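/- **Theorem.** For a finite simple undirected graph $G=(V,E)$ and $k,r\in\mathbb N$, a *$(k,r)$-center* of $G$ is a set $K\subseteq V$ with $|K|\le k$ such that every $u\in V\setminus K$ satisfies $d(v,u)\le r$ for some $v\in K$, where $d(v,u)$ is the least number of edges of a path from $v$ to $u$ in $G$ ($\infty$ if there is none). *Unweighted $(k,r)$-Center* is the problem of deciding, given $(G,k,r)$, whether $G$ has a $(k,r)$-center. The *tree-depth* $\mathrm{td}(G)$ is the minimum height (the maximum number of edges on a path from a root to a vertex, so that $\mathrm{td}(K_1)=0$) of a rooted forest whose completion, i.e. the graph obtained by joining each node to all its ancestors, contains $G$ as a subgraph. Unweighted $(k,r)$-Center can be solved in time $O^*\!\left(2^{O(\mathrm{td}(G)^2)}\right)$, where $O^*$ hides factors polynomial in the number of vertices of $G$. That is, there are a deterministic algorithm and a constant $C$ such that, for every graph $G$ with vertex set $\{0,\dots,n-1\}$ and all $k,r\in\mathbb N$, the algorithm, given $n$, $k$, $r$ and the adjacency matrix of $G$ (and neither a decomposition of $G$ nor the value of $\mathrm{td}(G)$), halts after at most $$2^{C\cdot \mathrm{td}(G)^2}\cdot C\,(n+1)^{C}$$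 steps, and answers $1$ if $G$ has a $(k,r)$-center and $0$ otherwise. Algorithms are programs of a random-access machine under the unit-cost measure: the memory consists of finitely many arrays of cells, each holding a natural number; the elementary operations, each of which takes one step, are constants, addition, truncated subtraction, reading and writing a cell at a computed index, and branching on whether a value is zero (conditionals and while-loops). There is no multiplication. -/

import Mathlib

/-! ### Random-access machines: structured programs, unit-cost time -/

namespace RAM

/-- The memory: finitely many banks (those that a program names) of cells indexed by `ℕ`, each cell
holding a natural number. `σ b i` is the content of cell `i` of bank `b`. -/
abbrev State : Type := ℕ → ℕ → ℕ

/-- Expressions. The bank in a memory access is fixed by the program text; the cell index is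
computed (indirect addressing). There is no multiplication, so that unit cost is polynomially
related to the time of a Turing machine. -/
inductive Expr : Type
  /-- a constant -/
  | lit (c : ℕ) : Expr
  /-- the content of the cell of bank `b` whose index is the value of `e` -/
  | read (b : ℕ) (e : Expr) : Expr
  /-- addition -/
  | add (e₁ e₂ : Expr) : Expr
  /-- truncated subtraction -/
  | sub (e₁ e₂ : Expr) : Expr

/-- The value of an expression in a memory state. -/
def Expr.eval (σ : State) : Expr → ℕ
  | .lit c => c
  | .read b e => σ b (e.eval σ)
  | .add e₁ e₂ => e₁.eval σ + e₂.eval σ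
  | .sub e₁ e₂ => e₁.eval σ - e₂.eval σ

/-- The time to evaluate an expression: one step for each operation in it. -/
def Expr.cost : Expr → ℕ
  | .lit _ => 1
  | .read _ e => e.cost + 1
  | .add e₁ e₂ => e₁.cost + e₂.cost + 1
  | .sub e₁ e₂ => e₁.cost + e₂.cost + 1

/-- Programs. -/
inductive Prog : Type
  /-- do nothing -/
  | skip : Prog
  /-- store the value of `e` in the cell of bank `b` whose index is the value of `a` -/
  | write (b : ℕ) (a e : Expr) : Prog
  /-- sequential composition -/
  | seq (p q : Prog) : Prog
  /-- run `p` if the value of `e` is nonzero, and `q` otherwise -/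
  | ite (e : Expr) (p q : Prog) : Prog
  /-- run `p` again and again as long as the value of `e` is nonzero -/
  | loop (e : Expr) (p : Prog) : Prog

/-- The memory state after storing `v` in cell `i` of bank `b`. -/
def State.store (σ : State) (b i v : ℕ) : State :=
  fun b' i' => if b' = b ∧ i' = i then v else σ b' i'

/-- `Exec p σ τ t`: program `p`, started in memory state `σ`, halts after exactly `t` steps
in memory state `τ`. -/
inductive Exec : Prog → State → State → ℕ → Prop
  | skip (σ : State) : Exec .skip σ σ 1
  | write (b : ℕ) (a e : Expr) (σ : State) :
      Exec (.write b a e) σ (σ.store b (a.eval σ) (e.eval σ)) (a.cost + e.cost + 1)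
  | seq {p q : Prog} {σ τ υ : State} {s t : ℕ} :
      Exec p σ τ s → Exec q τ υ t → Exec (.seq p q) σ υ (s + t)
  | ite_true {e : Expr} {p q : Prog} {σ τ : State} {t : ℕ} :
      e.eval σ ≠ 0 → Exec p σ τ t → Exec (.ite e p q) σ τ (e.cost + 1 + t)
  | ite_false {e : Expr} {p q : Prog} {σ τ : State} {t : ℕ} :
      e.eval σ = 0 → Exec q σ τ t → Exec (.ite e p q) σ τ (e.cost + 1 + t)
  | loop_done {e : Expr} {p : Prog} {σ : State} :
      e.eval σ = 0 → Exec (.loop e p) σ σ (e.cost + 1)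
  | loop_step {e : Expr} {p : Prog} {σ τ υ : State} {s t : ℕ} :
      e.eval σ ≠ 0 → Exec p σ τ s → Exec (.loop e p) τ υ t →
        Exec (.loop e p) σ υ (e.cost + 1 + s + t)

end RAM

/-! ### Tree-depth -/

/-- A rooted forest with vertex set `W`, given by its parent function (`none` at the roots). -/
structure RootedForest (W : Type) where
  parent : W → Option W
  wf : WellFounded fun a b => parent b = some a

namespace RootedForest

/-- `a` is a proper ancestor of `b`. -/
def IsAncestor {W : Type} (F : RootedForest W) (a b : W) : Prop :=
  Relation.TransGen (fun a b => F.parent b = some a) a b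

/-- The completion of the forest: each vertex is joined to all its proper ancestors. -/
def completion {W : Type} (F : RootedForest W) : SimpleGraph W :=
  SimpleGraph.fromRel F.IsAncestor

/-- The number of edges on the path from the root to `v`, i.e. of proper ancestors of `v`. -/
noncomputable def depth {W : Type} (F : RootedForest W) (v : W) : ℕ :=
  {a | F.IsAncestor a v}.ncard

/-- The height of a finite rooted forest: the largest number of edges on a path from a root
to a vertex. -/
noncomputable def height {W : Type} [Fintype W] (F : RootedForest W) : ℕ :=
  Finset.univ.sup F.depth

end RootedForest

/-- The tree-depth of a finite graph: the minimum height of a finite rooted forest whose completion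
contains the graph as a subgraph. Heights count edges, so a single vertex has tree-depth `0`. -/
noncomputable def treeDepth {V : Type} (G : SimpleGraph V) : ℕ :=
  sInf {h | ∃ (m : ℕ) (F : RootedForest (Fin m)), G.IsContained F.completion ∧ F.height = h}

/-! ### The unweighted (k, r)-center problem -/

/-- There is a set `K` of at most `k` vertices such that every vertex outside `K` is at distance at
most `r` from some vertex of `K`. The distance is the least number of edges of a walk, and `⊤` for
vertices in different components. -/
def HasCenter {V : Type} (G : SimpleGraph V) (k r : ℕ) : Prop :=
  ∃ K : Finset V, K.card ≤ k ∧ ∀ u, u ∉ K → ∃ v ∈ K, G.edist v u ≤ r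

open Classical in
/-- The initial memory for the instance `(G, k, r)`: the number `n` of vertices, `k` and `r` in
cell `0` of the banks `0`, `1`, `2`, the adjacency matrix of `G` row by row in bank `3`, and `0` in
every other cell. -/
noncomputable def inputState {n : ℕ} (G : SimpleGraph (Fin n)) (k r : ℕ) : RAM.State :=
  fun b a =>
    if b = 0 ∧ a = 0 then n
    else if b = 1 ∧ a = 0 then k
    else if b = 2 ∧ a = 0 then r
    else if b = 3 ∧ ∃ i j : Fin n, G.Adj i j ∧ a = i * n + j then 1
    else 0

/-! The algorithm is variable elimination along an order of small width, where the order is found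
without a decomposition. Let t = td(G) + 1, the tree-depth counted in vertices.

Labellings. A (k,r)-center amounts to a labelling of the vertices by numbers up to r, with at most k
zeros, in which every vertex with a positive label has a neighbor with a strictly smaller label
(`hasCenter_iff`). Connected vertices have distance at most 2^t - 2 (`TD.near`), so labels up to 2^t
suffice. A partial solution matters to the rest of the graph only through the labels of its boundary
vertices, one bit each (a smaller neighbor has been seen), and the number of centers used. A
boundary of w vertices thus has at most (2(2^t+1))^w (k+1) states, which is 2^{O(t²)} (n+1) when w =
O(t) and k ≤ n. Elimination with untruncated tables is exact (`total_correct`).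

The order. It is built from its end: a set A of placed vertices grows such that every component
outside A has at most 2t+1 neighbors in A. For a component with neighborhood W, bounded tree-depth
gives a set S₀ of at most t vertices whose removal leaves no component with more than half of W
(`TD.exists_balanced`). Placing one vertex v of the component together with such a separator leaves
neighborhoods of size at most t + (t+1). A suitable separator is found by branching: if a guess S of
at most t vertices fails, two vertices of W are joined by a short path outside S but are not
connected outside S₀, so the path contains a vertex of S₀ \ S (`exists_extension`). There are at
most (2t+1)²(2^t+1) choices per level and t levels, again 2^{O(t²)}. Inside one placement at most
t+1 further vertices count, so the boundaries in the elimination have at most 3t+2 vertices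
(`order_narrow`).

Unknown tree-depth. All candidate lists and tables are cut off at a cap. A truncated table is
recorded by a flag, and an answer without truncation is right for any parameters (`attempt_sound`).
With the right t and a cap parameter N ≥ 2^{18t²} nothing relevant is truncated (`attempt_ne_zero`).
The program runs through N = 2^m for m = 0, 1, 2, …, trying all tree-depths up to m each time, and
stops at m ≤ 18t² (`exists_search`).

The machine. `PT` is the class of functions computed by programs in time polynomial in the size of
the argument, numbers counting in unary. It is closed under composition, case distinction and loops
with polynomially bounded intermediate results, so `answer` is polynomial in the input and N
(`answer_PT`). Since N is a unary argument, 2^{O(t²)} enters the running time only through N. -/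

/-! ### Structured data in the memory of the machine -/

/-- Binary trees with natural numbers at the leaves. -/
inductive Data : Type
  | atom (n : ℕ) : Data
  | cons (a b : Data) : Data

/-- The size of a tree; the numbers at the leaves count in unary. -/
def Data.size : Data → ℕ
  | .atom n => n + 1
  | .cons a b => a.size + b.size + 1

namespace RAM

/-- Word `w` represents the tree: a leaf represents itself, an inner node is the address of a pair in the
banks `13` and `14`, below the heap top, which is stored in bank `12`. -/
def Rep (σ : State) : ℕ → Data → Prop
  | w, .atom n => w = n
  | w, .cons a b => 0 < w ∧ w < σ 12 0 ∧ Rep σ (σ 13 w) a ∧ Rep σ (σ 14 w) b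

/-- The heap of `τ` extends that of `σ`. -/
def Ext (σ τ : State) : Prop :=
  σ 12 0 ≤ τ 12 0 ∧ ∀ w < σ 12 0, τ 13 w = σ 13 w ∧ τ 14 w = σ 14 w

theorem Ext.refl (σ : State) : Ext σ σ := ⟨le_rfl, fun _ _ => ⟨rfl, rfl⟩⟩

theorem Ext.trans {σ τ υ : State} (h₁ : Ext σ τ) (h₂ : Ext τ υ) : Ext σ υ := by
  refine ⟨h₁.1.trans h₂.1, fun w hw => ?_⟩
  have h := h₂.2 w (hw.trans_le h₁.1)
  have h' := h₁.2 w hw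
  exact ⟨h.1.trans h'.1, h.2.trans h'.2⟩

/-- Heap cells are never overwritten, so no step of a program can spoil a tree that is already
represented, and subtrees may be shared freely. -/
theorem Rep.mono {σ τ : State} (h : Ext σ τ) : ∀ {d : Data} {w : ℕ}, Rep σ w d → Rep τ w d
  | .atom _, _, hw => hw
  | .cons _ _, w, hw => by
    obtain ⟨h0, h1, h2, h3⟩ := hw
    refine ⟨h0, h1.trans_le h.1, ?_, ?_⟩
    · rw [(h.2 w h1).1]; exact Rep.mono h h2
    · rw [(h.2 w h1).2]; exact Rep.mono h h3

/-- Addresses of pairs are positive. Words carry no type tags, but this makes a test for zero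
recognize the number 0, `false` and the empty list. -/
theorem Rep.eq_zero_iff {σ : State} {d : Data} {w : ℕ} (h : Rep σ w d) :
    w = 0 ↔ d = .atom 0 := by
  cases d with
  | atom n => simp only [Rep] at h; simp [h]
  | cons a b => simp only [reduceCtorEq, iff_false]; exact h.1.ne'

/-- The content of cell `0` of a bank. -/
abbrev reg (b : ℕ) : Expr := .read b (.lit 0)

/-- A sequence of assignments. -/
def assign : List (ℕ × Expr × Expr) → Prog
  | [] => .skip
  | (b, a, e) :: l => .seq (.write b a e) (assign l)

/-- The memory after a sequence of assignments. -/
def assigned : List (ℕ × Expr × Expr) → State → State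
  | [], σ => σ
  | (b, a, e) :: l, σ => assigned l (σ.store b (a.eval σ) (e.eval σ))

/-- The time of a sequence of assignments. -/
def assignCost : List (ℕ × Expr × Expr) → ℕ
  | [] => 1
  | (_, a, e) :: l => a.cost + e.cost + 1 + assignCost l

theorem exec_assign : ∀ (l : List (ℕ × Expr × Expr)) (σ : State),
    Exec (assign l) σ (assigned l σ) (assignCost l)
  | [], σ => .skip σ
  | (_, _, _) :: l, _ => .seq (.write _ _ _ _) (exec_assign l _)

/-- Started with a representation of `x` in the accumulator (bank `10`), the program `p` ends within `T` steps
with a representation of `y`; it preserves the stack pointer (bank `11`) and only extends the heap. -/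
def Runs (p : Prog) (x y : Data) (T : ℕ) : Prop :=
  ∀ σ : State, 0 < σ 12 0 → Rep σ (σ 10 0) x →
    ∃ τ t, Exec p σ τ t ∧ t ≤ T ∧ Ext σ τ ∧ τ 11 0 = σ 11 0 ∧ Rep τ (τ 10 0) y

theorem Runs.mono {p : Prog} {x y : Data} {T T' : ℕ} (h : Runs p x y T) (hT : T ≤ T') :
    Runs p x y T' := fun σ h0 hx =>
  let ⟨τ, t, h1, h2, h3⟩ := h σ h0 hx
  ⟨τ, t, h1, h2.trans hT, h3⟩

theorem Runs.id (x : Data) : Runs .skip x x 1 := fun σ _ hx =>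
  ⟨σ, 1, .skip σ, le_rfl, .refl σ, rfl, hx⟩

theorem Runs.comp {p q : Prog} {x y z : Data} {S T : ℕ} (hp : Runs p x y S) (hq : Runs q y z T) :
    Runs (.seq p q) x z (S + T) := fun σ h0 hx => by
  obtain ⟨τ, s, h1, h2, h3, h4, h5⟩ := hp σ h0 hx
  obtain ⟨υ, t, k1, k2, k3, k4, k5⟩ := hq τ (h0.trans_le h3.1) h5
  exact ⟨υ, s + t, h1.seq k1, add_le_add h2 k2, h3.trans k3, k4.trans h4, k5⟩

/-- Setting the accumulator. -/
theorem Runs.set {e : Expr} {x y : Data} (h : ∀ σ, Rep σ (σ 10 0) x → Rep σ (e.eval σ) y) :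
    Runs (.write 10 (.lit 0) e) x y (e.cost + 2) := fun σ _ hx => by
  have hE : Ext σ (σ.store 10 0 (e.eval σ)) :=
    ⟨by simp [State.store], by simp [State.store]⟩
  refine ⟨_, _, .write _ _ _ _, by simp [Expr.cost]; omega, hE, by simp [State.store], ?_⟩
  simpa [State.store, Expr.eval] using (h σ hx).mono hE

theorem Runs.atom (x : Data) (n : ℕ) : Runs (.write 10 (.lit 0) (.lit n)) x (.atom n) 3 :=
  .set fun _ _ => rfl

theorem Runs.fst (x y : Data) :
    Runs (.write 10 (.lit 0) (.read 13 (reg 10))) (.cons x y) x 5 :=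
  .set fun _ h => h.2.2.1

theorem Runs.snd (x y : Data) :
    Runs (.write 10 (.lit 0) (.read 14 (reg 10))) (.cons x y) y 5 :=
  .set fun _ h => h.2.2.2

theorem Runs.add (m n : ℕ) :
    Runs (.write 10 (.lit 0) (.add (.read 13 (reg 10)) (.read 14 (reg 10))))
      (.cons (.atom m) (.atom n)) (.atom (m + n)) 9 :=
  .set fun σ h => by
    obtain ⟨-, -, h1, h2⟩ := h
    simp only [Rep] at h1 h2
    simp [Rep, Expr.eval, h1, h2]

theorem Runs.sub (m n : ℕ) :
    Runs (.write 10 (.lit 0) (.sub (.read 13 (reg 10)) (.read 14 (reg 10))))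
      (.cons (.atom m) (.atom n)) (.atom (m - n)) 9 :=
  .set fun σ h => by
    obtain ⟨-, -, h1, h2⟩ := h
    simp only [Rep] at h1 h2
    simp [Rep, Expr.eval, h1, h2]

/-! ### Stack operations and control structures -/

/-- Push the accumulator onto the stack. -/
def push : List (ℕ × Expr × Expr) :=
  [(13, reg 12, reg 10), (14, reg 12, reg 11), (11, .lit 0, reg 12),
    (12, .lit 0, .add (reg 12) (.lit 1))]

/-- Exchange the accumulator and the top of the stack. -/
def exchange : List (ℕ × Expr × Expr) :=
  [(15, .lit 0, .read 13 (reg 11)), (11, .lit 0, .read 14 (reg 11)), (13, reg 12, reg 10),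
    (14, reg 12, reg 11), (11, .lit 0, reg 12), (12, .lit 0, .add (reg 12) (.lit 1)),
    (10, .lit 0, reg 15)]

/-- Replace the top of the stack and the accumulator by a pair. -/
def popPair : List (ℕ × Expr × Expr) :=
  [(13, reg 12, .read 13 (reg 11)), (14, reg 12, reg 10), (11, .lit 0, .read 14 (reg 11)),
    (10, .lit 0, reg 12), (12, .lit 0, .add (reg 12) (.lit 1))]

/-- Move the accumulator to bank `15` and pop the accumulator. -/
def popSave : List (ℕ × Expr × Expr) :=
  [(15, .lit 0, reg 10), (10, .lit 0, .read 13 (reg 11)), (11, .lit 0, .read 14 (reg 11))]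

theorem push_spec (σ : State) :
    Ext σ (assigned push σ) ∧ assigned push σ 10 0 = σ 10 0 ∧ assigned push σ 11 0 = σ 12 0 ∧
      assigned push σ 12 0 = σ 12 0 + 1 ∧ assigned push σ 13 (σ 12 0) = σ 10 0 ∧
      assigned push σ 14 (σ 12 0) = σ 11 0 := by
  refine ⟨⟨?_, fun w hw => ?_⟩, ?_⟩ <;>
    simp [push, assigned, State.store, Expr.eval]
  exact ⟨fun h => absurd h hw.ne, fun h => absurd h hw.ne⟩

theorem exchange_spec (σ : State) :
    Ext σ (assigned exchange σ) ∧ assigned exchange σ 10 0 = σ 13 (σ 11 0) ∧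
      assigned exchange σ 11 0 = σ 12 0 ∧ assigned exchange σ 12 0 = σ 12 0 + 1 ∧
      assigned exchange σ 13 (σ 12 0) = σ 10 0 ∧
      assigned exchange σ 14 (σ 12 0) = σ 14 (σ 11 0) := by
  refine ⟨⟨?_, fun w hw => ?_⟩, ?_⟩ <;>
    simp [exchange, assigned, State.store, Expr.eval]
  exact ⟨fun h => absurd h hw.ne, fun h => absurd h hw.ne⟩

/-- The bound on the stack pointer keeps the cell being popped apart from the fresh cell that
receives the pair. -/
theorem popPair_spec (σ : State) (h : σ 11 0 < σ 12 0) :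
    Ext σ (assigned popPair σ) ∧ assigned popPair σ 10 0 = σ 12 0 ∧
      assigned popPair σ 11 0 = σ 14 (σ 11 0) ∧ assigned popPair σ 12 0 = σ 12 0 + 1 ∧
      assigned popPair σ 13 (σ 12 0) = σ 13 (σ 11 0) ∧
      assigned popPair σ 14 (σ 12 0) = σ 10 0 := by
  refine ⟨⟨?_, fun w hw => ?_⟩, ?_⟩ <;>
    simp [popPair, assigned, State.store, Expr.eval, h.ne]
  exact ⟨fun h => absurd h hw.ne, fun h => absurd h hw.ne⟩

theorem popSave_spec (σ : State) :
    Ext σ (assigned popSave σ) ∧ assigned popSave σ 10 0 = σ 13 (σ 11 0) ∧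
      assigned popSave σ 11 0 = σ 14 (σ 11 0) ∧ assigned popSave σ 12 0 = σ 12 0 ∧
      assigned popSave σ 15 0 = σ 10 0 := by
  refine ⟨⟨?_, fun w hw => ?_⟩, ?_⟩ <;>
    simp [popSave, assigned, State.store, Expr.eval]

/-- The input waits on the stack while `p` runs and is then exchanged for the result of `p`. The
stack is a linked list in the heap, so `Ext` protects its contents; the subprograms only have to
restore the stack pointer. -/
theorem Runs.pair {p q : Prog} {x y z : Data} {S T : ℕ} (hp : Runs p x y S) (hq : Runs q x z T) :
    Runs (.seq (assign push) (.seq p (.seq (assign exchange) (.seq q (assign popPair))))) x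
      (.cons y z) (S + T + 150) := fun σ h0 hx => by
  obtain ⟨e1, a1, s1, t1, c1, d1⟩ := push_spec σ
  set σ₁ := assigned push σ with hσ₁
  obtain ⟨σ₂, t₂, x2, l2, e2, s2, r2⟩ := hp σ₁ (by omega) (a1 ▸ hx.mono e1)
  have hlt1 : σ 12 0 < σ₁ 12 0 := by omega
  obtain ⟨e3, a3, s3, t3, c3, d3⟩ := exchange_spec σ₂
  have k1 := e2.2 _ hlt1
  set σ₃ := assigned exchange σ₂ with hσ₃
  have a3' : σ₃ 10 0 = σ 10 0 := by rw [a3, s2, s1, k1.1, c1]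
  have d3' : σ₃ 14 (σ₂ 12 0) = σ 11 0 := by rw [d3, s2, s1, k1.2, d1]
  have e13 : Ext σ σ₃ := (e1.trans e2).trans e3
  obtain ⟨σ₄, t₄, x4, l4, e4, s4, r4⟩ := hq σ₃ (by omega) (a3' ▸ hx.mono e13)
  have hlt4 : σ₄ 11 0 < σ₄ 12 0 := by have := e4.1; omega
  obtain ⟨e5, a5, s5, t5, c5, d5⟩ := popPair_spec σ₄ hlt4
  have k2 := e4.2 (σ₂ 12 0) (by omega)
  refine ⟨_, _, (exec_assign push σ).seq (x2.seq ((exec_assign exchange σ₂).seq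
    (x4.seq (exec_assign popPair σ₄)))), ?_, e13.trans (e4.trans e5), ?_, ?_⟩
  · simp [push, exchange, popPair, assignCost, Expr.cost]; omega
  · rw [s5, s4, s3, k2.2, d3']
  · rw [a5]
    refine ⟨?_, by omega, ?_, ?_⟩
    · have := e4.1; omega
    · rw [c5, s4, s3, k2.1, c3]
      exact r2.mono (e3.trans (e4.trans e5))
    · rw [d5]; exact r4.mono e5

/-- The condition may destroy the accumulator, so the input is pushed first; the tested word is
moved to the scratch bank `15` and the chosen branch sees the original input. -/
theorem Runs.cond {c p q : Prog} {x b y : Data} {R S T : ℕ} (hc : Runs c x b R)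
    (hp : b ≠ .atom 0 → Runs p x y S) (hq : b = .atom 0 → Runs q x y T) :
    Runs (.seq (assign push) (.seq c (.seq (assign popSave) (.ite (reg 15) p q)))) x
      y (R + S + T + 150) := fun σ h0 hx => by
  obtain ⟨e1, a1, s1, t1, c1, d1⟩ := push_spec σ
  set σ₁ := assigned push σ with hσ₁
  obtain ⟨σ₂, t₂, x2, l2, e2, s2, r2⟩ := hc σ₁ (by omega) (a1 ▸ hx.mono e1)
  obtain ⟨e3, a3, s3, t3, b3⟩ := popSave_spec σ₂
  have k1 := e2.2 (σ 12 0) (by omega)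
  set σ₃ := assigned popSave σ₂ with hσ₃
  have e13 : Ext σ σ₃ := (e1.trans e2).trans e3
  have a3' : σ₃ 10 0 = σ 10 0 := by rw [a3, s2, s1, k1.1, c1]
  have s3' : σ₃ 11 0 = σ 11 0 := by rw [s3, s2, s1, k1.2, d1]
  have hx3 : Rep σ₃ (σ₃ 10 0) x := a3' ▸ hx.mono e13
  have h03 : 0 < σ₃ 12 0 := h0.trans_le e13.1
  by_cases hb : b = .atom 0
  · obtain ⟨τ, t, y1, y2, y3, y4, y5⟩ := hq hb σ₃ h03 hx3
    refine ⟨τ, _, (exec_assign push σ).seq (x2.seq ((exec_assign popSave σ₂).seq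
      (.ite_false ?_ y1))), ?_, e13.trans y3, y4.trans s3', y5⟩
    · change σ₃ 15 0 = 0
      rw [b3]; exact r2.eq_zero_iff.2 hb
    · simp [push, popSave, assignCost, Expr.cost]; omega
  · obtain ⟨τ, t, y1, y2, y3, y4, y5⟩ := hp hb σ₃ h03 hx3
    refine ⟨τ, _, (exec_assign push σ).seq (x2.seq ((exec_assign popSave σ₂).seq
      (.ite_true ?_ y1))), ?_, e13.trans y3, y4.trans s3', y5⟩
    · change σ₃ 15 0 ≠ 0
      rw [b3]; exact fun h => hb (r2.eq_zero_iff.1 h)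
    · simp [push, popSave, assignCost, Expr.cost]; omega

/-- Every constant can be computed. -/
theorem Runs.exists_const : ∀ d : Data, ∃ p T, ∀ x, Runs p x d T
  | .atom n => ⟨_, _, fun x => .atom x n⟩
  | .cons a b =>
    let ⟨_, _, hp⟩ := Runs.exists_const a
    let ⟨_, _, hq⟩ := Runs.exists_const b
    ⟨_, _, fun x => (hp x).pair (hq x)⟩

/-- Iterating a program until the first component of the accumulator is zero. -/
inductive Iterates (p : Prog) (T : ℕ) : Data → Data → ℕ → Prop
  | done (s : Data) : Iterates p T (.cons (.atom 0) s) (.cons (.atom 0) s) 0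
  | step {c s y z : Data} {k : ℕ} : c ≠ .atom 0 → Runs p (.cons c s) y T → Iterates p T y z k →
      Iterates p T (.cons c s) z (k + 1)

theorem Iterates.runs {p : Prog} {T k : ℕ} {x y : Data} (h : Iterates p T x y k) :
    Runs (.loop (.read 13 (reg 10)) p) x y (k * (T + 4) + 4) := by
  induction h with
  | done s =>
    intro σ h0 hx
    exact ⟨σ, _, .loop_done hx.2.2.1, by simp [Expr.cost], .refl σ, rfl, hx⟩
  | @step c s y z k hc hp _ ih =>
    intro σ h0 hx
    obtain ⟨τ, t, h1, h2, h3, h4, h5⟩ := hp σ h0 hx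
    obtain ⟨υ, u, k1, k2, k3, k4, k5⟩ := ih τ (h0.trans_le h3.1) h5
    refine ⟨υ, _, .loop_step ?_ h1 k1, ?_, h3.trans k3, k4.trans h4, k5⟩
    · exact fun h => hc (hx.2.2.1.eq_zero_iff.1 h)
    · simp only [Expr.cost]
      have : (k + 1) * (T + 4) = k * (T + 4) + (T + 4) := by ring
      omega

end RAM

open RAM

/-! ### Polynomial-time functions -/

/-- An encoding of a type by trees. -/
class Enc (α : Type) where
  /-- the tree that stands for an element -/
  enc : α → Data

open Enc

instance : Enc ℕ := ⟨.atom⟩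
instance : Enc Bool := ⟨fun b => .atom b.toNat⟩
instance {α β : Type} [Enc α] [Enc β] : Enc (α × β) := ⟨fun x => .cons (enc x.1) (enc x.2)⟩

/-- Lists are nested pairs that end with the leaf `0`. -/
def encList {α : Type} [Enc α] : List α → Data
  | [] => .atom 0
  | a :: l => .cons (enc a) (encList l)

instance {α : Type} [Enc α] : Enc (List α) := ⟨encList⟩

/-- The size of the tree that stands for an element. -/
def sz {α : Type} [Enc α] (x : α) : ℕ := (enc x).size

section sz
variable {α β : Type} [Enc α] [Enc β]

@[simp] theorem sz_nat (n : ℕ) : sz n = n + 1 := rfl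
@[simp] theorem sz_prod (x : α × β) : sz x = sz x.1 + sz x.2 + 1 := rfl
@[simp] theorem sz_nil : sz ([] : List α) = 1 := rfl
@[simp] theorem sz_cons (a : α) (l : List α) : sz (a :: l) = sz a + sz l + 1 := rfl
theorem sz_bool (b : Bool) : sz b = b.toNat + 1 := rfl
theorem sz_bool_le (b : Bool) : sz b ≤ 2 := by cases b <;> simp [sz_bool]

theorem sz_pos (x : α) : 0 < sz x := by
  unfold sz; cases enc x <;> simp [Data.size]

theorem length_lt_sz (l : List α) : l.length < sz l := by
  induction l with
  | nil => simp
  | cons a l ih => simp; omega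

theorem sz_append (l l' : List α) : sz (l ++ l') + 1 = sz l + sz l' := by
  induction l with
  | nil => simp [Nat.add_comm]
  | cons a l ih => simp; omega

theorem sz_reverse (l : List α) : sz l.reverse = sz l := by
  induction l with
  | nil => simp
  | cons a l ih =>
    have := sz_append l.reverse [a]
    simp at this ⊢; omega

theorem sz_le_of_sublist {l l' : List α} (h : l.Sublist l') : sz l ≤ sz l' := by
  induction h with
  | slnil => simp
  | cons a _ ih => simp; omega
  | cons_cons a _ ih => simp; omega

theorem sz_perm {l l' : List α} (h : l.Perm l') : sz l = sz l' := by
  induction h with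
  | nil => rfl
  | cons a _ ih => simp [ih]
  | swap a b l => simp; omega
  | trans _ _ h₁ h₂ => exact h₁.trans h₂

theorem sz_le_of_subperm {l l' : List α} (h : l.Subperm l') : sz l ≤ sz l' := by
  obtain ⟨m, hm, h⟩ := h
  exact (sz_perm hm).symm.le.trans (sz_le_of_sublist h)

theorem sz_le_of_mem {a : α} {l : List α} (h : a ∈ l) : sz a < sz l := by
  induction l with
  | nil => simp at h
  | cons b l ih =>
    rcases List.mem_cons.1 h with rfl | h
    · simp only [sz_cons]; omega
    · have := ih h; simp only [sz_cons]; omega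

theorem sz_list_le {l : List α} {s : ℕ} (h : ∀ a ∈ l, sz a ≤ s) : sz l ≤ l.length * (s + 1) + 1 := by
  induction l with
  | nil => simp
  | cons a l ih =>
    have h1 := h a (by simp)
    have h2 := ih fun b hb => h b (by simp [hb])
    simp only [sz_cons, List.length_cons, add_mul]; omega

end sz

/-- Polynomially bounded functions. -/
def PB {α : Type} [Enc α] (g : α → ℕ) : Prop := ∃ c, ∀ x, g x ≤ (sz x + 2) ^ c

namespace PB
variable {α β : Type} [Enc α] [Enc β] {f g : α → ℕ}

theorem mono (hg : PB g) (h : ∀ x, f x ≤ g x) : PB f :=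
  let ⟨c, hc⟩ := hg
  ⟨c, fun x => (h x).trans (hc x)⟩

theorem const (k : ℕ) : PB fun _ : α => k :=
  ⟨k, fun x => (Nat.lt_two_pow_self).le.trans (Nat.pow_le_pow_left (by omega) k)⟩

theorem size : PB fun x : α => sz x := ⟨1, fun x => by simp⟩

theorem mul (hf : PB f) (hg : PB g) : PB fun x => f x * g x := by
  obtain ⟨c, hc⟩ := hf
  obtain ⟨d, hd⟩ := hg
  exact ⟨c + d, fun x => by rw [pow_add]; exact Nat.mul_le_mul (hc x) (hd x)⟩

theorem add (hf : PB f) (hg : PB g) : PB fun x => f x + g x := by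
  obtain ⟨c, hc⟩ := hf
  obtain ⟨d, hd⟩ := hg
  refine ⟨c + d + 1, fun x => ?_⟩
  have h1 : (sz x + 2) ^ c ≤ (sz x + 2) ^ (c + d) := Nat.pow_le_pow_right (by omega) (by omega)
  have h2 : (sz x + 2) ^ d ≤ (sz x + 2) ^ (c + d) := Nat.pow_le_pow_right (by omega) (by omega)
  have h3 : (sz x + 2) ^ (c + d + 1) = (sz x + 2) ^ (c + d) * sz x + 2 * (sz x + 2) ^ (c + d) := by
    ring
  have := hc x
  have := hd x
  change f x + g x ≤ _
  omega

theorem pow (hf : PB f) (k : ℕ) : PB fun x => f x ^ k := by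
  induction k with
  | zero => simpa using const 1
  | succ k ih => simpa only [pow_succ] using ih.mul hf

theorem comp {g : β → ℕ} {h : α → β} (hg : PB g) (hh : PB fun x => sz (h x)) :
    PB fun x => g (h x) := by
  obtain ⟨c, hc⟩ := hg
  exact ((hh.add (const 2)).pow c).mono fun x => hc (h x)

end PB

/-- Functions computed by a program in polynomial time. -/
@[fun_prop]
def PT {α β : Type} [Enc α] [Enc β] (f : α → β) : Prop :=
  ∃ (p : Prog) (T : α → ℕ), PB T ∧ PB (fun x => sz (f x)) ∧
    ∀ x, Runs p (enc x) (enc (f x)) (T x)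

namespace PT
variable {α β γ δ : Type} [Enc α] [Enc β] [Enc γ] [Enc δ]

theorem size {f : α → β} (hf : PT f) : PB fun x => sz (f x) :=
  let ⟨_, _, _, h, _⟩ := hf
  h

theorem value {f : α → ℕ} (hf : PT f) : PB f := hf.size.mono fun x => by simp

theorem length {f : α → List β} (hf : PT f) : PB fun x => (f x).length :=
  hf.size.mono fun x => (length_lt_sz (f x)).le

@[fun_prop]
theorem id : PT fun x : α => x := ⟨_, _, .const 1, .size, fun _ => .id _⟩

@[fun_prop]
theorem const (b : β) : PT fun _ : α => b :=
  let ⟨p, T, h⟩ := Runs.exists_const (enc b)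
  ⟨p, _, .const T, .const _, fun x => h (enc x)⟩

@[fun_prop]
theorem comp {g : β → γ} {f : α → β} (hg : PT g) (hf : PT f) : PT fun x => g (f x) := by
  obtain ⟨q, S, hS, hs, hq⟩ := hg
  obtain ⟨p, T, hT, ht, hp⟩ := hf
  exact ⟨_, _, hT.add (hS.comp ht), hs.comp ht, fun x => (hp x).comp (hq (f x))⟩

@[fun_prop]
theorem mk {f : α → β} {g : α → γ} (hf : PT f) (hg : PT g) : PT fun x => (f x, g x) := by
  obtain ⟨p, T, hT, ht, hp⟩ := hf
  obtain ⟨q, S, hS, hs, hq⟩ := hg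
  exact ⟨_, _, (hT.add hS).add (.const _), (ht.add hs).add (.const 1),
    fun x => (hp x).pair (hq x)⟩

@[fun_prop]
theorem fst {f : α → β × γ} (hf : PT f) : PT fun x => (f x).1 :=
  comp (g := Prod.fst) ⟨_, _, .const 5, PB.size.mono fun x => by simp; omega,
    fun _ => .fst _ _⟩ hf

@[fun_prop]
theorem snd {f : α → β × γ} (hf : PT f) : PT fun x => (f x).2 :=
  comp (g := Prod.snd) ⟨_, _, .const 5, PB.size.mono fun x => by simp; omega,
    fun _ => .snd _ _⟩ hf

@[fun_prop]
theorem add {f g : α → ℕ} (hf : PT f) (hg : PT g) : PT fun x => f x + g x :=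
  comp (g := fun p : ℕ × ℕ => p.1 + p.2) ⟨_, _, .const 9, PB.size.mono fun x => by simp; omega,
    fun _ => .add _ _⟩ (hf.mk hg)

@[fun_prop]
theorem sub {f g : α → ℕ} (hf : PT f) (hg : PT g) : PT fun x => f x - g x :=
  comp (g := fun p : ℕ × ℕ => p.1 - p.2) ⟨_, _, .const 9, PB.size.mono fun x => by simp; omega,
    fun _ => .sub _ _⟩ (hf.mk hg)

/-- Reading an encoding as another one. -/
theorem cast {g : α → γ} (f : α → β) (hf : PT f) (h : ∀ x, enc (f x) = enc (g x)) : PT g := by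
  obtain ⟨p, T, hT, ht, hp⟩ := hf
  refine ⟨p, T, hT, ?_, fun x => h x ▸ hp x⟩
  simpa only [sz, h] using ht

@[fun_prop]
theorem list_cons {f : α → β} {g : α → List β} (hf : PT f) (hg : PT g) :
    PT fun x => f x :: g x := cast _ (hf.mk hg) fun _ => rfl

@[fun_prop]
theorem toNat {f : α → Bool} (hf : PT f) : PT fun x => (f x).toNat := cast _ hf fun _ => rfl

@[fun_prop]
theorem cond {c : α → Bool} {f g : α → β} (hc : PT c) (hf : PT f) (hg : PT g) :
    PT fun x => bif c x then f x else g x := by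
  obtain ⟨p, T, hT, ht, hp⟩ := hf
  obtain ⟨q, S, hS, hs, hq⟩ := hg
  obtain ⟨r, R, hR, hr, hr'⟩ := hc
  refine ⟨_, _, ((hR.add hT).add hS).add (.const _), (ht.add hs).mono fun x => ?_,
    fun x => (hr' x).cond (p := p) (q := q) (fun hb => ?_) fun hb => ?_⟩
  · change sz (bif c x then f x else g x) ≤ _
    cases c x <;> simp
  · have : c x = true := by
      cases h : c x
      · exact absurd (by rw [h]; rfl) hb
      · rfl
    simpa [this] using hp x
  · have : c x = false := by
      cases h : c x
      · rfl
      · rw [h] at hb; cases hb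
    simpa [this] using hq x

/-- Case distinction on a list. -/
theorem casesList {l : α → List β} {f : α → β × List β → γ} {g : α → γ} {h : α → γ} (hl : PT l)
    (hf : PT fun x : α × β × List β => f x.1 x.2) (hg : PT g)
    (h₁ : ∀ x b l', l x = b :: l' → h x = f x (b, l')) (h₂ : ∀ x, l x = [] → h x = g x) : PT h := by
  obtain ⟨p, T, hT, ht, hp⟩ := hf
  obtain ⟨q, S, hS, hs, hq⟩ := hg
  obtain ⟨r, R, hR, hr, hr'⟩ := hl
  have hR' : PB fun x => (sz x + sz (l x) + 1 + 2) := (((PB.size.add hr).add (.const 1))).add (.const 2)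
  obtain ⟨c, hc⟩ := hT
  obtain ⟨d, hd⟩ := ht
  refine ⟨_, _, ((hR.add (((PB.const 1).add hR |>.add (.const 150)).add (hR'.pow c))).add hS).add (.const _),
    ((hR'.pow d).add hs).mono fun x => ?_,
    fun x => (hr' x).cond (q := q)
      -- The tree of a nonempty list is the pair of its head and tail, so pairing the input with `l
      -- x` already gives the tree of `(x, b, l')`.
      (fun hb => ((Runs.id _).pair (hr' x)).comp (q := p) ?_) fun hb => ?_⟩
  · cases e : l x with
    | nil => rw [h₂ x e]; omega
    | cons b l' =>
      rw [h₁ x b l' e]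
      have := hd (x, b, l')
      simp only [sz_prod, sz_cons] at this ⊢
      refine this.trans ?_
      rw [← add_assoc (sz x), ← add_assoc (sz x)]
      simp
  · cases e : l x with
    | nil => rw [e] at hb; exact absurd rfl hb
    | cons b l' =>
      rw [h₁ x b l' e]
      exact (hp (x, b, l')).mono (hc _)
  · cases e : l x with
    | nil => rw [h₂ x e]; exact hq x
    | cons b l' => rw [e] at hb; cases hb

@[fun_prop]
theorem headD {l : α → List β} {d : α → β} (hl : PT l) (hd : PT d) :
    PT fun x => (l x).headD (d x) :=
  casesList (f := fun _ p => p.1) hl (by fun_prop) hd (by simp +contextual) (by simp +contextual)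

@[fun_prop]
theorem tail {l : α → List β} (hl : PT l) : PT fun x => (l x).tail :=
  casesList (f := fun _ p => p.2) (g := fun _ => []) hl (by fun_prop) (by fun_prop)
    (by simp +contextual) (by simp +contextual)

@[fun_prop]
theorem isEmpty {l : α → List β} (hl : PT l) : PT fun x => (l x).isEmpty :=
  casesList (f := fun _ _ => false) (g := fun _ => true) hl (by fun_prop) (by fun_prop)
    (by simp +contextual) (by simp +contextual)

/-- Iteration along a list, with a polynomial bound on the intermediate results. -/
theorem foldl {f : α → γ → β → γ} {a : α → γ} {l : α → List β}
    (hf : PT fun p : α × γ × β => f p.1 p.2.1 p.2.2) (ha : PT a) (hl : PT l)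
    {B : α → ℕ} (hB : PB B)
    (h : ∀ x l₁ l₂, l x = l₁ ++ l₂ → sz (l₁.foldl (f x) (a x)) ≤ B x) :
    PT fun x => (l x).foldl (f x) (a x) := by
  -- The loop state consists of the remaining list, the input and the accumulator. The remaining
  -- list also serves as the loop condition, because the empty list is the leaf `0`.
  have hbody : PT fun y : (β × List β) × α × γ => (y.1.2, y.2.1, f y.2.1 y.2.2 y.1.1) := by
    have := hf.comp (f := fun y : (β × List β) × α × γ => (y.2.1, y.2.2, y.1.1)) (by fun_prop)
    fun_prop
  have hpre : PT fun x => (l x, x, a x) := by fun_prop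
  obtain ⟨p, T, hT, ht, hp⟩ := hbody
  obtain ⟨c, hc⟩ := hT
  obtain ⟨q, S, hS, hs, hq⟩ := hpre
  have hX : PB fun x => sz (l x) + sz x + B x + 2 + 2 :=
    (((hl.size.add .size).add hB).add (.const 2)).add (.const 2)
  refine ⟨_, _, (((hS.add ((hl.length.mul ((hX.pow c).add (.const 4))).add (.const 4))).add
    (.const 5)).add (.const 5)), hB.mono fun x => h x (l x) [] (by simp),
    fun x => (((hq x).comp (Iterates.runs (p := p) ?_)).comp (.snd (.atom 0) _)).comp
      (.snd (enc x) _)⟩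
  have key : ∀ l₂ l₁, l x = l₁ ++ l₂ →
      Iterates p ((sz (l x) + sz x + B x + 2 + 2) ^ c) (enc (l₂, x, l₁.foldl (f x) (a x)))
        (.cons (.atom 0) (.cons (enc x) (enc ((l₁ ++ l₂).foldl (f x) (a x))))) l₂.length := by
    intro l₂
    induction l₂ with
    | nil => intro l₁ _; rw [List.append_nil]; exact Iterates.done _
    | cons b l₂ ih =>
      intro l₁ e
      have e' : l x = (l₁ ++ [b]) ++ l₂ := by simpa using e
      refine .step (y := enc (l₂, x, (l₁ ++ [b]).foldl (f x) (a x))) (fun h => by cases h) ?_ ?_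
      · have := hp ((b, l₂), x, l₁.foldl (f x) (a x))
        simp only [List.foldl_append, List.foldl_cons, List.foldl_nil]
        refine Runs.mono this ((hc _).trans (Nat.pow_le_pow_left ?_ c))
        have h1 := h x l₁ _ e
        have h2 : sz (b, l₂) ≤ sz (l x) := by
          rw [e]
          have := sz_append l₁ (b :: l₂)
          have := sz_pos l₁
          simp only [sz_cons, sz_prod] at *; omega
        simp only [sz_prod] at h2 ⊢
        omega
      · have := ih (l₁ ++ [b]) e'
        simpa using this
  exact key (l x) [] rfl

/-- Bounded iteration. -/
theorem iterate {f : α → γ → γ} {a : α → γ} {n : α → ℕ}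
    (hf : PT fun p : α × γ => f p.1 p.2) (ha : PT a) (hn : PT n)
    {B : α → ℕ} (hB : PB B) (h : ∀ x i, i ≤ n x → sz ((f x)^[i] (a x)) ≤ B x) :
    PT fun x => (f x)^[n x] (a x) := by
  have hbody : PT fun y : ℕ × α × γ => (y.1 - 1, y.2.1, f y.2.1 y.2.2) := by
    have := hf.comp (f := fun y : ℕ × α × γ => (y.2.1, y.2.2)) (by fun_prop)
    fun_prop
  have hpre : PT fun x => (n x, x, a x) := by fun_prop
  obtain ⟨p, T, hT, ht, hp⟩ := hbody
  obtain ⟨c, hc⟩ := hT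
  obtain ⟨q, S, hS, hs, hq⟩ := hpre
  have hX : PB fun x => n x + sz x + B x + 3 + 2 :=
    (((hn.value.add .size).add hB).add (.const 3)).add (.const 2)
  refine ⟨_, _, (((hS.add ((hn.value.mul ((hX.pow c).add (.const 4))).add (.const 4))).add
    (.const 5)).add (.const 5)), hB.mono fun x => h x (n x) le_rfl,
    fun x => (((hq x).comp (Iterates.runs (p := p) ?_)).comp (.snd (.atom 0) _)).comp
      (.snd (enc x) _)⟩
  have key : ∀ j i, i + j = n x →
      Iterates p ((n x + sz x + B x + 3 + 2) ^ c) (enc (j, x, (f x)^[i] (a x)))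
        (.cons (.atom 0) (.cons (enc x) (enc ((f x)^[n x] (a x))))) j := by
    intro j
    induction j with
    | zero => intro i e; obtain rfl : i = n x := by omega
              exact Iterates.done _
    | succ j ih =>
      intro i e
      refine .step (y := enc (j, x, (f x)^[i + 1] (a x))) (fun h => by cases h) ?_ ?_
      · have := hp (j + 1, x, (f x)^[i] (a x))
        rw [Function.iterate_succ_apply']
        refine Runs.mono this ((hc _).trans (Nat.pow_le_pow_left ?_ c))
        have h1 := h x i (by omega)
        simp only [sz_prod, sz_nat]
        omega
      · exact ih (i + 1) (by omega)
  exact key (n x) 0 (by omega)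

end PT

/-! ### Polynomial-time operations on lists, truth values and numbers -/

namespace PT
variable {α β γ δ : Type} [Enc α] [Enc β] [Enc γ] [Enc δ]

@[fun_prop]
theorem reverse {l : α → List β} (hl : PT l) : PT fun x => (l x).reverse := by
  have : PT fun x => (l x).foldl (fun acc b => b :: acc) [] := by
    refine foldl (by fun_prop) (by fun_prop) hl hl.size fun x l₁ l₂ e => ?_
    rw [List.foldl_flip_cons_eq_append, List.append_nil, List.map_id', sz_reverse, e]
    exact sz_le_of_sublist (List.sublist_append_left l₁ l₂)
  simpa only [List.foldl_flip_cons_eq_append, List.append_nil, List.map_id'] using this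

theorem foldr {f : α → β → γ → γ} {a : α → γ} {l : α → List β}
    (hf : PT fun p : α × β × γ => f p.1 p.2.1 p.2.2) (ha : PT a) (hl : PT l)
    {B : α → ℕ} (hB : PB B)
    (h : ∀ x l₁ l₂, l x = l₁ ++ l₂ → sz (l₂.foldr (f x) (a x)) ≤ B x) :
    PT fun x => (l x).foldr (f x) (a x) := by
  have : PT fun x => (l x).reverse.foldl (fun c b => f x b c) (a x) := by
    refine foldl ?_ ha (by fun_prop) hB fun x l₁ l₂ e => ?_
    · have := hf.comp (f := fun y : α × γ × β => (y.1, y.2.2, y.2.1)) (by fun_prop)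
      simpa using this
    · rw [← List.foldr_reverse]
      exact h x l₂.reverse l₁.reverse (by rw [← List.reverse_append, ← e, List.reverse_reverse])
  simpa only [List.foldl_reverse] using this

@[fun_prop]
theorem append {f g : α → List β} (hf : PT f) (hg : PT g) : PT fun x => f x ++ g x := by
  have h (l l' : List β) : l.foldr List.cons l' = l ++ l' := by simp
  have : PT fun x => (f x).foldr List.cons (g x) := by
    refine foldr (f := fun _ => List.cons) (by fun_prop) hg hf (hf.size.add hg.size) fun x l₁ l₂ e => ?_
    rw [h, e]
    have := sz_append l₂ (g x)
    have := sz_append l₁ l₂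
    have := sz_pos l₁
    omega
  simpa only [h] using this

/-- A bound for the size of lists whose elements come from another list. -/
theorem map_aux {f : α → β → γ} {l : α → List β} (hf : PT fun p : α × β => f p.1 p.2) (hl : PT l) :
    ∃ B : α → ℕ, PB B ∧ ∀ x, ∀ b ∈ l x, sz (f x b) ≤ B x := by
  obtain ⟨c, hc⟩ := hf.size
  refine ⟨_, (((PB.size (α := α)).add hl.size).add (.const 3)).pow c, fun x b hb => ?_⟩
  refine (hc (x, b)).trans (Nat.pow_le_pow_left ?_ c)
  have := sz_le_of_mem hb
  simp; omega

@[fun_prop]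
theorem flatMap {f : α → β → List γ} {l : α → List β} (hf : PT fun p : α × β => f p.1 p.2)
    (hl : PT l) : PT fun x => (l x).flatMap (f x) := by
  obtain ⟨B, hB, hb⟩ := map_aux hf hl
  have key (f : β → List γ) (l : List β) : l.foldr (fun b acc => f b ++ acc) [] = l.flatMap f := by
    induction l with
    | nil => rfl
    | cons b l ih => simp [ih]
  have hlen (f : β → List γ) (s : ℕ) (l : List β) (h : ∀ b ∈ l, sz (f b) ≤ s) :
      sz (l.flatMap f) ≤ l.length * s + 1 := by
    induction l with
    | nil => simp
    | cons b l ih =>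
      have h1 := h b (by simp)
      have h2 := ih fun b hb => h b (by simp [hb])
      have := sz_append (f b) (l.flatMap f)
      simp only [List.flatMap_cons, List.length_cons, add_mul]; omega
  have : PT fun x => (l x).foldr (fun b acc => f x b ++ acc) [] := by
    refine foldr ?_ (by fun_prop) hl ((hl.length.mul hB).add (.const 1)) fun x l₁ l₂ e => ?_
    · have := hf.comp (f := fun y : α × β × List γ => (y.1, y.2.1)) (by fun_prop)
      fun_prop
    · rw [key]
      refine (hlen _ (B x) _ fun b h => hb x b (by simp [e, h])).trans ?_
      have : l₂.length * B x ≤ (l x).length * B x := Nat.mul_le_mul_right _ (by simp [e])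
      omega
  simpa only [key] using this

@[fun_prop]
theorem map {f : α → β → γ} {l : α → List β} (hf : PT fun p : α × β => f p.1 p.2)
    (hl : PT l) : PT fun x => (l x).map (f x) := by
  have : PT fun x => (l x).flatMap fun b => [f x b] := by fun_prop
  simpa only [← List.map_eq_flatMap] using this

@[fun_prop]
theorem filter {f : α → β → Bool} {l : α → List β} (hf : PT fun p : α × β => f p.1 p.2)
    (hl : PT l) : PT fun x => (l x).filter (f x) := by
  have key (f : β → Bool) (l : List β) :
      (l.flatMap fun b => bif f b then [b] else []) = l.filter f := by
    induction l with
    | nil => rfl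
    | cons b l ih => cases h : f b <;> simp [ih, h]
  have : PT fun x => (l x).flatMap fun b => bif f x b then [b] else [] := by fun_prop
  simpa only [key] using this

@[fun_prop]
theorem not {f : α → Bool} (hf : PT f) : PT fun x => !(f x) := by
  have : PT fun x => bif f x then false else true := by fun_prop
  refine cast _ this fun x => ?_
  cases f x <;> rfl

@[fun_prop]
theorem and {f g : α → Bool} (hf : PT f) (hg : PT g) : PT fun x => f x && g x := by
  have : PT fun x => bif f x then g x else false := by fun_prop
  refine cast _ this fun x => ?_
  cases f x <;> rfl

@[fun_prop]
theorem or {f g : α → Bool} (hf : PT f) (hg : PT g) : PT fun x => f x || g x := by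
  have : PT fun x => bif f x then true else g x := by fun_prop
  refine cast _ this fun x => ?_
  cases f x <;> rfl

@[fun_prop]
theorem all {f : α → β → Bool} {l : α → List β} (hf : PT fun p : α × β => f p.1 p.2)
    (hl : PT l) : PT fun x => (l x).all (f x) := by
  have : PT fun x => ((l x).filter fun b => !(f x b)).isEmpty := by fun_prop
  refine cast _ this fun x => ?_
  congr 1
  rw [Bool.eq_iff_iff]
  simp

@[fun_prop]
theorem any {f : α → β → Bool} {l : α → List β} (hf : PT fun p : α × β => f p.1 p.2)
    (hl : PT l) : PT fun x => (l x).any (f x) := by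
  have : PT fun x => !((l x).all fun b => !(f x b)) := by fun_prop
  refine cast _ this fun x => ?_
  congr 1
  rw [Bool.eq_iff_iff]
  simp

/-- Booleans from numbers. -/
theorem isZero {f : α → ℕ} (hf : PT f) : PT fun x => f x == 0 := by
  have h : PT fun b : Bool => !b := by fun_prop
  obtain ⟨p, T, hT, ht, hp⟩ := hf
  obtain ⟨q, S, hS, hs, hq⟩ := const (α := α) false
  obtain ⟨r, R, hR, hr, hr'⟩ := const (α := α) true
  refine ⟨_, _, ((hT.add hS).add hR).add (.const 150), (PB.const 2).mono fun x => sz_bool_le _,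
    fun x => (hp x).cond (p := q) (q := r) (fun hb => ?_) fun hb => ?_⟩
  · have : (f x == 0) = false := beq_false_of_ne fun h => hb (by rw [h]; rfl)
    simpa only [this] using hq x
  · have h0 : f x = 0 := by injection hb
    have : (f x == 0) = true := by simp [h0]
    simpa only [this] using hr' x

@[fun_prop]
theorem ble {f g : α → ℕ} (hf : PT f) (hg : PT g) : PT fun x => Nat.ble (f x) (g x) := by
  refine cast _ (isZero (hf.sub hg)) fun x => ?_
  congr 1
  rw [Bool.eq_iff_iff, Nat.ble_eq, beq_iff_eq, Nat.sub_eq_zero_iff_le]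

@[fun_prop]
theorem beq {f g : α → ℕ} (hf : PT f) (hg : PT g) : PT fun x => f x == g x := by
  have : PT fun x => Nat.ble (f x) (g x) && Nat.ble (g x) (f x) := by fun_prop
  refine cast _ this fun x => ?_
  congr 1
  rw [Bool.eq_iff_iff, Bool.and_eq_true, Nat.ble_eq, Nat.ble_eq, beq_iff_eq]
  omega

@[fun_prop]
theorem beq_bool {f g : α → Bool} (hf : PT f) (hg : PT g) : PT fun x => f x == g x := by
  have : PT fun x => bif f x then g x else !(g x) := by fun_prop
  refine cast _ this fun x => ?_
  cases f x <;> cases g x <;> rfl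

@[fun_prop]
theorem list_length {l : α → List β} (hl : PT l) : PT fun x => (l x).length := by
  have h (l : List β) : l.foldr (fun _ n => n + 1) 0 = l.length := by
    induction l with
    | nil => rfl
    | cons b l ih => simp [ih]
  have : PT fun x => (l x).foldr (fun _ n => n + 1) 0 := by
    refine foldr (by fun_prop) (by fun_prop) hl hl.size fun x l₁ l₂ e => ?_
    rw [h, e, sz_nat]
    have := length_lt_sz (l₁ ++ l₂)
    simp at this; omega
  simpa only [h] using this

@[fun_prop]
theorem range {n : α → ℕ} (hn : PT n) : PT fun x => List.range (n x) := by
  have h (n i : ℕ) (hi : i ≤ n) : (fun p : ℕ × List ℕ => (p.1 - 1, (p.1 - 1) :: p.2))^[i] (n, []) =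
      (n - i, (List.range' (n - i) i)) := by
    induction i with
    | zero => rfl
    | succ i ih =>
      rw [Function.iterate_succ_apply', ih (by omega)]
      have : n - i - 1 = n - (i + 1) := by omega
      simp only [this, List.range'_succ, Prod.mk.injEq, true_and, List.cons.injEq]
      congr 1; omega
  have : PT fun x => ((fun p : ℕ × List ℕ => (p.1 - 1, (p.1 - 1) :: p.2))^[n x] (n x, [])).2 := by
    refine snd (iterate (f := fun _ (p : ℕ × List ℕ) => (p.1 - 1, (p.1 - 1) :: p.2))
      (B := fun x => (n x + 1) + (n x * (n x + 1 + 1) + 1) + 1) (by fun_prop) (by fun_prop) hn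
      (((hn.value.add (.const 1)).add ((hn.value.mul ((hn.value.add (.const 1)).add (.const 1))).add
        (.const 1))).add (.const 1)) fun x i hi => ?_)
    rw [h _ _ hi]
    have : sz (List.range' (n x - i) i) ≤ i * (n x + 1 + 1) + 1 := by
      refine (sz_list_le (s := n x + 1) fun a ha => ?_).trans (by simp)
      simp at ha
      rw [sz_nat]; omega
    have h2 : i * (n x + 1 + 1) ≤ n x * (n x + 1 + 1) := Nat.mul_le_mul_right _ hi
    simp only [sz_prod, sz_nat]
    omega
  refine cast _ this fun x => ?_
  rw [h _ _ le_rfl, Nat.sub_self, List.range_eq_range']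

-- The machine does not multiply; the product is the length of a list of `f x` concatenated blocks
-- of length `g x`, which is affordable because numbers count in unary.
@[fun_prop]
theorem mul {f g : α → ℕ} (hf : PT f) (hg : PT g) : PT fun x => f x * g x := by
  have : PT fun x => ((List.range (f x)).flatMap fun _ => List.range (g x)).length := by fun_prop
  refine cast _ this fun x => ?_
  simp [List.length_flatMap]

@[fun_prop]
theorem take {n : α → ℕ} {l : α → List β} (hn : PT n) (hl : PT l) :
    PT fun x => (l x).take (n x) := by
  have h (n : ℕ) (l : List β) : (l.foldl (fun (p : ℕ × List β) b =>
      (p.1 - 1, bif p.1 == 0 then p.2 else b :: p.2)) (n, [])) =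
        (n - l.length, (l.take n).reverse) := by
    suffices ∀ l' : List β, (l.foldl (fun (p : ℕ × List β) b =>
      (p.1 - 1, bif p.1 == 0 then p.2 else b :: p.2)) (n, l')) =
        (n - l.length, (l.take n).reverse ++ l') by simpa using this []
    induction l generalizing n with
    | nil => simp
    | cons b l ih =>
      intro l'
      rw [List.foldl_cons, ih]
      cases n <;> simp
  have : PT fun x => ((l x).foldl (fun (p : ℕ × List β) b =>
      (p.1 - 1, bif p.1 == 0 then p.2 else b :: p.2)) (n x, [])).2.reverse := by
    refine reverse (snd (foldl (f := fun _ (p : ℕ × List β) b =>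
      (p.1 - 1, bif p.1 == 0 then p.2 else b :: p.2)) (by fun_prop) (by fun_prop) hl
      (B := fun x => (n x + 1) + sz (l x) + 1) ((hn.size.add hl.size).add (.const 1))
      fun x l₁ l₂ e => ?_))
    rw [h]
    have h1 : sz (l₁.take (n x)) ≤ sz (l x) :=
      sz_le_of_sublist ((List.take_sublist _ _).trans (e ▸ List.sublist_append_left l₁ l₂))
    simp only [sz_prod, sz_nat, sz_reverse]; omega
  refine cast _ this fun x => ?_
  rw [h]; simp

@[fun_prop]
theorem getD {n : α → ℕ} {l : α → List β} {d : α → β} (hn : PT n) (hl : PT l) (hd : PT d) :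
    PT fun x => (l x).getD (n x) (d x) := by
  have h (i : ℕ) (l : List β) : List.tail^[i] l = l.drop i := by
    induction i with
    | zero => simp
    | succ i ih => rw [Function.iterate_succ_apply', ih, List.tail_drop]
  have : PT fun x => (List.tail^[n x] (l x)).headD (d x) := by
    refine headD (iterate (f := fun _ => List.tail) (by fun_prop) hl hn hl.size fun x i _ => ?_) hd
    rw [h]; exact sz_le_of_sublist (List.drop_sublist _ _)
  refine cast _ this fun x => ?_
  rw [h]
  simp [List.headD_eq_head?_getD, List.head?_drop, List.getD_eq_getElem?_getD]

open Classical in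
/-- Equality of two lists, given a test for the equality of their elements. -/
theorem listEq {e : β → β → Bool} (he : ∀ a b, e a b = true ↔ a = b)
    (hP : PT fun p : β × β => e p.1 p.2) {f g : α → List β} (hf : PT f) (hg : PT g) 
    {h : α → Bool} (hh : ∀ x, h x = true ↔ f x = g x) : PT h := by
  -- The fold strips one element of `l'` for each element of `l`; the flag says that `l` has been a
  -- prefix of `l'` so far. The lists are equal if the flag survives and nothing of `l'` is left.
  have key (l l' : List β) (b : Bool) : l.foldl (fun (p : List β × Bool) a =>
      (p.1.tail, p.2 && !p.1.isEmpty && e a (p.1.headD a))) (l', b) =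
        (l'.drop l.length, b && decide (l = l'.take l.length)) := by
    induction l generalizing l' b with
    | nil => simp
    | cons a l ih =>
      rw [List.foldl_cons, ih]
      cases l' with
      | nil => simp
      | cons c l' =>
        simp only [List.tail_cons, List.length_cons, List.drop_succ_cons, List.isEmpty_cons,
          Bool.not_false, Bool.and_true, List.headD_cons, List.take_succ_cons, List.cons.injEq,
          Prod.mk.injEq, true_and]
        rw [Bool.eq_iff_iff]
        simp [he, and_assoc]
        exact fun _ _ => decide_eq_true_iff
  have hb (b : Bool) : sz b ≤ 2 := sz_bool_le b
  have h1 : PT fun x => (f x).foldl (fun (p : List β × Bool) a =>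
      (p.1.tail, p.2 && !p.1.isEmpty && e a (p.1.headD a))) (g x, true) := by
    refine foldl (f := fun _ (p : List β × Bool) a => 
      (p.1.tail, p.2 && !p.1.isEmpty && e a (p.1.headD a))) ?_ (by fun_prop) hf
      (B := fun x => sz (g x) + 2 + 1) ((hg.size.add (.const 2)).add (.const 1))
      fun x l₁ l₂ _ => ?_
    · have := hP.comp (f := fun p : α × (List β × Bool) × β => (p.2.2, p.2.1.1.headD p.2.2))
        (by fun_prop)
      fun_prop
    · rw [key]
      have := sz_le_of_sublist (List.drop_sublist l₁.length (g x))
      have := hb (true && decide (l₁ = (g x).take l₁.length))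
      simp only [sz_prod]; omega
  have : PT fun x => ((f x).foldl (fun (p : List β × Bool) a =>
      (p.1.tail, p.2 && !p.1.isEmpty && e a (p.1.headD a))) (g x, true)).2 &&
      ((f x).foldl (fun (p : List β × Bool) a =>
      (p.1.tail, p.2 && !p.1.isEmpty && e a (p.1.headD a))) (g x, true)).1.isEmpty := by
    fun_prop
  refine cast _ this fun x => ?_
  congr 1
  rw [Bool.eq_iff_iff, hh, key]
  simp only [Bool.true_and, Bool.and_eq_true, decide_eq_true_eq, List.isEmpty_iff,
    List.drop_eq_nil_iff]
  constructor
  · rintro ⟨h1, h2⟩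
    rwa [List.take_of_length_le h2] at h1
  · intro h
    simp [h]

end PT

/-! ### The algorithm -/

namespace Center

/-- The list of arcs of a graph on natural numbers; an edge gives two arcs. -/
abbrev Arcs : Type := List (ℕ × ℕ)

/-- Adjacency. -/
def adj (E : Arcs) (u v : ℕ) : Bool := E.any fun p => p.1 == u && p.2 == v

/-- Membership. -/
def mem (v : ℕ) (l : List ℕ) : Bool := l.any fun x => x == v

/-- The vertices in `V` that are not in `A`. -/
def compl (V A : List ℕ) : List ℕ := V.filter fun x => !mem x A

/-- The vertices of `X` that are in `B` or adjacent to a vertex of `B`. -/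
def expand (E : Arcs) (X B : List ℕ) : List ℕ :=
  X.filter fun x => mem x B || B.any fun y => adj E y x

/-- The vertices at distance at most `i` from `v` in the subgraph induced by `X`. -/
def ball (E : Arcs) (X : List ℕ) (v i : ℕ) : List ℕ :=
  (expand E X)^[i] (X.filter fun x => x == v)

/-- A vertex of the ball around `a` of radius `i` that is equal or adjacent to the head of `p`. -/
def pathStep (E : Arcs) (X : List ℕ) (a b : ℕ) (p : List ℕ) (i : ℕ) : List ℕ :=
  ((ball E X a i).filter fun y => y == p.headD b || adj E y (p.headD b)).headD b :: p

/-- The vertices of a walk of length at most `L` from `a` to `b` in the subgraph induced by `X`. -/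
def path (E : Arcs) (X : List ℕ) (a b L : ℕ) : List ℕ :=
  (List.range L).reverse.foldl (pathStep E X a b) [b]

/-- The vertices of `A` adjacent to a vertex of `C`. -/
def bd (E : Arcs) (A C : List ℕ) : List ℕ := A.filter fun a => C.any fun y => adj E y a

/-- One level of the search for separators: all sets of the family, and all those that arise from a set `S` of
the family by adding a vertex of a path outside `S` between two vertices of `W`. -/
def famStep (E : Arcs) (V W : List ℕ) (L cap : ℕ) (Fs : List (List ℕ)) : List (List ℕ) :=
  (Fs ++ Fs.flatMap fun S => W.flatMap fun a => W.flatMap fun b =>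
    (path E (compl V S) a b L).map fun x => x :: S).take cap

/-- The candidates for separators of size at most `t`. -/
def fam (E : Arcs) (V W : List ℕ) (L cap t : ℕ) : List (List ℕ) :=
  (famStep E V W L cap)^[t] [[]]

/-- The vertices of `C` that are in `S` or equal to `v`. -/
def news (C : List ℕ) (v : ℕ) (S : List ℕ) : List ℕ := C.filter fun x => x == v || mem x S

/-- All components outside of `A` have at most `w` neighbors. -/
def narrow (E : Arcs) (V : List ℕ) (L w : ℕ) (A : List ℕ) : Bool :=
  (compl V A).all fun u => Nat.ble (bd E A (ball E (compl V A) u L)).length w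

/-- Place a vertex `v` and a separator in the component `C` of `v` in front of the list `A`. -/
def placeAt (E : Arcs) (V : List ℕ) (L w cap t : ℕ) (A : List ℕ) (v : ℕ) (C : List ℕ) : List ℕ :=
  news C v (((fam E V (bd E A C) L cap t).filter fun S =>
    narrow E V L w (news C v S ++ A)).headD []) ++ A

/-- Place some vertices in front of the list `A`, at least one if there are any left. -/
def place (E : Arcs) (V : List ℕ) (L w cap t : ℕ) (A : List ℕ) : List ℕ :=
  bif (compl V A).isEmpty then A else
    placeAt E V L w cap t A ((compl V A).headD 0) (ball E (compl V A) ((compl V A).headD 0) L)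

/-- An elimination order of all vertices. -/
def order (E : Arcs) (n L w cap t : ℕ) : List ℕ :=
  (place E (List.range n) L w cap t)^[n] []

/-- An entry of a table: a list of vertices, each with a label and a bit that says if a neighbor with a
smaller label has been seen; and a cost. -/
abbrev Entry : Type := List (ℕ × ℕ × Bool) × ℕ

/-- A factor: its scope, its table, and a bit that says that no table has been truncated. -/
abbrev Factor : Type := List ℕ × List Entry × Bool

/-- The label of a vertex. -/
def label (e : List (ℕ × ℕ × Bool)) (v : ℕ) : ℕ :=
  ((e.filter fun q => q.1 == v).map fun q => q.2.1).headD 0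

/-- The bit of a vertex. -/
def bit (e : List (ℕ × ℕ × Bool)) (v : ℕ) : Bool := e.any fun q => q.1 == v && q.2.2

/-- The common vertices have the same labels. -/
def compat (e f : List (ℕ × ℕ × Bool)) : Bool :=
  e.all fun p => f.all fun q => !(p.1 == q.1) || p.2.1 == q.2.1

/-- Combine two entries. -/
def merge (W : List ℕ) (e f : Entry) : Entry :=
  (W.map fun v => (v, label (e.1 ++ f.1) v, bit (e.1 ++ f.1) v), e.2 + f.2)

/-- Remove duplicates. -/
def dedup (T : List Entry) : List Entry :=
  T.foldr (fun a l => bif l.any (fun b => decide (b = a)) then l else a :: l) []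

/-- All combinations of two tables of cost at most `k`. -/
def joinTable (k : ℕ) (W : List ℕ) (T U : List Entry) : List Entry :=
  dedup (T.flatMap fun e => (U.filter fun e' => compat e.1 e'.1 && Nat.ble (e.2 + e'.2) k).map
    fun e' => merge W e e')

/-- The union of two scopes. -/
def joinScope (V W U : List ℕ) : List ℕ := V.filter fun v => mem v W || mem v U

/-- Combine two factors. -/
def join (V : List ℕ) (k cap : ℕ) (f g : Factor) : Factor :=
  (joinScope V f.1 g.1, (joinTable k (joinScope V f.1 g.1) f.2.1 g.2.1).take cap,
    f.2.2 && g.2.2 && Nat.ble (joinTable k (joinScope V f.1 g.1) f.2.1 g.2.1).length cap)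

/-- The vertex `v` has label `0`. -/
def isCenter (e : List (ℕ × ℕ × Bool)) (v : ℕ) : Bool := e.any fun q => q.1 == v && q.2.1 == 0

/-- Remove a vertex from a factor. -/
def forget (v k : ℕ) (f : Factor) : Factor :=
  (f.1.filter fun x => !(x == v),
    (f.2.1.filter fun e => (isCenter e.1 v || bit e.1 v) &&
      Nat.ble (e.2 + (isCenter e.1 v).toNat) k).map fun e =>
        (e.1.filter fun q => !(q.1 == v), e.2 + (isCenter e.1 v).toNat), f.2.2)

/-- The factor of a vertex. -/
def vertexFactor (R v : ℕ) : Factor :=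
  ([v], (List.range (R + 1)).map fun a => ([(v, a, false)], 0), true)

/-- The factor of an arc. -/
def arcFactor (R : ℕ) (p : ℕ × ℕ) : Factor :=
  ([p.1, p.2], (List.range (R + 1)).flatMap fun a => (List.range (R + 1)).map fun b =>
    ([(p.1, a, !Nat.ble a b), (p.2, b, false)], 0), true)

/-- Eliminate a vertex. -/
def elim (V : List ℕ) (k R cap : ℕ) (Fs : List Factor) (v : ℕ) : List Factor :=
  forget v k ((Fs.filter fun f => mem v f.1).foldl (join V k cap) (vertexFactor R v)) ::
    Fs.filter fun f => !mem v f.1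

/-- The factor that remains when all vertices have been eliminated. -/
def total (E : Arcs) (n k R cap : ℕ) (A : List ℕ) : Factor :=
  (A.foldl (elim (List.range n) k R cap) (E.map (arcFactor R))).foldl (join (List.range n) k cap)
    ([], [([], 0)], true)

/-- The answer from a factor: `0` for unknown, `1` for no, `2` for yes. -/
def verdict (f : Factor) : ℕ := bif f.2.2 then (bif f.2.1.isEmpty then 1 else 2) else 0

/-- All vertices that can be reached from a vertex can be reached in `L` steps. -/
def short (E : Arcs) (V : List ℕ) (L : ℕ) : Bool :=
  V.all fun v => (expand E V (ball E V v L)).all fun x => mem x (ball E V v L)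

/-- The minimum of two numbers. -/
def minimum (a b : ℕ) : ℕ := a - (a - b)

/-- `2 ^ t`, or `N` if that is smaller. -/
def cappedPow (t N : ℕ) : ℕ := (fun a => minimum (a + a) N)^[t] 1

/-- The answer for a given bound `L` on distances. -/
def attemptAt (E : Arcs) (n k r t N L : ℕ) : ℕ :=
  bif short E (List.range n) L then
    verdict (total E n k (minimum r L) (N * (n + 1)) (order E n L (2 * t + 1) N t))
  else 0

/-- The answer for given bounds on the tree-depth and the size of tables. -/
def attempt (E : Arcs) (n k r t N : ℕ) : ℕ := attemptAt E n k r t N (cappedPow t N)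

/-- The arcs of the graph with a given adjacency matrix. -/
def arcs (n : ℕ) (bits : List ℕ) : Arcs :=
  ((List.range n).flatMap fun i => (List.range n).map fun j => (i, j)).filter fun p =>
    !(bits.getD (p.1 * n + p.2) 0 == 0)

/-- The input of the algorithm: `n`, `k`, `r` and the adjacency matrix. -/
abbrev Input : Type := ℕ × ℕ × ℕ × List ℕ

/-- The first answer for tree-depths up to `m`. -/
def answer (x : Input) (m N : ℕ) : ℕ :=
  (((List.range (m + 1)).map fun t =>
    attempt (arcs x.1 x.2.2.2) x.1 x.2.1 x.2.2.1 t N).filter fun a => !(a == 0)).headD 0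

/-! ### The algorithm takes polynomial time -/

variable {α : Type} [Enc α] {E : α → Arcs} {V A C W X S : α → List ℕ} {n k r R t N m u v i L w cap a b : α → ℕ}

@[fun_prop]
theorem adj_PT (hE : PT E) (hu : PT u) (hv : PT v) : PT fun x => adj (E x) (u x) (v x) := by
  unfold adj; fun_prop

@[fun_prop]
theorem mem_PT (hv : PT v) (hX : PT X) : PT fun x => mem (v x) (X x) := by
  unfold mem; fun_prop

@[fun_prop]
theorem compl_PT (hV : PT V) (hA : PT A) : PT fun x => compl (V x) (A x) := by
  unfold compl; fun_prop

@[fun_prop]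
theorem expand_PT (hE : PT E) (hV : PT V) (hA : PT A) : PT fun x => expand (E x) (V x) (A x) := by
  unfold expand; fun_prop

/-- Gives the size bound that makes the iteration defining the ball polynomial. -/
theorem ball_sublist (E : Arcs) (X : List ℕ) (v : ℕ) (i : ℕ) : (ball E X v i).Sublist X := by
  unfold ball
  cases i with
  | zero => exact List.filter_sublist
  | succ i => rw [Function.iterate_succ_apply']; exact List.filter_sublist

@[fun_prop]
theorem ball_PT (hE : PT E) (hX : PT X) (hv : PT v) (hi : PT i) :
    PT fun x => ball (E x) (X x) (v x) (i x) := by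
  unfold ball
  exact PT.iterate (f := fun x => expand (E x) (X x)) (by fun_prop) (by fun_prop) hi hX.size
    fun x i _ => sz_le_of_sublist (ball_sublist _ _ _ _)

theorem headD_mem_or {β : Type} (l : List β) (d : β) : l.headD d ∈ l ∨ l.headD d = d := by
  cases l <;> simp

theorem mem_foldl_pathStep {E : Arcs} {X : List ℕ} {a b : ℕ} (l p : List ℕ)
    (hp : ∀ y ∈ p, y ∈ X ∨ y = b) : ∀ y ∈ l.foldl (pathStep E X a b) p, y ∈ X ∨ y = b := by
  induction l generalizing p with
  | nil => exact hp
  | cons i l ih =>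
    refine ih _ fun y hy => ?_
    rcases List.mem_cons.1 hy with rfl | hy
    · rcases headD_mem_or ((ball E X a i).filter fun y => y == p.headD b || adj E y (p.headD b)) b
        with h | h
      · exact .inl ((ball_sublist _ _ _ _).subset (List.mem_filter.1 h).1)
      · exact .inr h
    · exact hp y hy

theorem length_foldl_pathStep {E : Arcs} {X : List ℕ} {a b : ℕ} (l p : List ℕ) :
    (l.foldl (pathStep E X a b) p).length = l.length + p.length := by
  induction l generalizing p with
  | nil => simp
  | cons i l ih => rw [List.foldl_cons, ih]; simp [pathStep]; omega

theorem mem_path {E : Arcs} {X : List ℕ} {a b L y : ℕ} (h : y ∈ path E X a b L) : y ∈ X ∨ y = b :=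
  mem_foldl_pathStep _ _ (by simp) y h

theorem length_path (E : Arcs) (X : List ℕ) (a b L : ℕ) : (path E X a b L).length = L + 1 := by
  rw [path, length_foldl_pathStep]; simp

@[fun_prop]
theorem path_PT (hE : PT E) (hX : PT X) (ha : PT a) (hb : PT b) (hL : PT L) :
    PT fun x => path (E x) (X x) (a x) (b x) (L x) := by
  unfold path
  refine PT.foldl (f := fun x => pathStep (E x) (X x) (a x) (b x)) (by unfold pathStep; fun_prop)
    (by fun_prop) (by fun_prop) (B := fun x => (L x + 1) * (sz (X x) + b x + 1 + 1) + 1)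
    (((hL.value.add (.const 1)).mul (((hX.size.add hb.value).add (.const 1)).add (.const 1))).add
      (.const 1)) fun x l₁ l₂ e => ?_
  have h1 : l₁.length ≤ L x := by
    have := congrArg List.length e
    simp at this; omega
  refine (sz_list_le (s := sz (X x) + b x + 1) fun y hy => ?_).trans ?_
  · rcases mem_foldl_pathStep l₁ [b x] (by simp) y hy with h | h
    · have := sz_le_of_mem h
      omega
    · rw [h, sz_nat]; omega
  · rw [length_foldl_pathStep]
    have : (l₁.length + 1) * (sz (X x) + b x + 1 + 1) ≤ (L x + 1) * (sz (X x) + b x + 1 + 1) :=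
      Nat.mul_le_mul_right _ (by omega)
    simpa using this

@[fun_prop]
theorem bd_PT (hE : PT E) (hA : PT A) (hC : PT C) : PT fun x => bd (E x) (A x) (C x) := by
  unfold bd; fun_prop

/-- All candidates for separators have at most `i` vertices, from `V` or `W`. -/
theorem mem_fam {E : Arcs} {V W : List ℕ} {L cap i : ℕ} : ∀ {S : List ℕ}, S ∈ fam E V W L cap i →
    S.length ≤ i ∧ ∀ x ∈ S, x ∈ V ∨ x ∈ W := by
  induction i with
  | zero => intro S hS; simp only [fam, Function.iterate_zero_apply, List.mem_singleton] at hS; simp [hS]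
  | succ i ih =>
    intro S hS
    unfold fam at hS ih
    rw [Function.iterate_succ_apply', famStep] at hS
    have hS := List.mem_of_mem_take hS
    simp only [List.mem_append, List.mem_flatMap, List.mem_map] at hS
    rcases hS with hS | ⟨S', hS', a, ha, b, hb, x, hx, rfl⟩
    · exact ⟨(ih hS).1.trans (by omega), (ih hS).2⟩
    · refine ⟨by have := (ih hS').1; simpa, fun y hy => ?_⟩
      rcases List.mem_cons.1 hy with rfl | hy
      · rcases mem_path hx with h | h
        · exact .inl (List.mem_filter.1 h).1
        · exact .inr (h ▸ hb)
      · exact (ih hS').2 y hy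

theorem length_fam {E : Arcs} {V W : List ℕ} {L cap i : ℕ} :
    (fam E V W L cap i).length ≤ cap + 1 := by
  unfold fam
  cases i with
  | zero => simp
  | succ i => rw [Function.iterate_succ_apply', famStep]; exact (List.length_take_le _ _).trans (by omega)

@[fun_prop]
theorem fam_PT (hE : PT E) (hV : PT V) (hW : PT W) (hL : PT L) (hc : PT cap) (ht : PT t) :
    PT fun x => fam (E x) (V x) (W x) (L x) (cap x) (t x) := by
  unfold fam
  refine PT.iterate (f := fun x => famStep (E x) (V x) (W x) (L x) (cap x))
    (by unfold famStep; fun_prop) (by fun_prop) ht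
    (B := fun x => (cap x + 1) * (t x * (sz (V x) + sz (W x) + 1) + 1 + 1) + 1)
    (((hc.value.add (.const 1)).mul ((((ht.value.mul ((hV.size.add hW.size).add (.const 1)))).add
      (.const 1)).add (.const 1))).add (.const 1)) fun x i hi => ?_
  refine (sz_list_le (s := t x * (sz (V x) + sz (W x) + 1) + 1) fun S hS => ?_).trans ?_
  · obtain ⟨h1, h2⟩ := mem_fam hS
    refine (sz_list_le (s := sz (V x) + sz (W x)) fun y hy => ?_).trans ?_
    · rcases h2 y hy with h | h <;> have := sz_le_of_mem h <;> omega
    · have := Nat.mul_le_mul_right (sz (V x) + sz (W x) + 1) (h1.trans hi)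
      omega
  · have := Nat.mul_le_mul_right (t x * (sz (V x) + sz (W x) + 1) + 1 + 1)
      (length_fam (E := E x) (V := V x) (W := W x) (L := L x) (cap := cap x) (i := i))
    unfold fam at this
    omega

@[fun_prop]
theorem news_PT (hC : PT C) (hv : PT v) (hS : PT S) : PT fun x => news (C x) (v x) (S x) := by
  unfold news; fun_prop

@[fun_prop]
theorem narrow_PT (hE : PT E) (hV : PT V) (hL : PT L) (hw : PT w) (hA : PT A) :
    PT fun x => narrow (E x) (V x) (L x) (w x) (A x) := by
  unfold narrow; fun_prop

@[fun_prop]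
theorem placeAt_PT (hE : PT E) (hV : PT V) (hL : PT L) (hw : PT w) (hc : PT cap) (ht : PT t)
    (hA : PT A) (hv : PT v) (hC : PT C) :
    PT fun x => placeAt (E x) (V x) (L x) (w x) (cap x) (t x) (A x) (v x) (C x) := by
  unfold placeAt; fun_prop

@[fun_prop]
theorem place_PT (hE : PT E) (hV : PT V) (hL : PT L) (hw : PT w) (hc : PT cap) (ht : PT t)
    (hA : PT A) : PT fun x => place (E x) (V x) (L x) (w x) (cap x) (t x) (A x) := by
  unfold place; fun_prop

@[simp] theorem mem_iff {v : ℕ} {l : List ℕ} : mem v l = true ↔ v ∈ l := by simp [mem]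

@[simp] theorem mem_eq_false {v : ℕ} {l : List ℕ} : mem v l = false ↔ v ∉ l := by
  rw [← Bool.not_eq_true, mem_iff]

@[simp] theorem mem_compl {V A : List ℕ} {x : ℕ} : x ∈ compl V A ↔ x ∈ V ∧ x ∉ A := by
  simp [compl]

theorem placeAt_inv {E : Arcs} {V : List ℕ} {L w cap t v i : ℕ} {A : List ℕ} (hV : V.Nodup)
    (h : A.Nodup ∧ A ⊆ V) : (placeAt E V L w cap t A v (ball E (compl V A) v i)).Nodup ∧
      placeAt E V L w cap t A v (ball E (compl V A) v i) ⊆ V := by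
  have hs : (ball E (compl V A) v i).Sublist V := (ball_sublist _ _ _ _).trans List.filter_sublist
  unfold placeAt news
  refine ⟨List.Nodup.append ((hV.sublist hs).filter _) h.1 fun x hx hxA => ?_, ?_⟩
  · have := (ball_sublist _ _ _ _).subset (List.mem_filter.1 hx).1
    exact (mem_compl.1 this).2 hxA
  · exact List.append_subset.2 ⟨fun x hx => hs.subset (List.mem_filter.1 hx).1, h.2⟩

theorem place_inv {E : Arcs} {V : List ℕ} {L w cap t : ℕ} {A : List ℕ} (hV : V.Nodup)
    (h : A.Nodup ∧ A ⊆ V) : (place E V L w cap t A).Nodup ∧ place E V L w cap t A ⊆ V := by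
  unfold place
  cases (compl V A).isEmpty
  · exact placeAt_inv hV h
  · exact h

/-- Bounds the size of the partial orders by that of the vertex list, and is half of the proof that
the final order is a permutation of the vertices. -/
theorem order_inv {E : Arcs} {n L w cap t i : ℕ} :
    ((place E (List.range n) L w cap t)^[i] []).Nodup ∧
      (place E (List.range n) L w cap t)^[i] [] ⊆ List.range n := by
  induction i with
  | zero => simp
  | succ i ih => rw [Function.iterate_succ_apply']; exact place_inv List.nodup_range ih

@[fun_prop]
theorem order_PT (hE : PT E) (hn : PT n) (hL : PT L) (hw : PT w) (hc : PT cap) (ht : PT t) :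
    PT fun x => order (E x) (n x) (L x) (w x) (cap x) (t x) := by
  unfold order
  exact PT.iterate (f := fun x => place (E x) (List.range (n x)) (L x) (w x) (cap x) (t x))
    (by fun_prop) (by fun_prop) hn (PT.size (PT.range hn)) fun x i _ =>
      sz_le_of_subperm (List.Nodup.subperm order_inv.1 order_inv.2)

end Center

/-! ### The table operations take polynomial time -/

namespace Center

variable {α : Type} [Enc α] {E : α → Arcs} {V A C W X S : α → List ℕ} {n k r R t N m u v i L w cap a b : α → ℕ}
  {f g : α → Factor} {T U : α → List Entry} {e e' : α → Entry} {q q' : α → List (ℕ × ℕ × Bool)}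
  {Fs : α → List Factor}

@[fun_prop]
theorem label_PT (hq : PT q) (hv : PT v) : PT fun x => label (q x) (v x) := by
  unfold label; fun_prop

@[fun_prop]
theorem bit_PT (hq : PT q) (hv : PT v) : PT fun x => bit (q x) (v x) := by
  unfold bit; fun_prop

@[fun_prop]
theorem isCenter_PT (hq : PT q) (hv : PT v) : PT fun x => isCenter (q x) (v x) := by
  unfold isCenter; fun_prop

@[fun_prop]
theorem compat_PT (hq : PT q) (hq' : PT q') : PT fun x => compat (q x) (q' x) := by
  unfold compat; fun_prop

@[fun_prop]
theorem merge_PT (hW : PT W) (he : PT e) (he' : PT e') : PT fun x => merge (W x) (e x) (e' x) := by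
  unfold merge; fun_prop

@[fun_prop]
theorem decide_eq_PT (he : PT e) (he' : PT e') : PT fun x => decide (e x = e' x) := by
  have h1 : PT fun p : List (ℕ × ℕ × Bool) × List (ℕ × ℕ × Bool) => decide (p.1 = p.2) := by
    refine PT.listEq (e := fun a b : ℕ × ℕ × Bool => a.1 == b.1 && (a.2.1 == b.2.1 && a.2.2 == b.2.2))
      (f := fun p : List (ℕ × ℕ × Bool) × List (ℕ × ℕ × Bool) => p.1) (g := fun p => p.2)
      (fun a b => ?_) (by fun_prop) (by fun_prop) (by fun_prop) (by simp)
    simp [Prod.ext_iff]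
  have h2 := h1.comp (f := fun x => ((e x).1, (e' x).1)) (by fun_prop)
  have : PT fun x => decide ((e x).1 = (e' x).1) && (e x).2 == (e' x).2 := by fun_prop
  refine this.cast _ fun x => ?_
  congr 1
  rw [Bool.eq_iff_iff]
  simp [Prod.ext_iff]

theorem dedup_sublist (T : List Entry) : (dedup T).Sublist T := by
  induction T with
  | nil => simp [dedup]
  | cons a T ih =>
    unfold dedup at ih ⊢
    rw [List.foldr_cons]
    cases List.any _ _
    · exact ih.cons_cons a
    · exact ih.cons a

@[simp] theorem mem_dedup {T : List Entry} {e : Entry} : e ∈ dedup T ↔ e ∈ T := by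
  induction T with
  | nil => simp [dedup]
  | cons a T ih =>
    unfold dedup at ih ⊢
    rw [List.foldr_cons, List.mem_cons, ← ih]
    cases h : List.any _ _
    · simp
    · simp only [List.any_eq_true, decide_eq_true_eq] at h
      obtain ⟨b, hb, rfl⟩ := h
      simp only [cond_true, iff_or_self]
      rintro rfl; exact hb

/-- Without repetitions, the length of a table is bounded by the number of possible entries. -/
theorem nodup_dedup (T : List Entry) : (dedup T).Nodup := by
  induction T with
  | nil => simp [dedup]
  | cons a T ih =>
    unfold dedup at ih ⊢
    rw [List.foldr_cons]
    cases h : List.any _ _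
    · simp only [List.any_eq_false, decide_eq_true_eq] at h
      exact List.nodup_cons.2 ⟨fun ha => h a ha rfl, ih⟩
    · exact ih

@[fun_prop]
theorem dedup_PT (hT : PT T) : PT fun x => dedup (T x) := by
  unfold dedup
  refine PT.foldr (a := fun _ => [])
    (f := fun (_ : α) (a : Entry) (l : List Entry) => bif l.any (fun b => decide (b = a)) then l else a :: l)
    (by fun_prop) (by fun_prop) hT hT.size fun x l₁ l₂ h => ?_
  refine sz_le_of_sublist ((dedup_sublist l₂).trans ?_)
  rw [h]; exact List.sublist_append_right _ _

@[fun_prop]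
theorem joinTable_PT (hk : PT k) (hW : PT W) (hT : PT T) (hU : PT U) :
    PT fun x => joinTable (k x) (W x) (T x) (U x) := by
  unfold joinTable; fun_prop

@[fun_prop]
theorem joinScope_PT (hV : PT V) (hW : PT W) (hS : PT S) :
    PT fun x => joinScope (V x) (W x) (S x) := by
  unfold joinScope; fun_prop

@[fun_prop]
theorem join_PT (hV : PT V) (hk : PT k) (hc : PT cap) (hf : PT f) (hg : PT g) :
    PT fun x => join (V x) (k x) (cap x) (f x) (g x) := by
  unfold join; fun_prop

@[fun_prop]
theorem forget_PT (hv : PT v) (hk : PT k) (hf : PT f) :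
    PT fun x => forget (v x) (k x) (f x) := by
  unfold forget; fun_prop

@[fun_prop]
theorem vertexFactor_PT (hR : PT R) (hv : PT v) : PT fun x => vertexFactor (R x) (v x) := by
  unfold vertexFactor; fun_prop

@[fun_prop]
theorem arcFactor_PT {p : α → ℕ × ℕ} (hR : PT R) (hp : PT p) :
    PT fun x => arcFactor (R x) (p x) := by
  unfold arcFactor; fun_prop

/-- Entries with small numbers. -/
structure SmallEntry (z : ℕ) (e : Entry) : Prop where
  length : e.1.length ≤ z
  vertex : ∀ q ∈ e.1, q.1 ≤ z
  label : ∀ q ∈ e.1, q.2.1 ≤ z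
  cost : e.2 ≤ z

/-- Factors with small tables of small entries. -/
structure SmallFactor (z : ℕ) (f : Factor) : Prop where
  length : f.1.length ≤ z
  vertex : ∀ v ∈ f.1, v ≤ z
  table : f.2.1.length ≤ z
  entry : ∀ e ∈ f.2.1, SmallEntry z e

theorem SmallEntry.sz_le {z : ℕ} {e : Entry} (h : SmallEntry z e) :
    sz e ≤ z * (2 * z + 7) + z + 3 := by
  have : sz e.1 ≤ e.1.length * (2 * z + 7) + 1 := sz_list_le (s := 2 * z + 6) fun q hq => by
    have h1 := h.vertex q hq
    have h2 := h.label q hq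
    have h3 := sz_bool_le q.2.2
    simp only [sz_prod, sz_nat]; omega
  have h2 : e.1.length * (2 * z + 7) ≤ z * (2 * z + 7) := Nat.mul_le_mul_right _ h.length
  have h3 := h.cost
  simp only [sz_prod, sz_nat]; omega

theorem SmallFactor.sz_le {z : ℕ} {f : Factor} (h : SmallFactor z f) :
    sz f ≤ z * (z + 2) + z * (z * (2 * z + 7) + z + 4) + 6 := by
  have h1 : sz f.1 ≤ f.1.length * (z + 1 + 1) + 1 := sz_list_le fun q hq => by
    have h1 := h.vertex q hq
    simp only [sz_nat]; omega
  have h2 : sz f.2.1 ≤ f.2.1.length * (z * (2 * z + 7) + z + 3 + 1) + 1 :=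
    sz_list_le fun q hq => (h.entry q hq).sz_le
  have h3 : f.1.length * (z + 1 + 1) ≤ z * (z + 2) := Nat.mul_le_mul_right _ h.length
  have h4 : f.2.1.length * (z * (2 * z + 7) + z + 3 + 1) ≤ z * (z * (2 * z + 7) + z + 4) :=
    Nat.mul_le_mul_right _ h.table
  have h5 := sz_bool_le f.2.2
  simp only [sz_prod]; omega

theorem SmallFactor.PB {z : α → ℕ} (hz : PB z) :
    _root_.PB fun x => z x * (z x + 2) + z x * (z x * (2 * z x + 7) + z x + 4) + 6 :=
  ((hz.mul (hz.add (.const 2))).add (hz.mul (((hz.mul (((PB.const 2).mul hz).add (.const 7))).add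
    hz).add (.const 4)))).add (.const 6)

theorem SmallEntry.of_sz {z : ℕ} {e : Entry} (h : sz e ≤ z) : SmallEntry z e := by
  have h0 : sz e = sz e.1 + (e.2 + 1) + 1 := rfl
  refine ⟨?_, fun q hq => ?_, fun q hq => ?_, by omega⟩
  · have := length_lt_sz e.1; omega
  all_goals
    have h1 := sz_le_of_mem hq
    simp only [sz_prod, sz_nat] at h1
    omega

theorem SmallFactor.of_sz {z : ℕ} {f : Factor} (h : sz f ≤ z) : SmallFactor z f := by
  have h0 : sz f = sz f.1 + (sz f.2.1 + sz f.2.2 + 1) + 1 := rfl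
  refine ⟨?_, fun q hq => ?_, ?_, fun e he => .of_sz ?_⟩
  · have := length_lt_sz f.1; omega
  · have h1 := sz_le_of_mem hq
    simp only [sz_nat] at h1; omega
  · have := length_lt_sz f.2.1; omega
  · have h1 := sz_le_of_mem he
    omega

theorem label_eq_or (e : List (ℕ × ℕ × Bool)) (v : ℕ) :
    (∃ q ∈ e, q.1 = v ∧ q.2.1 = label e v) ∨ ((∀ q ∈ e, q.1 ≠ v) ∧ label e v = 0) := by
  unfold label
  cases h : e.filter fun q => q.1 == v with
  | nil =>
    rw [List.filter_eq_nil_iff] at h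
    exact .inr ⟨fun q hq => by simpa using h q hq, rfl⟩
  | cons q l =>
    have : q ∈ e.filter fun q => q.1 == v := by rw [h]; simp
    rw [List.mem_filter] at this
    exact .inl ⟨q, this.1, by simpa using this.2, rfl⟩

theorem label_le {e : List (ℕ × ℕ × Bool)} {R : ℕ} (h : ∀ q ∈ e, q.2.1 ≤ R) (v : ℕ) :
    label e v ≤ R := by
  rcases label_eq_or e v with ⟨q, hq, -, h'⟩ | ⟨-, h'⟩
  · exact h' ▸ h q hq
  · omega

/-- The entries of a combined table. -/
theorem mem_joinTable {k : ℕ} {W : List ℕ} {T U : List Entry} {e : Entry} :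
    e ∈ joinTable k W T U ↔ ∃ a ∈ T, ∃ b ∈ U, compat a.1 b.1 = true ∧ a.2 + b.2 ≤ k ∧
      merge W a b = e := by
  simp [joinTable, and_assoc]

/-- The scope lies in the vertex list, labels come from the operands, costs are at most `k` and the
table is cut at `cap`. So one bound `z` above `n`, `k` and `cap` survives any number of joins, where
composing polynomial bounds would make the degree grow with each join. -/
theorem SmallFactor.join {n z k cap : ℕ} {f g : Factor} (hf : SmallFactor z f)
    (hg : SmallFactor z g) (hn : n ≤ z) (hk : k ≤ z) (hc : cap ≤ z) :
    SmallFactor z (join (List.range n) k cap f g) := by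
  have hW : (joinScope (List.range n) f.1 g.1).length ≤ z :=
    (List.length_filter_le _ _).trans (by simpa)
  have hWs : ∀ v ∈ joinScope (List.range n) f.1 g.1, v ≤ z := fun v hv => by
    have := List.mem_range.1 (List.mem_filter.1 hv).1
    omega
  refine ⟨hW, hWs, (List.length_take_le _ _).trans hc, fun e he => ?_⟩
  obtain ⟨a, ha, b, hb, -, hc, rfl⟩ := mem_joinTable.1 (List.mem_of_mem_take he)
  refine ⟨by simpa [merge] using hW, ?_, ?_, hc.trans hk⟩
  · simpa [merge] using hWs
  · simp only [merge, List.mem_map, forall_exists_index, and_imp, forall_apply_eq_imp_iff₂]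
    intro v _
    refine label_le (fun q hq => ?_) v
    rcases List.mem_append.1 hq with h | h
    · exact (hf.entry a ha).label q h
    · exact (hg.entry b hb).label q h

theorem SmallFactor.foldl_join {n z k cap : ℕ} {l : List Factor} {f : Factor}
    (hf : SmallFactor z f) (hl : ∀ g ∈ l, SmallFactor z g) (hn : n ≤ z) (hk : k ≤ z)
    (hc : cap ≤ z) : SmallFactor z (l.foldl (Center.join (List.range n) k cap) f) := by
  induction l generalizing f with
  | nil => exact hf
  | cons g l ih =>
    exact ih (hf.join (hl g (by simp)) hn hk hc) fun g hg => hl g (by simp [hg])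

theorem SmallFactor.forget {z k v : ℕ} {f : Factor} (hf : SmallFactor z f) (hk : k ≤ z) :
    SmallFactor z (forget v k f) := by
  refine ⟨(List.length_filter_le _ _).trans hf.length, fun u hu => hf.vertex u (List.mem_filter.1 hu).1,
    ?_, fun e he => ?_⟩
  · simp only [Center.forget, List.length_map]
    exact (List.length_filter_le _ _).trans hf.table
  · simp only [Center.forget, List.mem_map, List.mem_filter] at he
    obtain ⟨a, ⟨ha, hc⟩, rfl⟩ := he
    have h := hf.entry a ha
    refine ⟨(List.length_filter_le _ _).trans h.length, fun q hq => h.vertex q (List.mem_filter.1 hq).1,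
      fun q hq => h.label q (List.mem_filter.1 hq).1, ?_⟩
    simp only [Bool.and_eq_true, Nat.ble_eq] at hc
    exact hc.2.trans hk

theorem SmallFactor.vertexFactor {z R v : ℕ} (hv : v ≤ z) (hR : R + 1 ≤ z) :
    SmallFactor z (vertexFactor R v) := by
  refine ⟨?_, ?_, ?_, ?_⟩
  · simp [Center.vertexFactor]; omega
  · simpa [Center.vertexFactor]
  · simpa only [Center.vertexFactor, List.length_map, List.length_range]
  · simp only [Center.vertexFactor, List.mem_map, List.mem_range, forall_exists_index, and_imp,
      forall_apply_eq_imp_iff₂]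
    intro a ha
    exact ⟨by simp; omega, by simpa, by simp; omega, by simp⟩

theorem SmallFactor.foldl_elim {n z R k cap : ℕ} {A : List ℕ} {Fs : List Factor}
    (hF : ∀ f ∈ Fs, SmallFactor z f) (hA : ∀ v ∈ A, v ≤ z) (hR : R + 1 ≤ z) (hn : n ≤ z)
    (hk : k ≤ z) (hc : cap ≤ z) :
    ∀ f ∈ A.foldl (elim (List.range n) k R cap) Fs, SmallFactor z f := by
  induction A generalizing Fs with
  | nil => exact hF
  | cons v A ih =>
    refine ih (fun f hf => ?_) fun u hu => hA u (by simp [hu])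
    rcases List.mem_cons.1 hf with rfl | hf
    · exact ((SmallFactor.vertexFactor (hA v (by simp)) hR).foldl_join
        (fun g hg => hF g (List.mem_filter.1 hg).1) hn hk hc).forget hk
    · exact hF f (List.mem_filter.1 hf).1

/-- Each elimination adds one factor. Together with the uniform bound on the single factors this
bounds the intermediate lists. -/
theorem length_foldl_elim (V : List ℕ) (k R cap : ℕ) (A : List ℕ) (Fs : List Factor) :
    (A.foldl (elim V k R cap) Fs).length ≤ A.length + Fs.length := by
  induction A generalizing Fs with
  | nil => simp
  | cons v A ih =>
    refine (ih _).trans ?_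
    have := List.length_filter_le (fun f : Factor => !mem v f.1) Fs
    simp only [elim, List.length_cons]; omega

@[fun_prop]
theorem foldl_join_PT (hn : PT n) (hk : PT k) (hc : PT cap) (hf : PT f) (hF : PT Fs) :
    PT fun x => (Fs x).foldl (join (List.range (n x)) (k x) (cap x)) (f x) := by
  refine PT.foldl (f := fun x => join (List.range (n x)) (k x) (cap x)) (by fun_prop) hf hF
    (SmallFactor.PB ((((hn.value.add hk.value).add hc.value).add hf.size).add hF.size))
    fun x l₁ l₂ h => ?_
  refine ((SmallFactor.of_sz (by omega)).foldl_join (fun g hg => .of_sz ?_) (by omega) (by omega)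
    (by omega)).sz_le
  have : sz g < sz (Fs x) := sz_le_of_mem (by rw [h]; exact List.mem_append_left _ hg)
  omega

@[fun_prop]
theorem elim_PT (hn : PT n) (hk : PT k) (hR : PT R) (hc : PT cap) (hF : PT Fs) (hv : PT v) :
    PT fun x => elim (List.range (n x)) (k x) (R x) (cap x) (Fs x) (v x) := by
  unfold elim; fun_prop

@[fun_prop]
theorem foldl_elim_PT (hn : PT n) (hk : PT k) (hR : PT R) (hc : PT cap) (hA : PT A) (hF : PT Fs) :
    PT fun x => (A x).foldl (elim (List.range (n x)) (k x) (R x) (cap x)) (Fs x) := by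
  have hz := (((((hn.value.add hk.value).add hc.value).add hF.size).add hA.size).add
    hR.value).add (.const 1)
  refine PT.foldl (f := fun x => elim (List.range (n x)) (k x) (R x) (cap x)) (by fun_prop) hF hA
    (((hA.length.add hF.length).mul ((SmallFactor.PB hz).add (.const 1))).add (.const 1))
    fun x l₁ l₂ h => ?_
  refine (sz_list_le fun f hf => (SmallFactor.foldl_elim (fun g hg => .of_sz ?_) (fun v hv => ?_)
    ?_ ?_ ?_ ?_ f hf).sz_le).trans (Nat.add_le_add_right (Nat.mul_le_mul_right _ ?_) 1)
  · have := sz_le_of_mem hg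
    omega
  · have : sz v < sz (A x) := sz_le_of_mem (by rw [h]; exact List.mem_append_left _ hv)
    rw [sz_nat] at this; omega
  any_goals omega
  · refine (length_foldl_elim _ _ _ _ _ _).trans ?_
    have := congrArg List.length h
    rw [List.length_append] at this; omega

@[fun_prop]
theorem total_PT (hE : PT E) (hn : PT n) (hk : PT k) (hR : PT R) (hc : PT cap) (hA : PT A) :
    PT fun x => total (E x) (n x) (k x) (R x) (cap x) (A x) := by
  unfold total; fun_prop

@[fun_prop]
theorem verdict_PT (hf : PT f) : PT fun x => verdict (f x) := by
  unfold verdict; fun_prop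

@[fun_prop]
theorem short_PT (hE : PT E) (hV : PT V) (hL : PT L) : PT fun x => short (E x) (V x) (L x) := by
  unfold short; fun_prop

@[fun_prop]
theorem minimum_PT (ha : PT a) (hb : PT b) : PT fun x => minimum (a x) (b x) := by
  unfold minimum; fun_prop

theorem minimum_eq (a b : ℕ) : minimum a b = min a b := by unfold minimum; omega

@[fun_prop]
theorem cappedPow_PT (ht : PT t) (hN : PT N) : PT fun x => cappedPow (t x) (N x) := by
  unfold cappedPow
  refine PT.iterate (f := fun x a => minimum (a + a) (N x)) (by fun_prop) (by fun_prop) ht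
    (B := fun x => N x + 2) (hN.value.add (.const 2)) fun x i _ => ?_
  cases i with
  | zero => simp
  | succ i => rw [Function.iterate_succ_apply', sz_nat, minimum_eq]; omega

@[fun_prop]
theorem attemptAt_PT (hE : PT E) (hn : PT n) (hk : PT k) (hr : PT r) (ht : PT t) (hN : PT N)
    (hL : PT L) : PT fun x => attemptAt (E x) (n x) (k x) (r x) (t x) (N x) (L x) := by
  unfold attemptAt; fun_prop

@[fun_prop]
theorem attempt_PT (hE : PT E) (hn : PT n) (hk : PT k) (hr : PT r) (ht : PT t) (hN : PT N) :
    PT fun x => attempt (E x) (n x) (k x) (r x) (t x) (N x) := by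
  unfold attempt; fun_prop

@[fun_prop]
theorem arcs_PT (hn : PT n) (hX : PT X) : PT fun x => arcs (n x) (X x) := by
  unfold arcs; fun_prop

theorem answer_PT : PT fun x : Input × ℕ × ℕ => answer x.1 x.2.1 x.2.2 := by
  unfold answer; fun_prop

end Center

/-! ### Correctness of the elimination -/

namespace Center

/-- A labelling agrees with an entry. -/
def Agrees (l : ℕ → ℕ) (e : List (ℕ × ℕ × Bool)) : Prop := ∀ q ∈ e, l q.1 = q.2.1

/-- The vertices with a bit. -/
def bits (e : List (ℕ × ℕ × Bool)) : Set ℕ := {v | bit e v = true}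

/-- There is a choice of entries from all tables that agrees with the labelling `l`, with set of
bits `b` and cost `c`. -/
def Choice (l : ℕ → ℕ) : List Factor → Set ℕ → ℕ → Prop
  | [], b, c => b = ∅ ∧ c = 0
  | f :: Fs, b, c => ∃ e ∈ f.2.1, Agrees l e.1 ∧ ∃ b' c', Choice l Fs b' c' ∧
      b = bits e.1 ∪ b' ∧ c = e.2 + c'

/-- Unions of bits and sums of costs do not depend on the order, so the factors containing the
eliminated vertex may be moved to the front. -/
theorem Choice.perm {l : ℕ → ℕ} {Fs Gs : List Factor} (h : Fs.Perm Gs) :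
    ∀ {b : Set ℕ} {c : ℕ}, Choice l Fs b c → Choice l Gs b c := by
  induction h with
  | nil => exact id
  | cons f _ ih =>
    rintro b c ⟨e, he, ha, b', c', h, rfl, rfl⟩
    exact ⟨e, he, ha, b', c', ih h, rfl, rfl⟩
  | swap f g Fs =>
    rintro b c ⟨e, he, ha, b', c', ⟨e', he', ha', b'', c'', h, rfl, rfl⟩, rfl, rfl⟩
    exact ⟨e', he', ha', _, _, ⟨e, he, ha, _, _, h, rfl, rfl⟩, Set.union_left_comm _ _ _,
      by omega⟩
  | trans _ _ ih₁ ih₂ => exact fun h => ih₂ (ih₁ h)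

/-- The entries are labellings of the scope, which is contained in `V`. -/
structure WF (V : List ℕ) (f : Factor) : Prop where
  subset : f.1 ⊆ V
  keys : ∀ e ∈ f.2.1, ∀ v, v ∈ f.1 ↔ ∃ q ∈ e.1, q.1 = v
  unique : ∀ e ∈ f.2.1, ∀ q ∈ e.1, ∀ q' ∈ e.1, q.1 = q'.1 → q.2.1 = q'.2.1

theorem mem_bits {e : List (ℕ × ℕ × Bool)} {v : ℕ} :
    v ∈ bits e ↔ ∃ q ∈ e, q.1 = v ∧ q.2.2 = true := by
  simp [bits, bit]

theorem mem_joinScope {V W U : List ℕ} {v : ℕ} :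
    v ∈ joinScope V W U ↔ v ∈ V ∧ (v ∈ W ∨ v ∈ U) := by
  simp [joinScope]

theorem agrees_label {e : List (ℕ × ℕ × Bool)}
    (h : ∀ q ∈ e, ∀ q' ∈ e, q.1 = q'.1 → q.2.1 = q'.2.1) : Agrees (label e) e := by
  intro q hq
  rcases label_eq_or e q.1 with ⟨q', hq', h1, h2⟩ | ⟨h1, -⟩
  · rw [← h2]; exact h q' hq' q hq h1
  · exact absurd rfl (h1 q hq)

theorem Agrees.label_eq {l : ℕ → ℕ} {e : List (ℕ × ℕ × Bool)} (h : Agrees l e) {v : ℕ}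
    (hv : ∃ q ∈ e, q.1 = v) : label e v = l v := by
  rcases label_eq_or e v with ⟨q, hq, rfl, h2⟩ | ⟨h1, -⟩
  · rw [← h2]; exact (h q hq).symm
  · obtain ⟨q, hq, rfl⟩ := hv
    exact absurd rfl (h1 q hq)

theorem bits_merge {V W U : List ℕ} {a b : Entry} (hW : W ⊆ V) (hU : U ⊆ V)
    (ha : ∀ v, v ∈ W ↔ ∃ q ∈ a.1, q.1 = v) (hb : ∀ v, v ∈ U ↔ ∃ q ∈ b.1, q.1 = v) :
    bits (merge (joinScope V W U) a b).1 = bits a.1 ∪ bits b.1 := by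
  ext v
  simp only [mem_bits, Set.mem_union, merge, List.mem_map]
  constructor
  · rintro ⟨q, ⟨u, -, rfl⟩, rfl, h⟩
    simp only [bit, List.any_append, Bool.or_eq_true, List.any_eq_true, Bool.and_eq_true,
      beq_iff_eq] at h
    exact h
  · intro h
    refine ⟨_, ⟨v, mem_joinScope.2 ?_, rfl⟩, rfl, ?_⟩
    · rcases h with ⟨q, hq, rfl, -⟩ | ⟨q, hq, rfl, -⟩
      · have := (ha q.1).2 ⟨q, hq, rfl⟩
        exact ⟨hW this, .inl this⟩
      · have := (hb q.1).2 ⟨q, hq, rfl⟩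
        exact ⟨hU this, .inr this⟩
    · simpa only [bit, List.any_append, Bool.or_eq_true, List.any_eq_true, Bool.and_eq_true,
        beq_iff_eq] using h

/-- Compatibility is exactly what makes the concatenation of two entries single-valued, and then the
labels of the merged entry are those of both parts. The scopes must lie in `V`, because the joint
scope is filtered from `V`. -/
theorem agrees_merge_iff {V W U : List ℕ} {a b : Entry} {l : ℕ → ℕ} (hW : W ⊆ V) (hU : U ⊆ V)
    (ha : ∀ v, v ∈ W ↔ ∃ q ∈ a.1, q.1 = v) (hb : ∀ v, v ∈ U ↔ ∃ q ∈ b.1, q.1 = v)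
    (ha' : ∀ q ∈ a.1, ∀ q' ∈ a.1, q.1 = q'.1 → q.2.1 = q'.2.1)
    (hb' : ∀ q ∈ b.1, ∀ q' ∈ b.1, q.1 = q'.1 → q.2.1 = q'.2.1) :
    (compat a.1 b.1 = true ∧ Agrees l (merge (joinScope V W U) a b).1) ↔
      Agrees l a.1 ∧ Agrees l b.1 := by
  have hcomp : compat a.1 b.1 = true ↔ ∀ p ∈ a.1, ∀ q ∈ b.1, p.1 = q.1 → p.2.1 = q.2.1 := by
    simp only [compat, List.all_eq_true, Bool.or_eq_true, Bool.not_eq_true', beq_eq_false_iff_ne,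
      beq_iff_eq]
    exact ⟨fun h p hp q hq e => (h p hp q hq).resolve_left (fun h => h e),
      fun h p hp q hq => or_iff_not_imp_left.2 fun e => h p hp q hq (not_not.1 e)⟩
  constructor
  · rintro ⟨hc, h⟩
    rw [hcomp] at hc
    have hu : ∀ q ∈ a.1 ++ b.1, ∀ q' ∈ a.1 ++ b.1, q.1 = q'.1 → q.2.1 = q'.2.1 := by
      intro q hq q' hq' e
      rcases List.mem_append.1 hq with hq | hq <;> rcases List.mem_append.1 hq' with hq' | hq'
      · exact ha' q hq q' hq' e
      · exact hc q hq q' hq' e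
      · exact (hc q' hq' q hq e.symm).symm
      · exact hb' q hq q' hq' e
    have hl := agrees_label hu
    have key : ∀ v ∈ joinScope V W U, l v = label (a.1 ++ b.1) v := fun v hv =>
      h _ (List.mem_map_of_mem hv)
    constructor
    · intro q hq
      have := (ha q.1).2 ⟨q, hq, rfl⟩
      rw [key _ (mem_joinScope.2 ⟨hW this, .inl this⟩)]
      exact hl q (List.mem_append_left _ hq)
    · intro q hq
      have := (hb q.1).2 ⟨q, hq, rfl⟩
      rw [key _ (mem_joinScope.2 ⟨hU this, .inr this⟩)]
      exact hl q (List.mem_append_right _ hq)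
  · rintro ⟨h1, h2⟩
    refine ⟨hcomp.2 fun p hp q hq e => by rw [← h1 p hp, ← h2 q hq, e], ?_⟩
    have h3 : Agrees l (a.1 ++ b.1) := fun q hq => (List.mem_append.1 hq).elim (h1 q) (h2 q)
    intro q hq
    simp only [merge, List.mem_map] at hq
    obtain ⟨v, hv, rfl⟩ := hq
    refine (h3.label_eq ?_).symm
    rcases (mem_joinScope.1 hv).2 with h | h
    · obtain ⟨q, hq, e⟩ := (ha v).1 h
      exact ⟨q, List.mem_append_left _ hq, e⟩
    · obtain ⟨q, hq, e⟩ := (hb v).1 h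
      exact ⟨q, List.mem_append_right _ hq, e⟩

theorem join_ok {V : List ℕ} {k cap : ℕ} {f g : Factor} (h : (join V k cap f g).2.2 = true) :
    f.2.2 = true ∧ g.2.2 = true ∧
      (join V k cap f g).2.1 = joinTable k (joinScope V f.1 g.1) f.2.1 g.2.1 := by
  simp only [join, Bool.and_eq_true, Nat.ble_eq] at h ⊢
  exact ⟨h.1.1, h.1.2, List.take_of_length_le h.2⟩

theorem WF.join {V : List ℕ} {k cap : ℕ} {f g : Factor} :
    WF V (join V k cap f g) := by
  refine ⟨fun v hv => (mem_joinScope.1 hv).1, fun e he v => ?_, fun e he => ?_⟩ <;>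
    obtain ⟨a, ha, b, hb, -, -, rfl⟩ := mem_joinTable.1 (List.mem_of_mem_take he)
  · simp [Center.join, merge]
  · simp only [merge, List.mem_map]
    rintro q ⟨u, hu, rfl⟩ q' ⟨u', hu', rfl⟩ (h : u = u')
    rw [h]

theorem choice_join {V : List ℕ} {k cap : ℕ} {f g : Factor} (hf : WF V f) (hg : WF V g)
    (h : (join V k cap f g).2.2 = true) {l : ℕ → ℕ} {Fs : List Factor} {b : Set ℕ} {c : ℕ}
    (hc : c ≤ k) : Choice l (join V k cap f g :: Fs) b c ↔ Choice l (f :: g :: Fs) b c := by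
  obtain ⟨-, -, ht⟩ := join_ok h
  constructor
  · rintro ⟨e, he, ha, b', c', h', rfl, rfl⟩
    rw [ht] at he
    obtain ⟨a₁, h1, a₂, h2, hcomp, -, rfl⟩ := mem_joinTable.1 he
    obtain ⟨h3, h4⟩ := (agrees_merge_iff hf.subset hg.subset (hf.keys _ h1) (hg.keys _ h2)
      (hf.unique _ h1) (hg.unique _ h2)).1 ⟨hcomp, ha⟩
    refine ⟨a₁, h1, h3, _, _, ⟨a₂, h2, h4, _, _, h', rfl, rfl⟩, ?_, ?_⟩
    · rw [bits_merge hf.subset hg.subset (hf.keys _ h1) (hg.keys _ h2), Set.union_assoc]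
    · simp [merge, add_assoc]
  · rintro ⟨a₁, h1, h3, _, _, ⟨a₂, h2, h4, b', c', h', rfl, rfl⟩, rfl, rfl⟩
    obtain ⟨hcomp, ha⟩ := (agrees_merge_iff hf.subset hg.subset (hf.keys _ h1) (hg.keys _ h2)
      (hf.unique _ h1) (hg.unique _ h2)).2 ⟨h3, h4⟩
    refine ⟨_, ht ▸ mem_joinTable.2 ⟨a₁, h1, a₂, h2, hcomp, by omega, rfl⟩, ha, b', c', h', ?_, ?_⟩
    · rw [bits_merge hf.subset hg.subset (hf.keys _ h1) (hg.keys _ h2), Set.union_assoc]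
    · simp [merge, add_assoc]

theorem foldl_join_ok {V : List ℕ} {k cap : ℕ} {Fs : List Factor} {f : Factor}
    (h : (Fs.foldl (join V k cap) f).2.2 = true) : f.2.2 = true ∧ ∀ g ∈ Fs, g.2.2 = true := by
  induction Fs generalizing f with
  | nil => exact ⟨h, by simp⟩
  | cons g Fs ih =>
    obtain ⟨h1, h2⟩ := ih h
    obtain ⟨h3, h4, -⟩ := join_ok h1
    exact ⟨h3, List.forall_mem_cons.2 ⟨h4, h2⟩⟩

theorem WF.foldl_join {V : List ℕ} {k cap : ℕ} {Fs : List Factor} {f : Factor} (hf : WF V f)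
    (hF : ∀ g ∈ Fs, WF V g) : WF V (Fs.foldl (Center.join V k cap) f) := by
  induction Fs generalizing f with
  | nil => exact hf
  | cons g Fs ih => exact ih (.join) fun g hg => hF g (by simp [hg])

theorem choice_foldl_join {V : List ℕ} {k cap : ℕ} {Fs Gs : List Factor} {f : Factor}
    (hf : WF V f) (hF : ∀ g ∈ Fs, WF V g) (h : (Fs.foldl (join V k cap) f).2.2 = true)
    {l : ℕ → ℕ} {b : Set ℕ} {c : ℕ} (hc : c ≤ k) :
    Choice l (Fs.foldl (join V k cap) f :: Gs) b c ↔ Choice l (f :: (Fs ++ Gs)) b c := by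
  induction Fs generalizing f with
  | nil => rfl
  | cons g Fs ih =>
    have hg := hF g (by simp)
    rw [List.foldl_cons, ih WF.join (fun g hg => hF g (by simp [hg])) h]
    have h' : (join V k cap f g).2.2 = true := (foldl_join_ok (Fs := Fs) h).1
    rw [choice_join hf hg h' hc]
    rfl

theorem cost_foldl_join {V : List ℕ} {k cap : ℕ} {Fs : List Factor} {f : Factor}
    (hf : ∀ e ∈ f.2.1, e.2 ≤ k) : ∀ e ∈ (Fs.foldl (join V k cap) f).2.1, e.2 ≤ k := by
  induction Fs generalizing f with
  | nil => exact hf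
  | cons g Fs ih =>
    refine ih fun e he => ?_
    obtain ⟨a, ha, b, hb, -, h, rfl⟩ := mem_joinTable.1 (List.mem_of_mem_take he)
    exact h

theorem WF.forget {V : List ℕ} {k v : ℕ} {f : Factor} (hf : WF V f) : WF V (forget v k f) := by
  refine ⟨fun u hu => hf.subset (List.mem_filter.1 hu).1, fun e he u => ?_, fun e he => ?_⟩ <;>
    simp only [Center.forget, List.mem_map, List.mem_filter] at he ⊢ <;>
    obtain ⟨a, ⟨ha, -⟩, rfl⟩ := he
  · rw [hf.keys a ha u]
    constructor
    · rintro ⟨⟨q, hq, rfl⟩, h⟩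
      exact ⟨q, List.mem_filter.2 ⟨hq, h⟩, rfl⟩
    · rintro ⟨q, hq, rfl⟩
      exact ⟨⟨q, (List.mem_filter.1 hq).1, rfl⟩, (List.mem_filter.1 hq).2⟩
  · exact fun q hq q' hq' => hf.unique a ha q (List.mem_filter.1 hq).1 q' (List.mem_filter.1 hq').1

theorem WF.vertexFactor {V : List ℕ} {R v : ℕ} (hv : v ∈ V) : WF V (vertexFactor R v) := by
  refine ⟨by simpa [Center.vertexFactor], fun e he u => ?_, fun e he => ?_⟩ <;>
    simp only [Center.vertexFactor, List.mem_map] at he <;> obtain ⟨a, ha, rfl⟩ := he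
  · simp [Center.vertexFactor, eq_comm]
  · simp

theorem WF.arcFactor {V : List ℕ} {R : ℕ} {p : ℕ × ℕ} (h₁ : p.1 ∈ V) (h₂ : p.2 ∈ V)
    (h : p.1 ≠ p.2) : WF V (arcFactor R p) := by
  refine ⟨by simp [Center.arcFactor, h₁, h₂], fun e he u => ?_, fun e he => ?_⟩ <;>
    simp only [Center.arcFactor, List.mem_flatMap, List.mem_map] at he <;>
    obtain ⟨a, ha, b, hb, rfl⟩ := he
  · simp [Center.arcFactor, eq_comm]
  · simp [h, h.symm]

/-- The labelled solutions of the problem given by some factors and the list `B` of vertices that have not been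
eliminated. -/
def Solvable (R k : ℕ) (B : List ℕ) (Fs : List Factor) : Prop :=
  ∃ l b c, Choice l Fs b c ∧ (∀ v ∈ B, l v ≤ R ∧ (l v = 0 ∨ v ∈ b)) ∧
    c + (B.filter fun v => l v == 0).length ≤ k

theorem Choice.congr {l l' : ℕ → ℕ} {V : List ℕ} {v : ℕ} (hl : ∀ u, u ≠ v → l u = l' u) {Fs : List Factor}
    (hF : ∀ f ∈ Fs, WF V f) (hv : ∀ f ∈ Fs, v ∉ f.1) {b : Set ℕ} {c : ℕ} (h : Choice l Fs b c) :
    Choice l' Fs b c := by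
  induction Fs generalizing b c with
  | nil => exact h
  | cons f Fs ih =>
    obtain ⟨e, he, ha, b', c', h', rfl, rfl⟩ := h
    refine ⟨e, he, fun q hq => ?_, b', c', ih (fun f hf => hF f (by simp [hf]))
      (fun f hf => hv f (by simp [hf])) h', rfl, rfl⟩
    rw [← ha q hq, hl]
    rintro rfl
    exact hv f (by simp) (((hF f (by simp)).keys e he _).2 ⟨q, hq, rfl⟩)

theorem Choice.not_mem {l : ℕ → ℕ} {V : List ℕ} {v : ℕ} {Fs : List Factor}
    (hF : ∀ f ∈ Fs, WF V f) (hv : ∀ f ∈ Fs, v ∉ f.1) {b : Set ℕ} {c : ℕ} (h : Choice l Fs b c) :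
    v ∉ b := by
  induction Fs generalizing b c with
  | nil => rw [h.1]; simp
  | cons f Fs ih =>
    obtain ⟨e, he, ha, b', c', h', rfl, rfl⟩ := h
    rintro (hb | hb)
    · obtain ⟨q, hq, rfl, -⟩ := mem_bits.1 hb
      exact hv f (by simp) (((hF f (by simp)).keys e he _).2 ⟨q, hq, rfl⟩)
    · exact ih (fun f hf => hF f (by simp [hf])) (fun f hf => hv f (by simp [hf])) h' hb

theorem isCenter_iff {l : ℕ → ℕ} {e : List (ℕ × ℕ × Bool)} {v : ℕ} (h : Agrees l e)
    (hv : ∃ q ∈ e, q.1 = v) : isCenter e v = true ↔ l v = 0 := by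
  simp only [isCenter, List.any_eq_true, Bool.and_eq_true, beq_iff_eq]
  constructor
  · rintro ⟨q, hq, rfl, h0⟩
    rw [h q hq, h0]
  · rintro h0
    obtain ⟨q, hq, rfl⟩ := hv
    exact ⟨q, hq, rfl, by rw [← h q hq, h0]⟩

theorem bits_filter (e : List (ℕ × ℕ × Bool)) (v : ℕ) :
    bits (e.filter fun q => !(q.1 == v)) = bits e \ {v} := by
  ext u
  simp only [mem_bits, List.mem_filter, Set.mem_sdiff, Set.mem_singleton_iff, Bool.not_eq_true',
    beq_eq_false_iff_ne]
  constructor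
  · rintro ⟨q, ⟨hq, h1⟩, rfl, h2⟩
    exact ⟨⟨q, hq, rfl, h2⟩, h1⟩
  · rintro ⟨⟨q, hq, rfl, h2⟩, h1⟩
    exact ⟨q, ⟨hq, h1⟩, rfl, h2⟩

/-- Only `f` mentions `v`, so whether `v` is a center or has a smaller neighbor is decided by the
entry of `f` alone. A center is paid for at the moment it is forgotten, hence exactly once. -/
theorem solvable_forget {V B : List ℕ} {R k v : ℕ} {f : Factor} {Fs : List Factor} (hf : WF V f)
    (hF : ∀ f ∈ Fs, WF V f) (hv : ∀ f ∈ Fs, v ∉ f.1) (hvf : v ∈ f.1) (hB : v ∉ B)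
    (hR : ∀ e ∈ f.2.1, label e.1 v ≤ R) :
    Solvable R k (v :: B) (f :: Fs) ↔ Solvable R k B (forget v k f :: Fs) := by
  constructor
  · rintro ⟨l, b, c, ⟨e, he, ha, b', c', h', rfl, rfl⟩, hsat, hk⟩
    have hc := isCenter_iff ha ((hf.keys e he v).1 hvf)
    -- The zero label of `v` moves from the count over the remaining vertices into the cost of the
    -- entry.
    have hk' : e.2 + (isCenter e.1 v).toNat + c' + (B.filter fun v => l v == 0).length ≤ k := by
      by_cases h0 : l v = 0
      · rw [hc.2 h0, Bool.toNat_true]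
        simp only [List.filter_cons, h0, beq_self_eq_true, if_true, List.length_cons] at hk
        omega
      · have : isCenter e.1 v = false := by
          rw [← Bool.not_eq_true, hc]; exact h0
        rw [this, Bool.toNat_false]
        simp only [List.filter_cons, beq_iff_eq, h0, if_false] at hk
        omega
    refine ⟨l, bits e.1 \ {v} ∪ b', e.2 + (isCenter e.1 v).toNat + c', ⟨
      (e.1.filter fun q => !(q.1 == v), e.2 + (isCenter e.1 v).toNat), ?_, ?_, b', c', h',
      by rw [bits_filter], rfl⟩, fun u hu => ?_, hk'⟩
    · simp only [forget, List.mem_map, List.mem_filter, Bool.and_eq_true, Nat.ble_eq, Bool.or_eq_true]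
      refine ⟨e, ⟨he, ?_, by omega⟩, rfl⟩
      rcases (hsat v (by simp)).2 with h0 | hb | hb
      · exact .inl (hc.2 h0)
      · exact .inr hb
      · exact absurd hb (h'.not_mem hF hv)
    · exact fun q hq => ha q (List.mem_filter.1 hq).1
    · obtain ⟨h1, h2⟩ := hsat u (by simp [hu])
      exact ⟨h1, h2.imp_right fun h => h.imp_left fun h => ⟨h, fun huv => hB (huv ▸ hu)⟩⟩
  · rintro ⟨l, b, c, ⟨e', he', ha', b', c', h', rfl, rfl⟩, hsat, hk⟩
    simp only [forget, List.mem_map, List.mem_filter, Bool.and_eq_true, Nat.ble_eq, Bool.or_eq_true] at he'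
    obtain ⟨e, ⟨he, hcb, -⟩, rfl⟩ := he'
    -- The shortened entry no longer fixes the label of `v`; it is taken from the entry of `f` that
    -- it stems from.
    set l' := Function.update l v (label e.1 v) with hl'
    have hll' : ∀ u, u ≠ v → l u = l' u := fun u hu => (Function.update_of_ne hu _ _).symm
    have hlv : l' v = label e.1 v := Function.update_self _ _ _
    have ha : Agrees l' e.1 := by
      intro q hq
      by_cases h : q.1 = v
      · rw [h, hlv, ← h]
        exact agrees_label (hf.unique e he) q hq
      · rw [← hll' _ h]
        exact ha' q (List.mem_filter.2 ⟨hq, by simpa using h⟩)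
    have hc := isCenter_iff ha ((hf.keys e he v).1 hvf)
    have hBf : (B.filter fun v => l' v == 0) = B.filter fun v => l v == 0 :=
      List.filter_congr fun u hu => by rw [hll' u (by rintro rfl; exact hB hu)]
    refine ⟨l', bits e.1 ∪ b', e.2 + c', ⟨e, he, ha, b', c', h'.congr hll' hF hv, rfl, rfl⟩,
      fun u hu => ?_, ?_⟩
    · rcases List.mem_cons.1 hu with rfl | huB
      · exact ⟨hlv ▸ hR e he, hcb.imp hc.1 fun h => .inl h⟩
      · have hne : u ≠ v := fun huv => hB (huv ▸ huB)
        rw [← hll' u hne]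
        obtain ⟨h1, h2⟩ := hsat u huB
        refine ⟨h1, h2.imp_right fun h => h.imp_left fun h => ?_⟩
        rw [bits_filter] at h
        exact h.1
    · by_cases h0 : l' v = 0
      · rw [hc.2 h0, Bool.toNat_true] at hk
        simp only [List.filter_cons, h0, beq_self_eq_true, if_true, List.length_cons, hBf]
        omega
      · simp only [List.filter_cons, beq_iff_eq, h0, if_false, hBf]
        simp only at hk
        omega

theorem choice_vertexFactor {l : ℕ → ℕ} {R v : ℕ} {Fs : List Factor} {b : Set ℕ} {c : ℕ} :
    Choice l (vertexFactor R v :: Fs) b c ↔ l v ≤ R ∧ Choice l Fs b c := by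
  have hb (a : ℕ) : bits [(v, a, false)] = ∅ := by
    ext u; simp [mem_bits]
  constructor
  · rintro ⟨e, he, ha, b', c', h, rfl, rfl⟩
    simp only [vertexFactor, List.mem_map, List.mem_range] at he
    obtain ⟨a, ha', rfl⟩ := he
    have : l v = a := ha (v, a, false) (by simp)
    refine ⟨by omega, ?_⟩
    simpa [hb] using h
  · rintro ⟨hv, h⟩
    refine ⟨([(v, l v, false)], 0), ?_, fun q hq => ?_, b, c, h, by simp [hb], by simp⟩
    · simp only [vertexFactor, List.mem_map, List.mem_range]
      exact ⟨l v, by omega, rfl⟩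
    · obtain rfl := List.mem_singleton.1 hq
      rfl

/-- Starting the join with `vertexFactor R v` puts `v` into the scope and bounds its label by `R`,
even if no other factor contains `v`, as for an isolated vertex. -/
theorem label_foldl_join {V : List ℕ} {k cap R v : ℕ} {Fs : List Factor} {f : Factor}
    (hf : WF V f) (hF : ∀ g ∈ Fs, WF V g) (hv : v ∈ f.1) (h : ∀ e ∈ f.2.1, label e.1 v ≤ R) :
    v ∈ (Fs.foldl (join V k cap) f).1 ∧
      ∀ e ∈ (Fs.foldl (join V k cap) f).2.1, label e.1 v ≤ R := by
  induction Fs generalizing f with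
  | nil => exact ⟨hv, h⟩
  | cons g Fs ih =>
    have hg := hF g (by simp)
    have hvJ : v ∈ (join V k cap f g).1 := mem_joinScope.2 ⟨hf.subset hv, .inl hv⟩
    refine ih WF.join (fun g hg => hF g (by simp [hg])) hvJ fun e he => ?_
    have hu := (WF.join (V := V) (f := f) (g := g) (k := k) (cap := cap)).unique e he
    obtain ⟨a, ha, b, hb, hc, -, rfl⟩ := mem_joinTable.1 (List.mem_of_mem_take he)
    have := ((agrees_merge_iff hf.subset hg.subset (hf.keys _ ha) (hg.keys _ hb)
      (hf.unique _ ha) (hg.unique _ hb)).1 ⟨hc, agrees_label hu⟩).1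
    rw [← this.label_eq ((hf.keys a ha v).1 hv)]
    exact h a ha

/-- Joining all factors with `v` in their scope changes no solutions, and `v` then occurs in the
joined factor only, so that it can be forgotten. -/
theorem solvable_elim {V B : List ℕ} {R k cap v : ℕ} {Fs : List Factor}
    (hF : ∀ f ∈ Fs, WF V f) (hv : v ∈ V) (hB : v ∉ B)
    (hok : ∀ f ∈ elim V k R cap Fs v, f.2.2 = true) :
    Solvable R k (v :: B) Fs ↔ Solvable R k B (elim V k R cap Fs v) := by
  have hI : ∀ f ∈ Fs.filter fun f => mem v f.1, WF V f := fun f hf => hF f (List.mem_filter.1 hf).1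
  have hO : ∀ f ∈ Fs.filter fun f => !mem v f.1, WF V f := fun f hf => hF f (List.mem_filter.1 hf).1
  have hV : WF V (vertexFactor R v) := .vertexFactor hv
  have hJ := hok _ List.mem_cons_self
  have hlab := label_foldl_join (k := k) (cap := cap) (R := R) hV hI (v := v) (by simp [vertexFactor])
    (fun e he => by
      simp only [vertexFactor, List.mem_map, List.mem_range] at he
      obtain ⟨a, ha, rfl⟩ := he
      simp [label]; omega)
  rw [elim, ← solvable_forget (hV.foldl_join hI) hO (by simp) hlab.1 hB hlab.2]
  have hperm := List.filter_append_perm (fun f : Factor => mem v f.1) Fs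
  unfold Solvable
  refine exists_congr fun l => exists_congr fun b => exists_congr fun c => ?_
  have key (hc : c ≤ k) : Choice l ((Fs.filter fun f => mem v f.1).foldl (join V k cap)
      (vertexFactor R v) :: Fs.filter fun f => !mem v f.1) b c ↔ l v ≤ R ∧ Choice l Fs b c := by
    rw [choice_foldl_join hV hI hJ hc, choice_vertexFactor]
    exact and_congr_right fun _ => ⟨fun h => h.perm hperm, fun h => h.perm hperm.symm⟩
  constructor
  · rintro ⟨h, hs, hk⟩
    exact ⟨(key (by omega)).2 ⟨(hs v (by simp)).1, h⟩, hs, hk⟩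
  · rintro ⟨h, hs, hk⟩
    exact ⟨((key (by omega)).1 h).2, hs, hk⟩

theorem elim_ok {V : List ℕ} {R k cap v : ℕ} {Fs : List Factor}
    (hok : ∀ f ∈ elim V k R cap Fs v, f.2.2 = true) : ∀ f ∈ Fs, f.2.2 = true := by
  intro f hf
  by_cases h : v ∈ f.1
  · have hJ := hok _ List.mem_cons_self
    exact (foldl_join_ok hJ).2 f (List.mem_filter.2 ⟨hf, mem_iff.2 h⟩)
  · exact hok f (List.mem_cons_of_mem _ (List.mem_filter.2 ⟨hf, by simpa⟩))

theorem WF.elim {V : List ℕ} {R k cap v : ℕ} {Fs : List Factor} (hF : ∀ f ∈ Fs, WF V f)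
    (hv : v ∈ V) : ∀ f ∈ elim V k R cap Fs v, WF V f := by
  intro f hf
  rcases List.mem_cons.1 hf with rfl | hf
  · exact ((WF.vertexFactor hv).foldl_join fun g hg => hF g (List.mem_filter.1 hg).1).forget
  · exact hF f (List.mem_filter.1 hf).1

theorem foldl_elim_ok {V A : List ℕ} {R k cap : ℕ} {Fs : List Factor}
    (hok : ∀ f ∈ A.foldl (elim V k R cap) Fs, f.2.2 = true) : ∀ f ∈ Fs, f.2.2 = true := by
  induction A generalizing Fs with
  | nil => exact hok
  | cons v A ih => exact elim_ok (ih hok)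

theorem WF.foldl_elim {V A : List ℕ} {R k cap : ℕ} {Fs : List Factor} (hF : ∀ f ∈ Fs, WF V f)
    (hA : A ⊆ V) : ∀ f ∈ A.foldl (Center.elim V k R cap) Fs, WF V f := by
  induction A generalizing Fs with
  | nil => exact hF
  | cons v A ih => exact ih (WF.elim hF (hA (by simp))) fun u hu => hA (by simp [hu])

theorem solvable_foldl_elim {V A : List ℕ} {R k cap : ℕ} {Fs : List Factor}
    (hF : ∀ f ∈ Fs, WF V f) (hA : A ⊆ V) (hA' : A.Nodup)
    (hok : ∀ f ∈ A.foldl (elim V k R cap) Fs, f.2.2 = true) :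
    Solvable R k A Fs ↔ Solvable R k [] (A.foldl (elim V k R cap) Fs) := by
  induction A generalizing Fs with
  | nil => rfl
  | cons v A ih =>
    rw [List.nodup_cons] at hA'
    rw [solvable_elim hF (hA (by simp)) hA'.1 (cap := cap) (foldl_elim_ok hok),
      ih (WF.elim hF (hA (by simp))) (fun u hu => hA (by simp [hu])) hA'.2 hok]
    rfl

/-- In the table of an arc the two labels determine the entry, so a labelling leaves no choice: the
bits are exactly those of the vertices with a neighbor of smaller label. -/
theorem choice_arcs {l : ℕ → ℕ} {E : Arcs} {R : ℕ} {b : Set ℕ} {c : ℕ} :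
    Choice l (E.map (arcFactor R)) b c ↔ (∀ p ∈ E, l p.1 ≤ R ∧ l p.2 ≤ R) ∧
      b = {v | ∃ u, (v, u) ∈ E ∧ l u < l v} ∧ c = 0 := by
  induction E generalizing b c with
  | nil => simp [Choice]
  | cons p E ih =>
    have hb : bits [(p.1, l p.1, !Nat.ble (l p.1) (l p.2)), (p.2, l p.2, false)] ∪
        {v | ∃ u, (v, u) ∈ E ∧ l u < l v} = {v | ∃ u, (v, u) ∈ p :: E ∧ l u < l v} := by
      ext v
      simp only [mem_bits, Set.mem_union, List.mem_cons, List.not_mem_nil, or_false,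
        Set.mem_ofPred_eq, exists_eq_or_imp, exists_eq_left, Bool.false_eq_true, and_false,
        Bool.not_eq_true', ← Bool.not_eq_true, Nat.ble_eq, not_le]
      constructor
      · rintro (⟨rfl, h⟩ | ⟨u, h1, h2⟩)
        · exact ⟨p.2, .inl rfl, h⟩
        · exact ⟨u, .inr h1, h2⟩
      · rintro ⟨u, rfl | h1, h2⟩
        · exact .inl ⟨rfl, h2⟩
        · exact .inr ⟨u, h1, h2⟩
    constructor
    · rintro ⟨e, he, ha, b', c', h, rfl, rfl⟩
      obtain ⟨h1, rfl, rfl⟩ := ih.1 h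
      simp only [arcFactor, List.mem_flatMap, List.mem_map, List.mem_range] at he
      obtain ⟨x, hx, y, hy, rfl⟩ := he
      have hx' : l p.1 = x := ha (p.1, x, !Nat.ble x y) (by simp)
      have hy' : l p.2 = y := ha (p.2, y, false) (by simp)
      refine ⟨?_, ?_, rfl⟩
      · intro q hq
        rcases List.mem_cons.1 hq with rfl | hq
        · omega
        · exact h1 q hq
      · rw [← hb, hx', hy']
    · rintro ⟨h1, rfl, rfl⟩
      refine ⟨([(p.1, l p.1, !Nat.ble (l p.1) (l p.2)), (p.2, l p.2, false)], 0), ?_, ?_, _, 0,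
        ih.2 ⟨fun q hq => h1 q (by simp [hq]), rfl, rfl⟩, hb.symm, rfl⟩
      · have := h1 p (by simp)
        simp only [arcFactor, List.mem_flatMap, List.mem_map, List.mem_range]
        exact ⟨l p.1, by omega, l p.2, by omega, rfl⟩
      · intro q hq
        simp only [List.mem_cons, List.not_mem_nil, or_false] at hq
        rcases hq with rfl | rfl <;> rfl

/-- Labellings that certify a center: every vertex with a positive label has a neighbor with a smaller one. -/
def Labelling (E : Arcs) (n k R : ℕ) : Prop :=
  ∃ l : ℕ → ℕ, (∀ v < n, l v ≤ R ∧ (l v = 0 ∨ ∃ u, (v, u) ∈ E ∧ l u < l v)) ∧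
    ((List.range n).filter fun v => l v == 0).length ≤ k

/-- Eliminating all vertices turns the arc factors into factors of empty scope without changing
solvability. What remains is to pick one entry from each table with total cost at most `k`, and
these picks are the entries of the final join. -/
theorem total_correct {E : Arcs} {n k R cap : ℕ} {A : List ℕ} (hA : A.Perm (List.range n))
    (hE : ∀ p ∈ E, p.1 < n ∧ p.2 < n ∧ p.1 ≠ p.2) (hok : (total E n k R cap A).2.2 = true) :
    (total E n k R cap A).2.1 ≠ [] ↔ Labelling E n k R := by
  have hF : ∀ f ∈ E.map (arcFactor R), WF (List.range n) f := by
    simp only [List.mem_map, forall_exists_index, and_imp, forall_apply_eq_imp_iff₂]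
    exact fun p hp => .arcFactor (by simpa using (hE p hp).1) (by simpa using (hE p hp).2.1)
      (hE p hp).2.2
  set Gs := A.foldl (elim (List.range n) k R cap) (E.map (arcFactor R)) with hGs
  have hG : ∀ f ∈ Gs, WF (List.range n) f := WF.foldl_elim hF hA.subset
  have hunit : WF (List.range n) ([], [([], 0)], true) := ⟨by simp, by simp, by simp⟩
  have hT : total E n k R cap A = Gs.foldl (join (List.range n) k cap) ([], [([], 0)], true) := rfl
  have hok' := hok
  rw [hT] at hok' ⊢
  have h1 : (Gs.foldl (join (List.range n) k cap) ([], [([], 0)], true)).2.1 ≠ [] ↔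
      Solvable R k [] Gs := by
    have hunit' (l : ℕ → ℕ) (b : Set ℕ) (c : ℕ) :
        Choice l (([], [([], 0)], true) :: Gs) b c ↔ Choice l Gs b c := by
      simp [Choice, Agrees, bits, bit]
    have hJ := hunit.foldl_join hG (k := k) (cap := cap)
    constructor
    · intro h
      obtain ⟨e, he⟩ := List.exists_mem_of_ne_nil _ h
      have hc := cost_foldl_join (V := List.range n) (k := k) (cap := cap) (Fs := Gs)
        (f := ([], [([], 0)], true)) (by simp) e he
      refine ⟨label e.1, bits e.1, e.2, ?_, by simp, by simpa using hc⟩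
      rw [← hunit', ← List.append_nil Gs, ← choice_foldl_join hunit hG hok' hc]
      exact ⟨e, he, agrees_label (hJ.unique e he), ∅, 0, ⟨rfl, rfl⟩, by simp, rfl⟩
    · rintro ⟨l, b, c, h, -, hc⟩
      rw [← hunit', ← List.append_nil Gs, ← choice_foldl_join hunit hG hok' (by omega)] at h
      obtain ⟨e, he, -⟩ := h
      exact List.ne_nil_of_mem he
  rw [h1, hGs, ← solvable_foldl_elim hF hA.subset (hA.nodup_iff.2 List.nodup_range)
    (foldl_join_ok hok').2]
  unfold Solvable Labelling
  refine exists_congr fun l => ⟨?_, ?_⟩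
  · rintro ⟨b, c, h, hs, hk⟩
    obtain ⟨h1, rfl, rfl⟩ := choice_arcs.1 h
    refine ⟨fun v hv => hs v (hA.mem_iff.2 (by simpa)), ?_⟩
    rw [zero_add, (hA.filter _).length_eq] at hk
    exact hk
  · rintro ⟨hs, hk⟩
    refine ⟨_, 0, choice_arcs.2 ⟨fun p hp => ⟨(hs _ (hE p hp).1).1, (hs _ (hE p hp).2.1).1⟩, rfl,
      rfl⟩, fun v hv => hs v (by simpa using hA.mem_iff.1 hv), ?_⟩
    rw [zero_add, (hA.filter _).length_eq]
    exact hk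

end Center

/-! ### Graphs of bounded tree-depth -/

namespace Center

/-! ### Walks, distances and tree-depth in induced subgraphs -/

section connectivity
variable {r : ℕ → ℕ → Prop} {X Y : Set ℕ} {u v w : ℕ}

/-- `u` and `v` are connected in the subgraph induced by `X`. -/
def Conn (r : ℕ → ℕ → Prop) (X : Set ℕ) (u v : ℕ) : Prop :=
  u ∈ X ∧ Relation.ReflTransGen (fun a b => r a b ∧ b ∈ X) u v

theorem Conn.refl (h : u ∈ X) : Conn r X u u := ⟨h, .refl⟩

theorem Conn.mem_right (h : Conn r X u v) : v ∈ X := by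
  obtain ⟨hu, h⟩ := h
  cases h with
  | refl => exact hu
  | tail _ h => exact h.2

theorem Conn.tail (h : Conn r X u v) (hr : r v w) (hw : w ∈ X) : Conn r X u w :=
  ⟨h.1, h.2.tail ⟨hr, hw⟩⟩

theorem Conn.trans (h : Conn r X u v) (h' : Conn r X v w) : Conn r X u w := ⟨h.1, h.2.trans h'.2⟩

theorem Conn.mono (h : Conn r X u v) (hXY : X ⊆ Y) : Conn r Y u v :=
  ⟨hXY h.1, h.2.lift id fun _ _ h => ⟨h.1, hXY h.2⟩⟩

/-- Induction along a walk. -/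
theorem Conn.induction {P : ℕ → Prop} (h : Conn r X u v) (hu : P u)
    (hs : ∀ a b, Conn r X u a → P a → r a b → b ∈ X → P b) : P v := by
  obtain ⟨hX, h⟩ := h
  induction h with
  | refl => exact hu
  | tail h hb ih => exact hs _ _ ⟨hX, h⟩ ih hb.1 hb.2

theorem Conn.symm (hr : ∀ ⦃a b⦄, r a b → r b a) (h : Conn r X u v) : Conn r X v u :=
  h.induction (P := fun v => Conn r X v u) (.refl h.1) fun _ _ _ hP hab hb =>
    ((Conn.refl hb).tail (hr hab) hP.1).trans hP

theorem Conn.subset_of_forall (h : Conn r X u v) (hY : ∀ x, Conn r X u x → x ∈ Y) : Conn r Y u v :=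
  h.induction (.refl (hY u (.refl h.1))) fun _ b ha hP hab hb => hP.tail hab (hY b (ha.tail hab hb))

/-- There is a walk of length at most `i` from `u` to `w` in the subgraph induced by `X`. -/
def Near (r : ℕ → ℕ → Prop) (X : Set ℕ) : ℕ → ℕ → ℕ → Prop
  | 0, u, w => u ∈ X ∧ w = u
  | i + 1, u, w => ∃ y, Near r X i u y ∧ (y = w ∨ r y w) ∧ w ∈ X

theorem Near.conn {i : ℕ} (h : Near r X i u w) : Conn r X u w := by
  induction i generalizing w with
  | zero => obtain ⟨h, rfl⟩ := h; exact .refl h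
  | succ i ih =>
    obtain ⟨y, hy, rfl | h, hw⟩ := h
    · exact ih hy
    · exact (ih hy).tail h hw

theorem Near.succ {i : ℕ} (h : Near r X i u w) : Near r X (i + 1) u w :=
  ⟨w, h, .inl rfl, h.conn.mem_right⟩

theorem Near.le {i j : ℕ} (h : Near r X i u w) (hij : i ≤ j) : Near r X j u w := by
  induction hij with
  | refl => exact h
  | step _ ih => exact ih.succ

theorem Near.trans {i j : ℕ} (h : Near r X i u v) (h' : Near r X j v w) : Near r X (i + j) u w := by
  induction j generalizing w with
  | zero => obtain ⟨_, rfl⟩ := h'; exact h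
  | succ j ih =>
    obtain ⟨y, hy, h⟩ := h'
    exact ⟨y, ih hy, h⟩

theorem Near.symm (hr : ∀ ⦃a b⦄, r a b → r b a) {i : ℕ} (h : Near r X i u w) : Near r X i w u := by
  induction i generalizing w with
  | zero => obtain ⟨h, rfl⟩ := h; exact ⟨h, rfl⟩
  | succ i ih =>
    obtain ⟨y, hy, h, hw⟩ := h
    have h1 : Near r X 1 w y := ⟨w, ⟨hw, rfl⟩, h.imp Eq.symm fun h => hr h, hy.conn.mem_right⟩
    rw [add_comm]
    exact h1.trans (ih hy)

theorem Near.mono {i : ℕ} (h : Near r X i u w) (hXY : X ⊆ Y) : Near r Y i u w := by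
  induction i generalizing w with
  | zero => exact ⟨hXY h.1, h.2⟩
  | succ i ih =>
    obtain ⟨y, hy, h, hw⟩ := h
    exact ⟨y, ih hy, h, hXY hw⟩

/-- The subgraph induced by `X` has a tree-depth of at most `t`, counted in vertices. -/
def TD (r : ℕ → ℕ → Prop) : ℕ → Set ℕ → Prop
  | 0, X => X = ∅
  | t + 1, X => ∀ u ∈ X, ∃ v, Conn r X u v ∧ TD r t {x | Conn r X u x ∧ x ≠ v}

theorem TD.mono {t : ℕ} (h : TD r t X) (hYX : Y ⊆ X) : TD r t Y := by
  induction t generalizing X Y with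
  | zero => rw [TD] at h ⊢; rw [h] at hYX; exact Set.subset_empty_iff.1 hYX
  | succ t ih =>
    intro u hu
    obtain ⟨v, hv, h⟩ := h u (hYX hu)
    by_cases hvY : Conn r Y u v
    · exact ⟨v, hvY, ih h fun x hx => ⟨hx.1.mono hYX, hx.2⟩⟩
    -- The root `v` of the larger component is missed by the component of `u` in `Y`, which
    -- therefore lies in the part of smaller depth; any vertex of it may be the root.
    · refine ⟨u, .refl hu, ih h fun x hx => ⟨hx.1.mono hYX, ?_⟩⟩
      rintro rfl; exact hvY hx.1

/-- A walk from `x` to `v` ends with an edge from a vertex that is connected to `x` outside of `v`. -/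
theorem Conn.exists_last (h : Conn r X u v) (hne : u ≠ v) :
    ∃ y, Conn r (X \ {v}) u y ∧ r y v := by
  have := h.induction (P := fun w => Conn r (X \ {v}) u w ∨ ∃ y, Conn r (X \ {v}) u y ∧ r y v)
    (.inl (.refl ⟨h.1, hne⟩)) fun a b _ hP hab hb => ?_
  · exact this.resolve_left fun h => h.mem_right.2 rfl
  · rcases hP with hP | hP
    · by_cases hbv : b = v
      · exact .inr ⟨a, hP, hbv ▸ hab⟩
      · exact .inl (hP.tail hab ⟨hb, hbv⟩)
    · exact .inr hP

/-- In a component with root `v`, every other vertex reaches a neighbor of `v` within the component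
minus `v`, by induction in at most 2^t - 2 steps. So all vertices are within 2^t - 1 of `v`, and any
two within 2(2^t - 1) = 2^{t+1} - 2. -/
theorem TD.near (hr : ∀ ⦃a b⦄, r a b → r b a) {t : ℕ} (h : TD r t X) (hc : Conn r X u w) :
    Near r X (2 ^ t - 2) u w := by
  induction t generalizing X u w with
  | zero => rw [TD] at h; have := hc.1; simp [h] at this
  | succ t ih =>
    obtain ⟨v, hv, h⟩ := h u hc.1
    have key : ∀ x, Conn r X u x → Near r X (2 ^ t - 1) x v := by
      intro x hx
      by_cases hxv : x = v
      · subst hxv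
        exact Near.le (i := 0) ⟨hv.mem_right, rfl⟩ (Nat.zero_le _)
      · obtain ⟨y, hy, hyv⟩ := ((hx.symm hr).trans hv).exists_last hxv
        have hy' : Conn r {x | Conn r X u x ∧ x ≠ v} x y := hy.subset_of_forall fun z hz =>
          ⟨hx.trans (hz.mono Set.sdiff_subset), hz.mem_right.2⟩
        have h1 := (ih h hy').mono (Y := X) fun z hz => hz.1.mem_right
        -- For `t = 0` the truncated subtraction would spoil the count, but then the component is
        -- just `v`.
        have ht : t ≠ 0 := by
          rintro rfl
          rw [TD] at h
          have : x ∈ {x | Conn r X u x ∧ x ≠ v} := ⟨hx, hxv⟩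
          simp [h] at this
        have h2 : 2 ^ t - 1 = 2 ^ t - 2 + 1 := by
          have : 2 ≤ 2 ^ t := Nat.le_self_pow ht 2
          omega
        rw [h2]
        exact ⟨y, h1, .inr hyv, hv.mem_right⟩
    have := (key u (.refl hc.1)).trans ((key w hc).symm hr)
    refine this.le ?_
    rw [pow_succ]; omega

/-- A set of connected vertices has at most half of the vertices of `W` when a small set is removed. -/
theorem TD.exists_balanced {t : ℕ} (h : TD r t X) (W : Finset ℕ) :
    ∃ S : Finset ℕ, S.card ≤ t ∧ ∀ U ⊆ W, (∀ a ∈ U, ∀ b ∈ U, Conn r (X \ S) a b) →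
      2 * U.card ≤ W.card := by
  induction t generalizing X with
  | zero =>
    refine ⟨∅, by simp, fun U _ hc => ?_⟩
    have : U = ∅ := by
      refine Finset.eq_empty_of_forall_notMem fun a ha => ?_
      rw [TD] at h
      have := (hc a ha a ha).1.1
      simp [h] at this
    simp [this]
  | succ t ih =>
    by_cases hU : ∀ U ⊆ W, (∀ a ∈ U, ∀ b ∈ U, Conn r X a b) → 2 * U.card ≤ W.card
    · exact ⟨∅, by simp, by simpa using hU⟩
    push Not at hU
    obtain ⟨U₀, hU₀, hc₀, hlt⟩ := hU
    have hne : U₀.Nonempty := by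
      rw [Finset.nonempty_iff_ne_empty]; rintro rfl; simp at hlt
    obtain ⟨u, hu⟩ := hne
    -- Only a component with more than half of `W` has to be cut. Its root is removed and the
    -- induction continues inside it.
    obtain ⟨v, hv, h⟩ := h u (hc₀ u hu u hu).1
    obtain ⟨S, hS, hbal⟩ := ih h
    refine ⟨insert v S, (Finset.card_insert_le _ _).trans (by omega), fun U hUW hc => ?_⟩
    -- A set disjoint from `U₀` has fewer than half of the vertices of `W`; any other connected set
    -- lies in the component of `U₀`.
    by_cases hd : Disjoint U U₀
    · have := Finset.card_le_card (Finset.union_subset hUW hU₀)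
      rw [Finset.card_union_of_disjoint hd] at this
      omega
    · obtain ⟨a, haU, ha₀⟩ := Finset.not_disjoint_iff.1 hd
      refine hbal U hUW fun b hb c hcU => ?_
      refine (hc b hb c hcU).subset_of_forall fun x hx => ?_
      have hm := hx.mem_right
      simp only [Finset.coe_insert, Set.mem_sdiff, Set.mem_insert_iff, not_or] at hm
      refine ⟨⟨?_, hm.2.1⟩, hm.2.2⟩
      exact (hc₀ u hu a ha₀).trans (((hc a haU b hb).trans hx).mono Set.sdiff_subset)

end connectivity

/-! ### Tree-depth -/

section forest
variable {W : Type} {F : RootedForest W}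

theorem _root_.RootedForest.not_isAncestor_self (F : RootedForest W) (a : W) : ¬ F.IsAncestor a a :=
  F.wf.transGen.irrefl.irrefl a

theorem _root_.RootedForest.IsAncestor.depth_lt [Finite W] {a b : W} (h : F.IsAncestor a b) :
    F.depth a < F.depth b := by
  refine Set.ncard_lt_ncard ⟨fun c hc => hc.trans h, fun hs => ?_⟩ (Set.toFinite _)
  exact F.not_isAncestor_self a (hs h)

/-- Parents are unique, so the ancestors of a vertex form a chain. -/
theorem _root_.RootedForest.IsAncestor.comparable {a b c : W} (h₁ : F.IsAncestor a c)
    (h₂ : F.IsAncestor b c) : a = b ∨ F.IsAncestor a b ∨ F.IsAncestor b a := by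
  have hu : Relator.RightUnique (Function.swap fun a b => F.parent b = some a) := by
    intro x y z hy hz
    exact Option.some_injective _ (hy.symm.trans hz)
  have h₁' := (Relation.transGen_swap.2 h₁).to_reflTransGen
  have h₂' := (Relation.transGen_swap.2 h₂).to_reflTransGen
  rcases Relation.ReflTransGen.total_of_right_unique hu h₁' h₂' with h | h <;>
    rw [Relation.reflTransGen_iff_eq_or_transGen, Relation.transGen_swap] at h
  · rcases h with h | h
    · exact .inl h.symm
    · exact .inr (.inr h)
  · rcases h with h | h
    · exact .inl h
    · exact .inr (.inl h)

/-- A vertex of least depth in a component is an ancestor of all others: along a walk, an ancestor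
of the next vertex is comparable with it and cannot lie above it. Removing it raises the least depth
in the component by at least one, and depths are bounded by `h`. -/
theorem td_of_forest [Finite W] {r : ℕ → ℕ → Prop} (hr : ∀ ⦃a b⦄, r a b → r b a) (F : RootedForest W) (φ : ℕ → W) (h : ℕ) {t : ℕ}
    {X : Set ℕ} (hinj : Set.InjOn φ X)
    (hadj : ∀ x ∈ X, ∀ y ∈ X, r x y → F.IsAncestor (φ x) (φ y) ∨ F.IsAncestor (φ y) (φ x))
    (hle : ∀ x ∈ X, F.depth (φ x) ≤ h) (ht : ∀ x ∈ X, h + 1 ≤ F.depth (φ x) + t) : TD r t X := by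
  induction t generalizing X with
  | zero =>
    refine Set.eq_empty_of_forall_notMem fun x hx => ?_
    have := hle x hx
    have := ht x hx
    omega
  | succ t ih =>
    intro u hu
    obtain ⟨v, hv, hmin⟩ := (measure fun x => F.depth (φ x)).wf.has_min {x | Conn r X u x}
      ⟨u, .refl hu⟩
    have hmin' : ∀ x, Conn r X u x → ¬ F.IsAncestor (φ x) (φ v) := fun x hx hlt =>
      hmin x hx hlt.depth_lt
    have key : ∀ x, Conn r X v x → φ x = φ v ∨ F.IsAncestor (φ v) (φ x) := by
      intro x hx
      refine hx.induction (P := fun x => φ x = φ v ∨ F.IsAncestor (φ v) (φ x)) (.inl rfl)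
        fun a b ha hP hab hb => ?_
      have hub : Conn r X u b := hv.trans (ha.tail hab hb)
      rcases hadj a ha.mem_right b hb hab with hab | hab
      · rcases hP with hP | hP
        · exact .inr (hP ▸ hab)
        · exact .inr (hP.trans hab)
      · rcases hP with hP | hP
        · exact absurd (hP ▸ hab) (hmin' b hub)
        · rcases hP.comparable hab with h | h | h
          · exact .inl h.symm
          · exact .inr h
          · exact absurd h (hmin' b hub)
    have hsub : {x | Conn r X u x ∧ x ≠ v} ⊆ X := fun x hx => hx.1.mem_right
    refine ⟨v, hv, ih (hinj.mono hsub) (fun x hx y hy => hadj x (hsub hx) y (hsub hy))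
      (fun x hx => hle x (hsub hx)) fun x hx => ?_⟩
    rcases key x ((Conn.symm hr hv).trans hx.1) with h | h
    · exact absurd (hinj (hsub hx) (Conn.mem_right hv) h) hx.2
    · have := h.depth_lt
      have := ht v (Conn.mem_right hv)
      omega

end forest

/-- Adjacency of numbers in a graph on `Fin n`. -/
def rel {n : ℕ} (G : SimpleGraph (Fin n)) (u v : ℕ) : Prop :=
  ∃ (hu : u < n) (hv : v < n), G.Adj ⟨u, hu⟩ ⟨v, hv⟩

theorem rel_symm {n : ℕ} (G : SimpleGraph (Fin n)) : ∀ ⦃a b⦄, rel G a b → rel G b a :=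
  fun _ _ ⟨hu, hv, h⟩ => ⟨hv, hu, h.symm⟩

/-- The rooted forest that consists of one path. -/
def pathForest (n : ℕ) : RootedForest (Fin n) where
  parent i := if 0 < i.1 then some ⟨i.1 - 1, by omega⟩ else none
  wf := by
    refine Subrelation.wf (r := fun a b : Fin n => a < b) (fun {a b} h => ?_) wellFounded_lt
    split_ifs at h with h0
    have := congrArg Fin.val (Option.some_injective _ h)
    change a.1 < b.1
    simp at this; omega

theorem pathForest_isAncestor {n : ℕ} {a : ℕ} (ha : a < n) : ∀ {b : ℕ} (hb : b < n), a < b →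
    (pathForest n).IsAncestor ⟨a, ha⟩ ⟨b, hb⟩
  | b + 1, hb, h => by
    have h1 : (pathForest n).IsAncestor ⟨b, by omega⟩ ⟨b + 1, hb⟩ := .single (by simp [pathForest])
    rcases Nat.lt_succ_iff_lt_or_eq.1 h with h | rfl
    · exact (pathForest_isAncestor ha (by omega) h).trans h1
    · exact h1

/-- The infimum in `treeDepth` is attained because the set is nonempty: the completion of a path on
all vertices is a complete graph. -/
theorem exists_forest {n : ℕ} (G : SimpleGraph (Fin n)) :
    ∃ (m : ℕ) (F : RootedForest (Fin m)), G.IsContained F.completion ∧ F.height = treeDepth G := by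
  refine Nat.sInf_mem (s := {h | ∃ (m : ℕ) (F : RootedForest (Fin m)),
    G.IsContained F.completion ∧ F.height = h}) ⟨_, n, pathForest n, .of_le fun a b h => ?_, rfl⟩
  rw [RootedForest.completion, SimpleGraph.fromRel_adj]
  refine ⟨h.ne, ?_⟩
  rcases lt_or_gt_of_ne (Fin.val_ne_of_ne h.ne) with h | h
  · exact .inl (pathForest_isAncestor a.2 b.2 h)
  · exact .inr (pathForest_isAncestor b.2 a.2 h)

/-- The shift by one turns heights counted in edges into depths counted in vertices. -/
theorem td_treeDepth {n : ℕ} (G : SimpleGraph (Fin n)) :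
    TD (rel G) (treeDepth G + 1) {x | x < n} := by
  rcases Nat.eq_zero_or_pos n with rfl | hn
  · exact fun u hu => absurd hu (Nat.not_lt_zero u)
  obtain ⟨m, F, ⟨f⟩, hF⟩ := exists_forest G
  let φ : ℕ → Fin m := fun x => if h : x < n then f ⟨x, h⟩ else f ⟨0, hn⟩
  have hφ (x : ℕ) (h : x < n) : φ x = f ⟨x, h⟩ := by simp [φ, h]
  refine td_of_forest (rel_symm G) F φ (treeDepth G) (fun x hx y hy h => ?_) (fun x hx y hy h => ?_)
    (fun x hx => ?_) fun x _ => by omega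
  · rw [hφ x hx, hφ y hy] at h
    simpa using f.injective h
  · obtain ⟨hx, hy, h⟩ := h
    rw [hφ x hx, hφ y hy]
    have : (SimpleGraph.fromRel F.IsAncestor).Adj (f ⟨x, hx⟩) (f ⟨y, hy⟩) := f.toHom.map_rel h
    exact ((SimpleGraph.fromRel_adj _ _ _).1 this).2
  · rw [← hF]
    exact Finset.le_sup (f := F.depth) (Finset.mem_univ _)

end Center

/-! ### The search for an elimination order succeeds -/

namespace Center

/-- Adjacency in a list of arcs as a relation. -/
abbrev Arcs.rel (E : Arcs) (u v : ℕ) : Prop := adj E u v = true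

/-- The vertices outside of `A`. -/
def out (n : ℕ) (A : List ℕ) : Set ℕ := {x | x < n ∧ x ∉ A}

theorem mem_expand {E : Arcs} {X B : List ℕ} {x : ℕ} :
    x ∈ expand E X B ↔ x ∈ X ∧ (x ∈ B ∨ ∃ y ∈ B, E.rel y x) := by
  simp [expand]

theorem mem_ball {E : Arcs} {X : List ℕ} {v w i : ℕ} :
    w ∈ ball E X v i ↔ Near E.rel {x | x ∈ X} i v w := by
  unfold ball
  induction i generalizing w with
  | zero =>
    simp only [Function.iterate_zero_apply, List.mem_filter, beq_iff_eq, Near]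
    constructor <;> (rintro ⟨h, rfl⟩; exact ⟨h, rfl⟩)
  | succ i ih =>
    rw [Function.iterate_succ_apply', mem_expand, Near]
    simp only [ih]
    constructor
    · rintro ⟨hw, h | ⟨y, hy, h⟩⟩
      · exact ⟨w, h, .inl rfl, hw⟩
      · exact ⟨y, hy, .inr h, hw⟩
    · rintro ⟨y, hy, rfl | h, hw⟩
      · exact ⟨hw, .inl hy⟩
      · exact ⟨hw, .inr ⟨y, hy, h⟩⟩

theorem coe_compl (n : ℕ) (A : List ℕ) : {x | x ∈ compl (List.range n) A} = out n A := by
  ext x; simp [out]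

/-- The walk is traced back from `b`: a vertex at distance at most `j + 1` from `a` is equal or
adjacent to one at distance at most `j`, so the default value in `pathStep` is never used. At radius
`0` the head is `a`. -/
theorem path_conn {E : Arcs} {X : List ℕ} {a b : ℕ} {Y : Set ℕ} : ∀ {j : ℕ} {p : List ℕ},
    p.headD b ∈ ball E X a j → p ≠ [] →
    (∀ y ∈ (List.range j).reverse.foldl (pathStep E X a b) p, y ∈ Y) →
    ((∀ y ∈ p, y ∈ Y) → Conn E.rel Y (p.headD b) b) → Conn E.rel Y a b
  | 0, p, hp, _, hY, hc => by
    have : p.headD b = a := by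
      rw [mem_ball] at hp; exact hp.2
    rw [← this]
    exact hc hY
  | j + 1, p, hp, hne, hY, hc => by
    rw [List.range_succ, List.reverse_append, List.reverse_singleton, List.singleton_append,
      List.foldl_cons] at hY
    obtain ⟨y, hy, hyp⟩ : ∃ y ∈ ball E X a j, (y == p.headD b || adj E y (p.headD b)) = true := by
      rw [mem_ball] at hp
      obtain ⟨y, hy, h, -⟩ := hp
      exact ⟨y, mem_ball.2 hy, by simpa using h⟩
    have hs : ∃ z, pathStep E X a b p j = z :: p ∧ z ∈ ball E X a j ∧
        (z = p.headD b ∨ E.rel z (p.headD b)) := by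
      have hmem := (List.mem_filter (p := fun y => y == p.headD b || adj E y (p.headD b))).2 ⟨hy, hyp⟩
      refine ⟨_, rfl, ?_⟩
      cases hf : (ball E X a j).filter fun y => y == p.headD b || adj E y (p.headD b) with
      | nil => rw [hf] at hmem; simp at hmem
      | cons z l =>
        have hz : z ∈ (ball E X a j).filter fun y => y == p.headD b || adj E y (p.headD b) := by
          rw [hf]; simp
        rw [List.mem_filter] at hz
        exact ⟨hz.1, by simpa using hz.2⟩
    obtain ⟨z, hz, hzb, hzp⟩ := hs
    rw [hz] at hY
    refine path_conn (p := z :: p) hzb (by simp) hY fun hz' => ?_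
    have h1 := hc fun y hy => hz' y (by simp [hy])
    rcases hzp with h | h
    · rw [List.headD_cons, h]; exact h1
    · exact ((Conn.refl (hz' z (by simp))).tail h h1.1).trans h1

theorem conn_of_path {E : Arcs} {X : List ℕ} {a b L : ℕ} {Y : Set ℕ} (h : b ∈ ball E X a L)
    (hY : ∀ y ∈ path E X a b L, y ∈ Y) : Conn E.rel Y a b :=
  path_conn (p := [b]) h (by simp) hY fun hb => .refl (hb b (by simp))

theorem length_le_of_subset {l l' : List ℕ} (h : l.Nodup) (hs : l ⊆ l') : l.length ≤ l'.length :=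
  (h.subperm hs).length_le

theorem length_fam_le {E : Arcs} {V W : List ℕ} {L cap i : ℕ} :
    (fam E V W L cap i).length ≤ (1 + W.length * (W.length * (L + 1))) ^ i := by
  unfold fam
  induction i with
  | zero => simp
  | succ i ih =>
    rw [Function.iterate_succ_apply', famStep, pow_succ, mul_add, mul_one]
    refine (List.length_take_le' _ _).trans ?_
    simp only [List.length_append, List.length_flatMap, List.length_map, length_path, List.map_const',
      List.sum_replicate, smul_eq_mul]
    exact add_le_add ih (Nat.mul_le_mul_right _ ih)

/-- A sufficiently large cap means that no candidate is cut off. -/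
theorem fam_succ {E : Arcs} {V W : List ℕ} {L cap i : ℕ}
    (h : (1 + W.length * (W.length * (L + 1))) ^ (i + 1) ≤ cap) :
    fam E V W L cap (i + 1) = fam E V W L cap i ++ (fam E V W L cap i).flatMap fun S =>
      W.flatMap fun a => W.flatMap fun b => (path E (compl V S) a b L).map fun x => x :: S := by
  have h1 := length_fam_le (E := E) (V := V) (W := W) (L := L) (cap := cap) (i := i)
  rw [fam, Function.iterate_succ_apply', famStep, ← fam, List.take_of_length_le]
  refine le_trans ?_ h
  simp only [List.length_append, List.length_flatMap, List.length_map, length_path, List.map_const',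
    List.sum_replicate, smul_eq_mul]
  refine (add_le_add h1 (Nat.mul_le_mul_right _ h1)).trans_eq ?_
  ring

/-- Every placement includes at least the vertex `v` itself, so `n` rounds exhaust all vertices,
whether or not a separator is found. -/
theorem length_order_aux {E : Arcs} {n L w cap t : ℕ} (i : ℕ) :
    (compl (List.range n) ((place E (List.range n) L w cap t)^[i] [])).length ≤ n - i := by
  induction i with
  | zero => exact (List.length_filter_le _ _).trans (by simp)
  | succ i ih =>
    rw [Function.iterate_succ_apply']
    set A := (place E (List.range n) L w cap t)^[i] [] with hA
    unfold place
    cases h : (compl (List.range n) A).isEmpty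
    · have hv : (compl (List.range n) A).headD 0 ∈ compl (List.range n) A := by
        cases hc : compl (List.range n) A with
        | nil => rw [hc] at h; simp at h
        | cons v l => simp
      set v := (compl (List.range n) A).headD 0 with hv'
      have hvb : v ∈ ball E (compl (List.range n) A) v L :=
        mem_ball.2 (Near.le (i := 0) ⟨hv, rfl⟩ (Nat.zero_le _))
      have hnd : (v :: compl (List.range n) (placeAt E (List.range n) L w cap t A v
          (ball E (compl (List.range n) A) v L))).Nodup := by
        refine List.nodup_cons.2 ⟨?_, List.nodup_range.filter _⟩
        rw [mem_compl, not_and_not_right]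
        intro _
        exact List.mem_append_left _ (List.mem_filter.2 ⟨hvb, by simp⟩)
      have := length_le_of_subset hnd (l' := compl (List.range n) A) (by
        refine List.cons_subset.2 ⟨hv, fun x hx => ?_⟩
        rw [mem_compl] at hx ⊢
        exact ⟨hx.1, fun hxA => hx.2 (List.mem_append_right _ hxA)⟩)
      simp only [List.length_cons, cond_false] at this ⊢
      omega
    · rw [cond_true, List.isEmpty_iff.1 h]; simp

theorem order_perm (E : Arcs) (n L w cap t : ℕ) : (order E n L w cap t).Perm (List.range n) := by
  have h1 := order_inv (E := E) (n := n) (L := L) (w := w) (cap := cap) (t := t) (i := n)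
  unfold order
  rw [List.perm_ext_iff_of_nodup h1.1 List.nodup_range]
  refine fun x => ⟨fun h => h1.2 h, fun h => ?_⟩
  have h2 := length_order_aux (E := E) (n := n) (L := L) (w := w) (cap := cap) (t := t) n
  rw [Nat.sub_self, Nat.le_zero, List.length_eq_zero_iff] at h2
  by_contra hx
  have : x ∈ compl (List.range n) (order E n L w cap t) := mem_compl.2 ⟨h, hx⟩
  rw [order, h2] at this
  simp at this

section success
variable {E : Arcs} {n t : ℕ} (hr : ∀ ⦃a b⦄, E.rel a b → E.rel b a)
  (hT : TD E.rel t {x | x < n})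
include hr hT

/-- By the distance bound of `TD.near`, a ball of radius 2^t is a whole component. -/
theorem mem_ball_compl {A : List ℕ} {v y : ℕ} :
    y ∈ ball E (compl (List.range n) A) v (2 ^ t) ↔ Conn E.rel (out n A) v y := by
  rw [mem_ball, coe_compl]
  refine ⟨Near.conn, fun h => (TD.near hr (hT.mono ?_) h).le (Nat.sub_le _ _)⟩
  exact fun x hx => hx.1

theorem mem_bd {A : List ℕ} {u a : ℕ} :
    a ∈ bd E A (ball E (compl (List.range n) A) u (2 ^ t)) ↔
      a ∈ A ∧ ∃ y, Conn E.rel (out n A) u y ∧ E.rel y a := by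
  simp only [bd, List.mem_filter, List.any_eq_true, mem_ball_compl hr hT]

omit hr hT in
theorem narrow_iff {A : List ℕ} {w : ℕ} : narrow E (List.range n) (2 ^ t) w A = true ↔
    ∀ u ∈ out n A, (bd E A (ball E (compl (List.range n) A) u (2 ^ t))).length ≤ w := by
  simp only [narrow, List.all_eq_true, Nat.ble_eq, mem_compl, List.mem_range]
  rfl

/-- Neighbors of a component after some vertices `s` of the component of `v` have been placed. -/
theorem mem_bd_append {A s : List ℕ} {u v a : ℕ} (hs : ∀ x ∈ s, Conn E.rel (out n A) v x)
    (ha : a ∈ bd E (s ++ A) (ball E (compl (List.range n) (s ++ A)) u (2 ^ t))) :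
    (¬ Conn E.rel (out n A) v u → a ∈ bd E A (ball E (compl (List.range n) A) u (2 ^ t))) ∧
      (Conn E.rel (out n A) v u → a ∈ s ∨
        a ∈ bd E A (ball E (compl (List.range n) A) v (2 ^ t))) := by
  rw [mem_bd hr hT] at ha
  obtain ⟨ha, y, hy, hya⟩ := ha
  have hy' : Conn E.rel (out n A) u y := hy.mono fun x hx =>
    ⟨hx.1, fun h => hx.2 (List.mem_append_right _ h)⟩
  refine ⟨fun hvu => ?_, fun hvu => ?_⟩
  · refine (mem_bd hr hT).2 ⟨?_, y, hy', hya⟩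
    rcases List.mem_append.1 ha with h | h
    · exact absurd ((hs a h).trans ((hy'.tail hya (hs a h).mem_right).symm hr)) hvu
    · exact h
  · rcases List.mem_append.1 ha with h | h
    · exact .inl h
    · exact .inr ((mem_bd hr hT).2 ⟨h, y, hvu.trans hy', hya⟩)

/-- If `S` fails, some component has a neighborhood containing more than half of `W` outside `S`.
These vertices are pairwise connected outside `S`, but not all pairwise connected outside the
balanced separator `S₀`. A path outside `S` between an offending pair must therefore meet `S₀`. -/
theorem exists_extension {A S : List ℕ} {v : ℕ} (hA : A.Nodup) (hAV : A ⊆ List.range n)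
    (hnar : narrow E (List.range n) (2 ^ t) (2 * t + 1) A = true)
    (hv : v ∈ compl (List.range n) A) (hS : S.length ≤ t)
    (hnot : narrow E (List.range n) (2 ^ t) (2 * t + 1)
      (news (ball E (compl (List.range n) A) v (2 ^ t)) v S ++ A) = false) {S₀ : Finset ℕ}
    (hS₀ : ∀ U ⊆ (bd E A (ball E (compl (List.range n) A) v (2 ^ t))).toFinset,
      (∀ a ∈ U, ∀ b ∈ U, Conn E.rel ({x | x < n} \ S₀) a b) →
      2 * U.card ≤ (bd E A (ball E (compl (List.range n) A) v (2 ^ t))).toFinset.card) :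
    ∃ a ∈ bd E A (ball E (compl (List.range n) A) v (2 ^ t)),
      ∃ b ∈ bd E A (ball E (compl (List.range n) A) v (2 ^ t)),
        ∃ x ∈ path E (compl (List.range n) S) a b (2 ^ t), x ∈ S₀ ∧ x ∉ S := by
  set C := ball E (compl (List.range n) A) v (2 ^ t) with hC
  set W := bd E A C with hW
  have hvA : v ∈ out n A := by simpa [out] using hv
  have hCs : ∀ x ∈ news C v S, Conn E.rel (out n A) v x := fun x hx =>
    (mem_ball_compl hr hT).1 (List.mem_filter.1 hx).1
  have hCnd : C.Nodup := (List.nodup_range.sublist List.filter_sublist).sublist (ball_sublist _ _ _ _)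
  have hnd : (news C v S ++ A).Nodup := by
    refine List.Nodup.append (hCnd.filter _) hA fun x hx hxA => ?_
    exact (hCs x hx).mem_right.2 hxA
  rw [← Bool.not_eq_true, narrow_iff] at hnot
  push Not at hnot
  obtain ⟨u, hu, hlt⟩ := hnot
  set B := bd E (news C v S ++ A) (ball E (compl (List.range n) (news C v S ++ A)) u (2 ^ t)) with hB
  have hBnd : B.Nodup := hnd.filter _
  have huA : u ∈ out n A := ⟨hu.1, fun h => hu.2 (List.mem_append_right _ h)⟩
  -- The other components keep their old, small neighborhoods.
  have hvu : Conn E.rel (out n A) v u := by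
    by_contra hvu
    have h1 := length_le_of_subset hBnd fun a ha => (mem_bd_append hr hT hCs ha).1 hvu
    have h2 := (narrow_iff).1 hnar u huA
    omega
  -- `B` has at least `2t + 2` elements and at most `t + 1` of them are `v` or in `S`; the others
  -- belong to `W`. So `U` has at least `t + 1` elements, more than half of `W`.
  set U := B.filter fun a => decide (a ∈ W ∧ a ∉ S) with hU
  have hrest : (B.filter fun a => !decide (a ∈ W ∧ a ∉ S)).length ≤ (v :: S).length := by
    refine length_le_of_subset (hBnd.filter _) fun a ha => ?_
    simp only [List.mem_filter, Bool.not_eq_true', decide_eq_false_iff_not, not_and_not_right] at ha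
    rcases (mem_bd_append hr hT hCs ha.1).2 hvu with h | h
    · have := (List.mem_filter.1 h).2
      simpa using this
    · exact List.mem_cons_of_mem _ (ha.2 h)
  have hlen := List.length_eq_length_filter_add (l := B) fun a => decide (a ∈ W ∧ a ∉ S)
  rw [← hU] at hlen
  have hWl : W.length ≤ 2 * t + 1 := (narrow_iff).1 hnar v hvA
  have hUcard : U.toFinset.card = U.length := List.toFinset_card_of_nodup (hBnd.filter _)
  have hWcard := W.toFinset_card_le
  have hnc : ¬ ∀ a ∈ U.toFinset, ∀ b ∈ U.toFinset, Conn E.rel ({x | x < n} \ S₀) a b := by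
    intro hc
    have := hS₀ U.toFinset (fun a ha => by
      simp only [hU, List.mem_toFinset, List.mem_filter, decide_eq_true_eq] at ha
      exact List.mem_toFinset.2 ha.2.1) hc
    simp only [List.length_cons] at hrest
    omega
  push Not at hnc
  obtain ⟨a, ha, b, hb, hab⟩ := hnc
  have hconn : ∀ a ∈ U.toFinset, a ∈ W ∧ a ∉ S ∧ a < n ∧ Conn E.rel (out n S) u a := by
    intro a ha
    simp only [hU, List.mem_toFinset, List.mem_filter, decide_eq_true_eq] at ha
    obtain ⟨haB, haW, haS⟩ := ha
    have han : a < n := List.mem_range.1 (hAV (List.mem_filter.1 haW).1)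
    obtain ⟨-, y, hy, hya⟩ := (mem_bd hr hT).1 haB
    refine ⟨haW, haS, han, Conn.tail (hy.subset_of_forall fun z hz => ⟨hz.mem_right.1, fun hzS => ?_⟩)
      hya ⟨han, haS⟩⟩
    refine hz.mem_right.2 (List.mem_append_left _ (List.mem_filter.2 ⟨(mem_ball_compl hr hT).2 ?_, ?_⟩))
    · exact hvu.trans (hz.mono fun x hx => ⟨hx.1, fun h => hx.2 (List.mem_append_right _ h)⟩)
    · simp [hzS]
  obtain ⟨haW, haS, -, hua⟩ := hconn a ha
  obtain ⟨hbW, hbS, hbn, hub⟩ := hconn b hb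
  have hball := (mem_ball_compl hr hT).2 ((hua.symm hr).trans hub)
  have hpath : ∀ y ∈ path E (compl (List.range n) S) a b (2 ^ t), y < n ∧ y ∉ S := by
    intro y hy
    rcases mem_path hy with h | rfl
    · simpa using h
    · exact ⟨hbn, hbS⟩
  by_contra hcon
  push Not at hcon
  refine hab (conn_of_path hball fun y hy => ⟨(hpath y hy).1, fun hyS => ?_⟩)
  exact (hpath y hy).2 (hcon a haW b hbW y hy hyS)

/-- If all candidates failed, `exists_extension` would enlarge a candidate inside `S₀` one vertex at
a time, ending with `t + 1` distinct vertices in a set of size at most `t`. -/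
theorem exists_separator {A : List ℕ} {v cap : ℕ} (hA : A.Nodup) (hAV : A ⊆ List.range n)
    (hnar : narrow E (List.range n) (2 ^ t) (2 * t + 1) A = true)
    (hv : v ∈ compl (List.range n) A)
    (hcap : (1 + (2 * t + 1) * ((2 * t + 1) * (2 ^ t + 1))) ^ t ≤ cap) :
    ∃ S ∈ fam E (List.range n) (bd E A (ball E (compl (List.range n) A) v (2 ^ t))) (2 ^ t) cap t,
      narrow E (List.range n) (2 ^ t) (2 * t + 1)
        (news (ball E (compl (List.range n) A) v (2 ^ t)) v S ++ A) = true := by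
  set C := ball E (compl (List.range n) A) v (2 ^ t) with hC
  set W := bd E A C with hW
  have hWl : W.length ≤ 2 * t + 1 := (narrow_iff).1 hnar v (by simpa [out] using hv)
  obtain ⟨S₀, hS₀, hbal⟩ := hT.exists_balanced W.toFinset
  by_contra hcon
  push Not at hcon
  have hcap' (i : ℕ) (hi : i ≤ t) : (1 + W.length * (W.length * (2 ^ t + 1))) ^ i ≤ cap := by
    refine le_trans ?_ hcap
    refine (Nat.pow_le_pow_left ?_ i).trans (Nat.pow_le_pow_right (by omega) hi)
    gcongr
  have hmono : ∀ j, j ≤ t → ∀ i ≤ j, fam E (List.range n) W (2 ^ t) cap i ⊆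
      fam E (List.range n) W (2 ^ t) cap j := by
    intro j hj
    induction j with
    | zero => intro i hi; obtain rfl := Nat.le_zero.1 hi; exact fun _ h => h
    | succ j ih =>
      intro i hi
      rcases Nat.lt_or_eq_of_le hi with h | rfl
      · rw [fam_succ (hcap' _ hj)]
        exact fun S hS => List.mem_append_left _ (ih (by omega) i (by omega) hS)
      · exact fun _ h => h
  have hext : ∀ i ≤ t, ∀ S ∈ fam E (List.range n) W (2 ^ t) cap i, ∃ a ∈ W, ∃ b ∈ W,
      ∃ x ∈ path E (compl (List.range n) S) a b (2 ^ t), x ∈ S₀ ∧ x ∉ S := fun i hi S hS =>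
    exists_extension hr hT hA hAV hnar hv ((mem_fam hS).1.trans hi)
      (by simpa using hcon S (hmono t le_rfl i hi hS)) hbal
  have key : ∀ i ≤ t, ∃ S ∈ fam E (List.range n) W (2 ^ t) cap i, S.Nodup ∧ S.length = i ∧
      ∀ x ∈ S, x ∈ S₀ := by
    intro i
    induction i with
    | zero => exact fun _ => ⟨[], by simp [fam], by simp⟩
    | succ i ih =>
      intro hi
      obtain ⟨S, hS, hnd, hl, hsub⟩ := ih (by omega)
      obtain ⟨a, ha, b, hb, x, hx, hx₀, hxS⟩ := hext i (by omega) S hS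
      refine ⟨x :: S, ?_, List.nodup_cons.2 ⟨hxS, hnd⟩, by simp [hl], by simpa using ⟨hx₀, hsub⟩⟩
      rw [fam_succ (hcap' _ hi)]
      refine List.mem_append_right _ ?_
      simp only [List.mem_flatMap, List.mem_map]
      exact ⟨S, hS, a, ha, b, hb, x, hx, rfl⟩
  obtain ⟨S, hS, hnd, hl, hsub⟩ := key t le_rfl
  obtain ⟨a, ha, b, hb, x, hx, hx₀, hxS⟩ := hext t le_rfl S hS
  have h1 : (x :: S).toFinset.card = t + 1 := by
    rw [List.toFinset_card_of_nodup (List.nodup_cons.2 ⟨hxS, hnd⟩)]; simp [hl]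
  have h2 : (x :: S).toFinset ⊆ S₀ := by
    intro y hy
    rcases List.mem_cons.1 (List.mem_toFinset.1 hy) with rfl | h
    · exact hx₀
    · exact hsub y h
  have := Finset.card_le_card h2
  omega

/-- Some vertices of a component are placed such that all components stay narrow. -/
theorem placeAt_spec {A : List ℕ} {v cap : ℕ} (hA : A.Nodup) (hAV : A ⊆ List.range n)
    (hnar : narrow E (List.range n) (2 ^ t) (2 * t + 1) A = true)
    (hv : v ∈ compl (List.range n) A)
    (hcap : (1 + (2 * t + 1) * ((2 * t + 1) * (2 ^ t + 1))) ^ t ≤ cap) :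
    ∃ s : List ℕ, placeAt E (List.range n) (2 ^ t) (2 * t + 1) cap t A v
        (ball E (compl (List.range n) A) v (2 ^ t)) = s ++ A ∧ s.length ≤ t + 1 ∧
      (∀ x ∈ s, Conn E.rel (out n A) v x) ∧
      narrow E (List.range n) (2 ^ t) (2 * t + 1) (s ++ A) = true := by
  obtain ⟨S, hS, hSn⟩ := exists_separator hr hT hA hAV hnar hv hcap
  set C := ball E (compl (List.range n) A) v (2 ^ t) with hC
  have hmem := (List.mem_filter (p := fun S =>
    narrow E (List.range n) (2 ^ t) (2 * t + 1) (news C v S ++ A))).2 ⟨hS, hSn⟩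
  unfold placeAt
  cases hf : (fam E (List.range n) (bd E A C) (2 ^ t) cap t).filter fun S =>
      narrow E (List.range n) (2 ^ t) (2 * t + 1) (news C v S ++ A) with
  | nil => rw [hf] at hmem; simp at hmem
  | cons S' l =>
    have hS' : S' ∈ (fam E (List.range n) (bd E A C) (2 ^ t) cap t).filter fun S =>
        narrow E (List.range n) (2 ^ t) (2 * t + 1) (news C v S ++ A) := by rw [hf]; simp
    rw [List.mem_filter] at hS'
    refine ⟨_, rfl, ?_, fun x hx => (mem_ball_compl hr hT).1 (List.mem_filter.1 hx).1, hS'.2⟩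
    have hCnd : C.Nodup :=
      (List.nodup_range.sublist List.filter_sublist).sublist (ball_sublist _ _ _ _)
    refine (length_le_of_subset (l' := v :: S') (hCnd.filter _) fun x hx => ?_).trans ?_
    · simpa using (List.mem_filter.1 hx).2
    · simpa using (mem_fam hS'.1).1

/-- Suffixes between two placements add at most `t + 1` vertices to a neighborhood of size at most
`2t + 1`, whence `3t + 2`. Components other than that of `v` do not change. -/
theorem narrow_suffix {A s B : List ℕ} {v : ℕ} (hnd : (s ++ A).Nodup) (hv : v ∈ out n A)
    (hnar : narrow E (List.range n) (2 ^ t) (2 * t + 1) A = true)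
    (hs : ∀ x ∈ s, Conn E.rel (out n A) v x) (hl : s.length ≤ t + 1)
    (hA : ∀ B, B <:+ A → narrow E (List.range n) (2 ^ t) (3 * t + 2) B = true)
    (hB : B <:+ s ++ A) : narrow E (List.range n) (2 ^ t) (3 * t + 2) B = true := by
  rcases le_total B.length A.length with h | h
  · exact hA B (List.suffix_of_suffix_length_le hB (List.suffix_append s A) h)
  obtain ⟨s', rfl⟩ := List.suffix_of_suffix_length_le (List.suffix_append s A) hB h
  obtain ⟨p, hp⟩ := hB
  rw [← List.append_assoc, List.append_cancel_right_eq] at hp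
  subst hp
  have hs' : ∀ x ∈ s', Conn E.rel (out n A) v x := fun x hx => hs x (List.mem_append_right _ hx)
  have hnd' : (s' ++ A).Nodup := by
    rw [List.append_assoc] at hnd; exact hnd.of_append_right
  rw [narrow_iff] at hnar ⊢
  intro u hu
  have huA : u ∈ out n A := ⟨hu.1, fun h => hu.2 (List.mem_append_right _ h)⟩
  by_cases hvu : Conn E.rel (out n A) v u
  · have := length_le_of_subset (l' := s' ++ bd E A (ball E (compl (List.range n) A) v (2 ^ t)))
      (hnd'.filter _) fun a ha => List.mem_append.2 ((mem_bd_append hr hT hs' ha).2 hvu)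
    have h1 := hnar v hv
    simp only [List.length_append] at hl this
    unfold bd at *
    omega
  · have := length_le_of_subset (hnd'.filter _) fun a ha => (mem_bd_append hr hT hs' ha).1 hvu
    have h1 := hnar u huA
    unfold bd at *
    omega

/-- The suffixes of the order are the sets of vertices not yet eliminated, so this bounds the
neighborhoods of all components of eliminated vertices at every stage. -/
theorem order_narrow {cap : ℕ}
    (hcap : (1 + (2 * t + 1) * ((2 * t + 1) * (2 ^ t + 1))) ^ t ≤ cap) {B : List ℕ}
    (hB : B <:+ order E n (2 ^ t) (2 * t + 1) cap t) :
    narrow E (List.range n) (2 ^ t) (3 * t + 2) B = true := by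
  suffices ∀ i, narrow E (List.range n) (2 ^ t) (2 * t + 1)
      ((place E (List.range n) (2 ^ t) (2 * t + 1) cap t)^[i] []) = true ∧
      ∀ B, B <:+ (place E (List.range n) (2 ^ t) (2 * t + 1) cap t)^[i] [] →
        narrow E (List.range n) (2 ^ t) (3 * t + 2) B = true from (this n).2 B hB
  intro i
  induction i with
  | zero =>
    refine ⟨(narrow_iff).2 fun u _ => by simp [bd], fun B hB => ?_⟩
    rw [Function.iterate_zero_apply, List.suffix_nil] at hB
    subst hB
    exact (narrow_iff).2 fun u _ => by simp [bd]
  | succ i ih =>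
    have hinv := order_inv (E := E) (n := n) (L := 2 ^ t) (w := 2 * t + 1) (cap := cap) (t := t) (i := i)
    have hinv' := order_inv (E := E) (n := n) (L := 2 ^ t) (w := 2 * t + 1) (cap := cap) (t := t)
      (i := i + 1)
    rw [Function.iterate_succ_apply'] at hinv' ⊢
    set A := (place E (List.range n) (2 ^ t) (2 * t + 1) cap t)^[i] [] with hA
    unfold place at hinv' ⊢
    cases h : (compl (List.range n) A).isEmpty
    · have hv : (compl (List.range n) A).headD 0 ∈ compl (List.range n) A := by
        cases hc : compl (List.range n) A with
        | nil => rw [hc] at h; simp at h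
        | cons v l => simp
      rw [h, cond_false] at hinv'
      obtain ⟨s, hs, hl, hc, hn⟩ := placeAt_spec hr hT hinv.1 hinv.2 ih.1 hv hcap
      rw [hs] at hinv' 
      rw [cond_false, hs]
      exact ⟨hn, fun B hB => narrow_suffix hr hT hinv'.1 (by simpa [out] using hv) ih.1 hc hl ih.2 hB⟩
    · exact ih

end success

end Center

/-! ### The tables stay small -/

namespace Center

/-- All labellings of a list of vertices with labels up to `R` and bits. -/
def states (R : ℕ) : List ℕ → List (List (ℕ × ℕ × Bool))
  | [] => [[]]
  | v :: W => (states R W).flatMap fun s => (List.range (R + 1)).flatMap fun a =>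
      [(v, a, false) :: s, (v, a, true) :: s]

theorem length_states (R : ℕ) (W : List ℕ) : (states R W).length = (2 * (R + 1)) ^ W.length := by
  induction W with
  | nil => rfl
  | cons v W ih => simp [states, List.length_flatMap, ih, pow_succ, mul_comm]

theorem map_mem_states {R : ℕ} {W : List ℕ} {l : ℕ → ℕ} {b : ℕ → Bool} (hl : ∀ v, l v ≤ R) :
    (W.map fun v => (v, l v, b v)) ∈ states R W := by
  induction W with
  | nil => simp [states]
  | cons v W ih =>
    simp only [states, List.map_cons, List.mem_flatMap]
    refine ⟨_, ih, l v, List.mem_range.2 (Nat.lt_succ_of_le (hl v)), ?_⟩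
    cases b v <;> simp

/-- The table has no duplicates, and an entry is determined by a label and a bit for each vertex of
the scope and a cost up to `k`. -/
theorem length_joinTable_le {k R : ℕ} {W : List ℕ} {T U : List Entry}
    (hT : ∀ e ∈ T, ∀ q ∈ e.1, q.2.1 ≤ R) (hU : ∀ e ∈ U, ∀ q ∈ e.1, q.2.1 ≤ R) :
    (joinTable k W T U).length ≤ (2 * (R + 1)) ^ W.length * (k + 1) := by
  have h : (joinTable k W T U).length ≤
      ((states R W).flatMap fun s => (List.range (k + 1)).map fun c => (s, c)).length := by
    refine ((nodup_dedup _).subperm fun e he => ?_).length_le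
    obtain ⟨a, ha, b, hb, -, hc, rfl⟩ := mem_joinTable.1 he
    simp only [List.mem_flatMap, List.mem_map, List.mem_range]
    refine ⟨_, map_mem_states (l := label (a.1 ++ b.1)) (b := bit (a.1 ++ b.1)) (label_le ?_), _,
      Nat.lt_succ_of_le hc, rfl⟩
    exact fun q hq => (List.mem_append.1 hq).elim (hT a ha q) (hU b hb q)
  refine h.trans ?_
  simp [List.length_flatMap, length_states]

/-- Factors without truncation, with scope in `N` and labels up to `R`. -/
structure Fine (R : ℕ) (N : List ℕ) (f : Factor) : Prop where
  ok : f.2.2 = true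
  scope : f.1 ⊆ N
  label : ∀ e ∈ f.2.1, ∀ q ∈ e.1, q.2.1 ≤ R

theorem Fine.join {R n k cap : ℕ} {N : List ℕ} {f g : Factor} (hf : Fine R N f) (hg : Fine R N g)
    (hcap : (2 * (R + 1)) ^ N.length * (k + 1) ≤ cap) :
    Fine R N (join (List.range n) k cap f g) := by
  have hW : joinScope (List.range n) f.1 g.1 ⊆ N := fun v hv =>
    (mem_joinScope.1 hv).2.elim (fun h => hf.scope h) (fun h => hg.scope h)
  refine ⟨?_, hW, fun e he => ?_⟩
  · simp only [Center.join, hf.ok, hg.ok, Bool.true_and, Nat.ble_eq]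
    refine (length_joinTable_le hf.label hg.label).trans (le_trans ?_ hcap)
    exact Nat.mul_le_mul_right _ (Nat.pow_le_pow_right (by omega)
      (length_le_of_subset (List.nodup_range.filter _) hW))
  · obtain ⟨a, ha, b, hb, -, hc, rfl⟩ := mem_joinTable.1 (List.mem_of_mem_take he)
    simp only [merge, List.mem_map, forall_exists_index, and_imp, forall_apply_eq_imp_iff₂]
    intro v _
    exact label_le (fun q hq => (List.mem_append.1 hq).elim (hf.label a ha q) (hg.label b hb q)) v

theorem Fine.foldl_join {R n k cap : ℕ} {N : List ℕ} {f : Factor} {Fs : List Factor}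
    (hf : Fine R N f) (hF : ∀ g ∈ Fs, Fine R N g)
    (hcap : (2 * (R + 1)) ^ N.length * (k + 1) ≤ cap) :
    Fine R N (Fs.foldl (Center.join (List.range n) k cap) f) := by
  induction Fs generalizing f with
  | nil => exact hf
  | cons g Fs ih =>
    exact ih (hf.join (hF g (by simp)) hcap) fun g hg => hF g (by simp [hg])

/-- The scope consists of neighbors of a connected set of eliminated vertices, or is an edge. -/
def Local (E : Arcs) (n : ℕ) (B : List ℕ) (f : Factor) : Prop :=
  (∃ u ∈ out n B, ∀ a ∈ f.1, ∃ y, Conn E.rel (out n B) u y ∧ E.rel y a) ∨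
    ∃ a b, f.1 = [a, b] ∧ E.rel a b

section
variable {E : Arcs} {n t : ℕ} (hr : ∀ ⦃a b⦄, E.rel a b → E.rel b a)
  (hT : TD E.rel t {x | x < n})
include hr hT

/-- All factors containing `v` merge at `v`: their scopes lie in `v` and the neighborhood of the
component of `v` among the eliminated vertices, which now include `v`. So joined scopes have at most
`1 + (3t + 2)` vertices, and the new factor is again local. -/
theorem elim_fine {R k cap v : ℕ} {B : List ℕ} {Fs : List Factor} (hB : (v :: B).Nodup)
    (hv : v < n) (hF : ∀ f ∈ Fs, Fine R (v :: B) f ∧ Local E n (v :: B) f)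
    (hnar : narrow E (List.range n) (2 ^ t) (3 * t + 2) B = true)
    (hcap : (2 * (R + 1)) ^ (3 * t + 3) * (k + 1) ≤ cap) :
    ∀ f ∈ elim (List.range n) k R cap Fs v, Fine R B f ∧ Local E n B f := by
  rw [List.nodup_cons] at hB
  have hvB : v ∈ out n B := ⟨hv, hB.1⟩
  have hout : out n (v :: B) ⊆ out n B := fun x hx => ⟨hx.1, fun h => hx.2 (by simp [h])⟩
  set N := bd E B (ball E (compl (List.range n) B) v (2 ^ t)) with hN
  have hNl : N.length ≤ 3 * t + 2 := narrow_iff.1 hnar v hvB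
  have hins : ∀ f ∈ Fs, v ∈ f.1 → Fine R (v :: N) f := by
    intro f hf hvf
    obtain ⟨hfine, hloc⟩ := hF f hf
    refine ⟨hfine.ok, fun a ha => ?_, hfine.label⟩
    by_cases hav : a = v
    · simp [hav]
    have haB : a ∈ B := (List.mem_cons.1 (hfine.scope ha)).resolve_left hav
    refine List.mem_cons_of_mem _ ((mem_bd hr hT).2 ⟨haB, ?_⟩)
    rcases hloc with ⟨u, -, hu⟩ | ⟨x, y, hxy, hadj⟩
    · obtain ⟨y, hy, hya⟩ := hu a ha
      obtain ⟨y', hy', hyv⟩ := hu v hvf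
      exact ⟨y, (((hy'.mono hout).tail hyv hvB).symm hr).trans (hy.mono hout), hya⟩
    · rw [hxy] at ha hvf
      simp only [List.mem_cons, List.not_mem_nil, or_false] at ha hvf
      refine ⟨v, .refl hvB, ?_⟩
      rcases hvf with rfl | rfl <;> rcases ha with rfl | rfl
      · exact absurd rfl hav
      · exact hadj
      · exact hr hadj
      · exact absurd rfl hav
  have hJ : Fine R (v :: N) ((Fs.filter fun f => mem v f.1).foldl (join (List.range n) k cap)
      (vertexFactor R v)) := by
    refine Fine.foldl_join ⟨rfl, by simp [vertexFactor], fun e he q hq => ?_⟩ (fun f hf => ?_) ?_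
    · simp only [vertexFactor, List.mem_map, List.mem_range] at he
      obtain ⟨a, ha, rfl⟩ := he
      obtain rfl := List.mem_singleton.1 hq
      exact Nat.le_of_lt_succ ha
    · exact hins f (List.mem_filter.1 hf).1 (by simpa using (List.mem_filter.1 hf).2)
    · refine le_trans (Nat.mul_le_mul_right _ (Nat.pow_le_pow_right (by omega) ?_)) hcap
      simpa using hNl
  intro f hf
  rcases List.mem_cons.1 hf with rfl | hf
  · have hs : ∀ a ∈ (forget v k ((Fs.filter fun f => mem v f.1).foldl (join (List.range n) k cap)
        (vertexFactor R v))).1, a ∈ N := fun a ha => by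
      obtain ⟨h1, h2⟩ := List.mem_filter.1 ha
      exact (List.mem_cons.1 (hJ.scope h1)).resolve_left (by simpa using h2)
    refine ⟨⟨hJ.ok, fun a ha => (List.mem_filter.1 (hs a ha)).1, fun e he => ?_⟩, .inl ⟨v, hvB,
      fun a ha => ((mem_bd hr hT).1 (hs a ha)).2⟩⟩
    simp only [forget, List.mem_map, List.mem_filter] at he
    obtain ⟨a, ⟨ha, -⟩, rfl⟩ := he
    exact fun q hq => hJ.label a ha q (List.mem_filter.1 hq).1
  · obtain ⟨hf, hvf⟩ := List.mem_filter.1 hf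
    simp only [Bool.not_eq_true', mem_eq_false] at hvf
    obtain ⟨hfine, hloc⟩ := hF f hf
    refine ⟨⟨hfine.ok, fun a ha => ?_, hfine.label⟩, hloc.imp_left ?_⟩
    · exact (List.mem_cons.1 (hfine.scope ha)).resolve_left (by rintro rfl; exact hvf ha)
    · rintro ⟨u, hu, h⟩
      refine ⟨u, hout hu, fun a ha => ?_⟩
      obtain ⟨y, hy, hya⟩ := h a ha
      exact ⟨y, hy.mono hout, hya⟩

theorem foldl_elim_fine {R k cap : ℕ} (hcap : (2 * (R + 1)) ^ (3 * t + 3) * (k + 1) ≤ cap) :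
    ∀ (A : List ℕ) (Fs : List Factor), A.Nodup → A ⊆ List.range n →
      (∀ B, B <:+ A → narrow E (List.range n) (2 ^ t) (3 * t + 2) B = true) →
      (∀ f ∈ Fs, Fine R A f ∧ Local E n A f) →
      ∀ f ∈ A.foldl (elim (List.range n) k R cap) Fs, Fine R [] f
  | [], _, _, _, _, hF => fun f hf => (hF f hf).1
  | v :: A, Fs, hA, hAV, hnar, hF =>
    foldl_elim_fine hcap A (elim (List.range n) k R cap Fs v) (List.nodup_cons.1 hA).2
      (List.cons_subset.1 hAV).2 (fun B hB => hnar B (hB.trans (List.suffix_cons v A)))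
      (elim_fine hr hT hA (List.mem_range.1 (hAV (by simp))) hF (hnar A (List.suffix_cons v A)) hcap)

theorem total_ok {R k cap : ℕ} {A : List ℕ} (hcap : (2 * (R + 1)) ^ (3 * t + 3) * (k + 1) ≤ cap)
    (hA : A.Perm (List.range n)) (hE : ∀ p ∈ E, p.1 < n ∧ p.2 < n)
    (hnar : ∀ B, B <:+ A → narrow E (List.range n) (2 ^ t) (3 * t + 2) B = true) :
    (total E n k R cap A).2.2 = true := by
  have hAn : A.Nodup := hA.nodup_iff.2 List.nodup_range
  refine (Fine.foldl_join (R := R) (N := []) ⟨rfl, by simp, by simp⟩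
    (foldl_elim_fine hr hT hcap A _ hAn hA.subset hnar fun f hf => ?_) ?_).ok
  · obtain ⟨p, hp, rfl⟩ := List.mem_map.1 hf
    refine ⟨⟨rfl, ?_, fun e he q hq => ?_⟩, .inr ⟨p.1, p.2, rfl, ?_⟩⟩
    · simp [arcFactor, hA.mem_iff, hE p hp]
    · simp only [arcFactor, List.mem_flatMap, List.mem_map, List.mem_range] at he
      obtain ⟨a, ha, b, hb, rfl⟩ := he
      simp only [List.mem_cons, List.not_mem_nil, or_false] at hq
      rcases hq with rfl | rfl
      · exact Nat.le_of_lt_succ ha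
      · exact Nat.le_of_lt_succ hb
    · simp only [Arcs.rel, adj, List.any_eq_true, Bool.and_eq_true, beq_iff_eq]
      exact ⟨p, hp, rfl, rfl⟩
  · refine le_trans (Nat.mul_le_mul_right _ ?_) hcap
    simp only [List.length_nil, pow_zero]
    exact Nat.one_le_pow _ _ (by omega)

end

end Center

/-! ### The answer of the algorithm -/

namespace Center

/-! ### Centers as labellings -/

section labelling
variable {n : ℕ} {G : SimpleGraph (Fin n)} {E : Arcs}

theorem mem_of_adj {E : Arcs} {u v : ℕ} : E.rel u v ↔ (u, v) ∈ E := by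
  simp only [Arcs.rel, adj, List.any_eq_true, Bool.and_eq_true, beq_iff_eq]
  exact ⟨fun ⟨p, hp, h1, h2⟩ => by subst h1 h2; exact hp, fun h => ⟨_, h, rfl, rfl⟩⟩

theorem near_of_walk {u v : Fin n} (p : G.Walk u v) :
    Near (rel G) {x | x < n} p.length u v := by
  induction p with
  | nil => exact ⟨Fin.is_lt _, rfl⟩
  | @cons u v w h p ih =>
    have h1 : Near (rel G) {x | x < n} 1 u v := ⟨u, ⟨u.2, rfl⟩, .inr ⟨u.2, v.2, h⟩, v.2⟩
    rw [SimpleGraph.Walk.length_cons, add_comm]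
    exact h1.trans ih

/-- If one more step never enlarges a ball of radius `L`, these balls are closed under adjacency.
The algorithm checks this itself, so no bound on the tree-depth is needed here. -/
theorem near_of_short {L u v : ℕ} (hs : short E (List.range n) L = true)
    (h : Conn E.rel {x | x < n} u v) : Near E.rel {x | x < n} L u v := by
  have hV : {x | x ∈ List.range n} = {x | x < n} := by ext; simp
  refine h.induction (P := Near E.rel {x | x < n} L u) ?_ fun a b _ ha hab hb => ?_
  · exact Near.le (i := 0) ⟨h.1, rfl⟩ (Nat.zero_le L)
  · simp only [short, List.all_eq_true, mem_iff, List.mem_range] at hs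
    rw [← hV, ← mem_ball] at ha ⊢
    refine hs u h.1 b (mem_expand.2 ⟨List.mem_range.2 hb, .inr ⟨a, ha, hab⟩⟩)

/-- A center is labelled by distances to it; conversely, descending labels lead from each vertex to
one labelled `0`. Cutting `k` and `r` down to `n` keeps all numbers polynomial in unary. -/
theorem hasCenter_iff (hE : E.rel = rel G) {k r L : ℕ}
    (hs : short E (List.range n) L = true) :
    HasCenter G k r ↔ Labelling E n (min k n) (min (min r n) L) := by
  classical
  constructor
  · rintro ⟨K, hK, hd⟩
    have key : ∀ v : Fin n, ∃ d, d ≤ min (min r n) L ∧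
        ∃ u ∈ K, Near (rel G) {x | x < n} d u v := by
      intro v
      by_cases hv : v ∈ K
      · exact ⟨0, Nat.zero_le _, v, hv, v.2, rfl⟩
      obtain ⟨u, hu, h⟩ := hd v hv
      have htop : G.edist u v ≠ ⊤ := ne_top_of_le_ne_top (ENat.natCast_ne_top r) h
      obtain ⟨p, hp⟩ := SimpleGraph.exists_walk_of_edist_ne_top htop
      rw [← hp, Nat.cast_le] at h
      have h1 := near_of_walk p
      have h2 := near_of_walk (p.toPath : G.Walk u v)
      have h3 : (p.toPath : G.Walk u v).length < n := by simpa using p.toPath.2.length_lt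
      have h4 := near_of_short hs (hE ▸ h1.conn)
      rw [hE] at h4
      -- Three bounds on the same distance: `r` by assumption, `n` by a path without repeated
      -- vertices, and `L` by the check `short`.
      rcases min_choice (min r n) L with h | h <;> rw [h]
      · rcases min_choice r n with h | h <;> rw [h]
        · exact ⟨r, le_rfl, u, hu, h1.le ‹_›⟩
        · exact ⟨n, le_rfl, u, hu, h2.le h3.le⟩
      · exact ⟨L, le_rfl, u, hu, h4⟩
    let Q (v d : ℕ) : Prop := ∃ u ∈ K, Near (rel G) {x | x < n} d u v
    let l (v : ℕ) : ℕ := if h : ∃ d, Q v d then Nat.find h else 0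
    have hl {v d : ℕ} (h : Q v d) : l v ≤ d ∧ Q v (l v) := by
      have h' : ∃ d, Q v d := ⟨d, h⟩
      simp only [l, dif_pos h']
      exact ⟨Nat.find_min' h' h, Nat.find_spec h'⟩
    refine ⟨l, fun v hv => ?_, le_min ?_ ?_⟩
    · obtain ⟨d, hd, hq⟩ := key ⟨v, hv⟩
      obtain ⟨h1, h2⟩ := hl (v := v) hq
      refine ⟨h1.trans hd, ?_⟩
      rcases h0 : l v with _ | c
      · exact .inl rfl
      rw [h0] at h2
      obtain ⟨u, hu, y, hy, h, hvn⟩ := h2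
      have hy' := (hl (v := y) ⟨u, hu, hy⟩).1
      rcases h with rfl | h
      · omega
      · exact .inr ⟨y, mem_of_adj.1 (hE ▸ rel_symm G h), by omega⟩
    · refine le_trans ?_ hK
      rw [← Finset.length_toList, ← List.length_map (f := Fin.val)]
      refine length_le_of_subset (List.nodup_range.filter _) fun v hv => ?_
      simp only [List.mem_filter, List.mem_range, beq_iff_eq] at hv
      obtain ⟨d, -, hq⟩ := key ⟨v, hv.1⟩
      have h2 := (hl (v := v) hq).2
      rw [hv.2] at h2
      obtain ⟨u, hu, -, rfl⟩ := h2
      exact List.mem_map.2 ⟨u, Finset.mem_toList.2 hu, rfl⟩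
    · exact (List.length_filter_le _ _).trans (by simp)
  · rintro ⟨l, hl, hk⟩
    refine ⟨Finset.univ.filter fun v : Fin n => l v = 0, le_trans ?_ (hk.trans (min_le_left _ _)),
      fun u _ => ?_⟩
    · rw [← List.toFinset_card_of_nodup (List.nodup_range.filter _)]
      refine Finset.card_le_card_of_injOn Fin.val (fun v hv => ?_) (Fin.val_injective.injOn)
      simpa using hv
    · have key : ∀ d, ∀ u : Fin n, l u = d →
          ∃ v ∈ Finset.univ.filter (fun v : Fin n => l v = 0), G.edist v u ≤ d := by
        intro d
        induction d using Nat.strong_induction_on with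
        | _ d ih =>
          intro u hu
          rcases (hl u u.2).2 with h0 | ⟨y, hy, hlt⟩
          · exact ⟨u, by simpa using h0, by simp⟩
          · rw [← mem_of_adj, hE] at hy
            obtain ⟨hu', hyn, hy⟩ := hy
            obtain ⟨v, hv, hd⟩ := ih _ (hu ▸ hlt) ⟨y, hyn⟩ rfl
            refine ⟨v, hv, (G.edist_triangle (v := ⟨y, hyn⟩)).trans
              ((add_le_add hd (hy.symm.toWalk.edist_le)).trans ?_)⟩
            simp only [SimpleGraph.Walk.length_cons, SimpleGraph.Walk.length_nil]
            exact_mod_cast (by omega : l y + (0 + 1) ≤ d)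
      obtain ⟨v, hv, h⟩ := key _ u rfl
      exact ⟨v, hv, h.trans (Nat.cast_le.2 (((hl u u.2).1.trans (min_le_left _ _)).trans
        (min_le_left _ _)))⟩

end labelling

/-- The entries of the adjacency matrix. -/
def IsMatrix {n : ℕ} (G : SimpleGraph (Fin n)) (X : List ℕ) : Prop :=
  ∀ i j : Fin n, X.getD (i * n + j) 0 ≠ 0 ↔ G.Adj i j

/-! ### Soundness and success of an attempt -/

section attempt
variable {n : ℕ} {G : SimpleGraph (Fin n)} {X : List ℕ} (hX : IsMatrix G X)
include hX

theorem mem_arcs {u v : ℕ} : (u, v) ∈ arcs n X ↔ rel G u v := by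
  simp only [arcs, List.mem_filter, List.mem_flatMap, List.mem_map, List.mem_range, Prod.mk.injEq,
    Bool.not_eq_true', beq_eq_false_iff_ne, rel]
  constructor
  · rintro ⟨⟨_, hu, _, hv, rfl, rfl⟩, h⟩
    exact ⟨hu, hv, (hX ⟨_, hu⟩ ⟨_, hv⟩).1 h⟩
  · rintro ⟨hu, hv, h⟩
    exact ⟨⟨u, hu, v, hv, rfl, rfl⟩, (hX ⟨_, hu⟩ ⟨_, hv⟩).2 h⟩

theorem rel_arcs : (arcs n X).rel = rel G := by
  funext u v
  exact propext (mem_of_adj.trans (mem_arcs hX))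

/-- The parameters `t` and `N` are arbitrary: a bad elimination order only leads to large tables,
and their truncation is recorded and yields the answer `0`. -/
theorem attempt_sound {k r t N : ℕ} (h : attempt (arcs n X) n (min k n) (min r n) t N ≠ 0) :
    (attempt (arcs n X) n (min k n) (min r n) t N = 2 ∧ HasCenter G k r) ∨
      (attempt (arcs n X) n (min k n) (min r n) t N = 1 ∧ ¬ HasCenter G k r) := by
  simp only [attempt, attemptAt] at h ⊢
  cases hs : short (arcs n X) (List.range n) (cappedPow t N)
  · simp [hs] at h
  rw [hs] at h
  rw [hasCenter_iff (rel_arcs hX) hs]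
  simp only [cond_true, verdict, minimum_eq] at h ⊢
  cases hok : (total (arcs n X) n (min k n) (min (min r n) (cappedPow t N)) (N * (n + 1))
    (order (arcs n X) n (cappedPow t N) (2 * t + 1) N t)).2.2
  · exact absurd (by rw [hok]; rfl) h
  · rw [← total_correct (order_perm _ _ _ _ _ _) (fun p hp => ?_) hok]
    · cases (total (arcs n X) n (min k n) (min (min r n) (cappedPow t N)) (N * (n + 1))
        (order (arcs n X) n (cappedPow t N) (2 * t + 1) N t)).2.1 <;> simp
    · obtain ⟨h1, h2, h3⟩ := (mem_arcs hX).1 (show (p.1, p.2) ∈ arcs n X from hp)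
      exact ⟨h1, h2, fun h => h3.ne (Fin.ext h)⟩

/-- The first bound keeps all candidate separators, so the order is narrow; the second, times `n +
1` for the costs, keeps all tables. -/
theorem attempt_ne_zero {k r t N : ℕ} (hT : TD (rel G) t {x | x < n}) (hL : cappedPow t N = 2 ^ t)
    (h1 : (1 + (2 * t + 1) * ((2 * t + 1) * (2 ^ t + 1))) ^ t ≤ N)
    (h2 : (2 * (2 ^ t + 1)) ^ (3 * t + 3) ≤ N) :
    attempt (arcs n X) n (min k n) (min r n) t N ≠ 0 := by
  have hE := rel_arcs hX
  have hr := rel_symm G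
  rw [← hE] at hT hr
  have hs : short (arcs n X) (List.range n) (2 ^ t) = true := by
    have hc : compl (List.range n) [] = List.range n := by simp [compl, mem]
    have hb {v y : ℕ} := mem_ball_compl hr hT (A := []) (v := v) (y := y)
    rw [hc] at hb
    simp only [short, List.all_eq_true, mem_iff, hb, mem_expand]
    rintro v - x ⟨hx, h | ⟨y, hy, h⟩⟩
    · exact h
    · exact hy.tail h (by simpa [out] using hx)
  have hok := total_ok hr hT (k := min k n) (R := min (min r n) (2 ^ t)) (cap := N * (n + 1)) ?_
    (order_perm _ _ _ _ _ _) (fun p hp => ?_) (fun B hB => order_narrow hr hT h1 hB)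
  · simp only [attempt, attemptAt, hL, hs, cond_true, verdict, minimum_eq, hok]
    cases List.isEmpty _ <;> simp
  · refine Nat.mul_le_mul (le_trans (Nat.pow_le_pow_left ?_ _) h2) (by omega)
    have := min_le_right (min r n) (2 ^ t)
    omega
  · obtain ⟨h1, h2, -⟩ := (mem_arcs hX).1 (show (p.1, p.2) ∈ arcs n X from hp)
    exact ⟨h1, h2⟩

theorem answer_sound {k r m N : ℕ} (h : answer (n, min k n, min r n, X) m N ≠ 0) :
    (answer (n, min k n, min r n, X) m N = 2 ∧ HasCenter G k r) ∨
      (answer (n, min k n, min r n, X) m N = 1 ∧ ¬ HasCenter G k r) := by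
  unfold answer at h ⊢
  dsimp only at h ⊢
  rcases headD_mem_or (((List.range (m + 1)).map fun t =>
    attempt (arcs n X) n (min k n) (min r n) t N).filter fun a => !(a == 0)) 0 with h' | h'
  · obtain ⟨h1, -⟩ := List.mem_filter.1 h'
    obtain ⟨t, -, ht⟩ := List.mem_map.1 h1
    rw [← ht] at h ⊢
    exact attempt_sound hX h
  · exact absurd h' h

omit hX in
theorem cappedPow_eq {t N : ℕ} (h : 2 ^ t ≤ N) : cappedPow t N = 2 ^ t := by
  have : ∀ i ≤ t, (fun a => minimum (a + a) N)^[i] 1 = 2 ^ i := by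
    intro i hi
    induction i with
    | zero => rfl
    | succ i ih =>
      have h1 : 2 ^ (i + 1) ≤ 2 ^ t := Nat.pow_le_pow_right (by omega) hi
      rw [Function.iterate_succ_apply', ih (by omega), minimum_eq, pow_succ] at *
      omega
  exact this t le_rfl

-- The first quantity is at most `2 ^ (7 * t ^ 2)`. The second is at most `2 ^ ((t + 2) * (3 * t +
-- 3))`, whose exponent equals `18 * t ^ 2` at `t = 1`; this explains the constant.
omit hX in
theorem caps_le {t : ℕ} (ht : 1 ≤ t) :
    (1 + (2 * t + 1) * ((2 * t + 1) * (2 ^ t + 1))) ^ t ≤ 2 ^ (18 * t ^ 2) ∧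
      (2 * (2 ^ t + 1)) ^ (3 * t + 3) ≤ 2 ^ (18 * t ^ 2) := by
  have hlt : t + 1 ≤ 2 ^ t := Nat.lt_two_pow_self
  have h0 : 1 ≤ 2 ^ t := Nat.one_le_two_pow
  constructor
  · have h1 : 1 + (2 * t + 1) * ((2 * t + 1) * (2 ^ t + 1)) ≤ 2 ^ (7 * t) := by
      have a1 : 2 * t + 1 ≤ 2 ^ (2 * t) := by
        have : 2 * t + 1 ≤ 2 ^ (2 * t) := Nat.lt_two_pow_self
        exact this
      have a2 : 2 ^ t + 1 ≤ 2 ^ (2 * t) := by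
        have : 2 ^ (2 * t) = 2 ^ t * 2 ^ t := by rw [← pow_add]; congr 1; omega
        have : 2 ^ t * 2 ≤ 2 ^ t * 2 ^ t := Nat.mul_le_mul_left _ (by omega)
        omega
      have a3 : (2 * t + 1) * ((2 * t + 1) * (2 ^ t + 1)) ≤ 2 ^ (6 * t) := by
        refine (Nat.mul_le_mul a1 (Nat.mul_le_mul a1 a2)).trans_eq ?_
        rw [← pow_add, ← pow_add]; congr 1; omega
      have a4 : 2 ^ (7 * t) = 2 ^ (6 * t) * 2 ^ t := by rw [← pow_add]; congr 1; omega
      have a5 : 2 ^ (6 * t) * 2 ≤ 2 ^ (6 * t) * 2 ^ t := Nat.mul_le_mul_left _ (by omega)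
      have := Nat.one_le_two_pow (n := 6 * t)
      omega
    refine (Nat.pow_le_pow_left h1 t).trans ?_
    rw [← pow_mul]
    exact Nat.pow_le_pow_right (by omega) (by nlinarith)
  · have h1 : 2 * (2 ^ t + 1) ≤ 2 ^ (t + 2) := by
      have : 2 ^ (t + 2) = 2 ^ t * 4 := pow_add 2 t 2
      omega
    refine (Nat.pow_le_pow_left h1 _).trans ?_
    rw [← pow_mul]
    exact Nat.pow_le_pow_right (by omega) (by nlinarith)

/-- All tree-depths up to `m` are tried, so it suffices that the true one is among them; no square
root of `m / 18` has to be computed. -/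
theorem answer_ne_zero {k r t : ℕ} (ht : 1 ≤ t) (hT : TD (rel G) t {x | x < n}) :
    answer (n, min k n, min r n, X) (18 * t ^ 2) (2 ^ (18 * t ^ 2)) ≠ 0 := by
  have hle : t ≤ 18 * t ^ 2 := by nlinarith
  have h := attempt_ne_zero hX (k := k) (r := r) hT
    (cappedPow_eq (Nat.pow_le_pow_right (by omega) hle)) (caps_le ht).1 (caps_le ht).2
  unfold answer
  dsimp only
  set l := ((List.range (18 * t ^ 2 + 1)).map fun s =>
    attempt (arcs n X) n (min k n) (min r n) s (2 ^ (18 * t ^ 2))).filter fun a => !(a == 0) with hl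
  have hmem : attempt (arcs n X) n (min k n) (min r n) t (2 ^ (18 * t ^ 2)) ∈ l :=
    List.mem_filter.2 ⟨List.mem_map.2 ⟨t, List.mem_range.2 (by omega), rfl⟩, by simpa using h⟩
  have : l.headD 0 ∈ l := by
    cases hc : l with
    | nil => rw [hc] at hmem; simp at hmem
    | cons a l => simp
  simpa using (List.mem_filter.1 this).2

end attempt

end Center

/-! ### The program -/

namespace Center

/-- Search for a bound on the tree-depth that yields an answer, doubling the size of tables. -/
def searchStep (y : ℕ × ℕ × Input × ℕ × ℕ) : ℕ × ℕ × Input × ℕ × ℕ :=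
  let a := answer y.2.2.1 y.2.2.2.1 y.2.2.2.2
  (bif a == 0 then 1 else 0, a - 1, y.2.2.1, y.2.2.2.1 + 1, y.2.2.2.2 + y.2.2.2.2)

theorem searchStep_PT : PT searchStep := by
  have h : PT fun y : ℕ × ℕ × Input × ℕ × ℕ => answer y.2.2.1 y.2.2.2.1 y.2.2.2.2 :=
    answer_PT.comp (f := fun y : ℕ × ℕ × Input × ℕ × ℕ => y.2.2) (by fun_prop)
  unfold searchStep
  fun_prop

/-- The first success occurs at some `m ≤ M`. Each of the `m + 1` rounds is polynomial in the input
and `2 ^ i ≤ 2 ^ M`, and the number of rounds is at most `2 ^ M`, so the whole search is polynomial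
in the size of the input and `2 ^ M`. Subtracting one turns the verdicts `2` and `1` into the
outputs `1` and `0`. -/
theorem exists_search : ∃ (p : Prog) (c : ℕ), ∀ (x : Input) (M : ℕ), answer x M (2 ^ M) ≠ 0 →
    ∃ m d, answer x m (2 ^ m) ≠ 0 ∧ Runs p (enc x)
      (.cons (.atom 0) (.cons (.atom (answer x m (2 ^ m) - 1)) d)) ((sz x + 2 ^ M + 4) ^ c) := by
  obtain ⟨p, T, ⟨c, hT⟩, -, hp⟩ := searchStep_PT
  have hstart : PT fun x : Input => (1, 0, x, 0, 1) := by fun_prop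
  obtain ⟨q, S, ⟨e, hS⟩, -, hq⟩ := hstart
  -- The pair of the input and `2 ^ M` is treated as one argument, so a single exponent bounds
  -- initialization and all rounds.
  have hB : PB fun z : Input × ℕ => (sz z.1 + 2) ^ e +
      ((z.2 + 1) * ((sz z.1 + (2 * z.2 + 14)) ^ c + 4) + 4) := by
    have h1 : PB fun z : Input × ℕ => sz z.1 := PT.size (f := fun z : Input × ℕ => z.1) (by fun_prop)
    have h2 : PB fun z : Input × ℕ => z.2 := PT.value (by fun_prop)
    exact ((h1.add (.const 2)).pow e).add (((h2.add (.const 1)).mul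
      (((h1.add (((PB.const 2).mul h2).add (.const 14))).pow c).add (.const 4))).add (.const 4))
  obtain ⟨c', hB⟩ := hB
  refine ⟨.seq q (.loop (.read 13 (reg 10)) p), c', fun x M hM => ?_⟩
  classical
  have hex : ∃ m, answer x m (2 ^ m) ≠ 0 := ⟨M, hM⟩
  have hm := Nat.find_spec hex
  have hmin {i : ℕ} (hi : i < Nat.find hex) : answer x i (2 ^ i) = 0 := by
    simpa using Nat.find_min hex hi
  have hmM : Nat.find hex ≤ M := Nat.find_min' hex hM
  set m := Nat.find hex
  refine ⟨m, enc (x, m + 1, 2 ^ m + 2 ^ m), hm, ?_⟩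
  have hrun {i : ℕ} (hi : i ≤ m) : Runs p (enc (1, 0, x, i, 2 ^ i)) (enc (searchStep (1, 0, x, i, 2 ^ i)))
      ((sz x + (2 * 2 ^ M + 14)) ^ c) := by
    refine (hp _).mono ((hT _).trans (Nat.pow_le_pow_left ?_ c))
    have h1 : i < 2 ^ i := Nat.lt_two_pow_self
    have h2 : 2 ^ i ≤ 2 ^ M := Nat.pow_le_pow_right (by omega) (hi.trans hmM)
    simp only [sz_prod, sz_nat]
    omega
  have key : ∀ j i, i + j = m → Iterates p ((sz x + (2 * 2 ^ M + 14)) ^ c) (enc (1, 0, x, i, 2 ^ i))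
      (enc (0, answer x m (2 ^ m) - 1, x, m + 1, 2 ^ m + 2 ^ m)) (j + 1) := by
    intro j
    induction j with
    | zero =>
      intro i hi
      obtain rfl : i = m := by omega
      refine .step (fun h => by cases h) (hrun le_rfl) ?_
      have : (answer x m (2 ^ m) == 0) = false := by simpa using hm
      simp only [searchStep, this, cond_false]
      exact Iterates.done _
    | succ j ih =>
      intro i hi
      refine .step (fun h => by cases h) (hrun (by omega)) ?_
      have := ih (i + 1) (by omega)
      simp only [searchStep, hmin (show i < m by omega)]
      rwa [pow_succ, mul_two] at this
  refine ((hq x).comp (key m 0 (by omega)).runs).mono (le_trans ?_ ((hB (x, 2 ^ M)).trans_eq ?_))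
  · refine add_le_add (hS x) (Nat.add_le_add_right (Nat.mul_le_mul_right _ ?_) 4)
    have : m < 2 ^ m := Nat.lt_two_pow_self
    have : 2 ^ m ≤ 2 ^ M := Nat.pow_le_pow_right (by omega) hmM
    dsimp only
    omega
  · simp only [sz_prod, sz_nat]
    congr 1

/-! ### Reading the input and the total running time -/

/-- Put the value of an expression in front of the accumulator. -/
def consAtom (e : Expr) : List (ℕ × Expr × Expr) :=
  [(13, reg 12, e), (14, reg 12, reg 10), (10, .lit 0, reg 12), (12, .lit 0, .add (reg 12) (.lit 1))]

theorem exec_consAtom (e : Expr) {σ : State} {d : Data} (h0 : 0 < σ 12 0) (h : Rep σ (σ 10 0) d) :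
    ∃ τ, Exec (assign (consAtom e)) σ τ (e.cost + 19) ∧ 0 < τ 12 0 ∧
      Rep τ (τ 10 0) (.cons (.atom (e.eval σ)) d) ∧
      ∀ b, b ∉ [10, 12, 13, 14] → τ b = σ b := by
  have hE : Ext σ (assigned (consAtom e) σ) := by
    refine ⟨?_, fun w hw => ?_⟩ <;> simp [consAtom, assigned, State.store, Expr.eval]
    exact ⟨fun h => absurd h hw.ne, fun h => absurd h hw.ne⟩
  have h12 : assigned (consAtom e) σ 12 0 = σ 12 0 + 1 := by
    simp [consAtom, assigned, State.store, Expr.eval]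
  have h10 : assigned (consAtom e) σ 10 0 = σ 12 0 := by
    simp [consAtom, assigned, State.store, Expr.eval]
  have h13 : assigned (consAtom e) σ 13 (σ 12 0) = e.eval σ := by
    simp [consAtom, assigned, State.store, Expr.eval]
  have h14 : assigned (consAtom e) σ 14 (σ 12 0) = σ 10 0 := by
    simp [consAtom, assigned, State.store, Expr.eval]
  refine ⟨assigned (consAtom e) σ, ?_, by omega, ?_, fun b hb => ?_⟩
  · convert exec_assign (consAtom e) σ using 1
    simp [consAtom, assignCost, Expr.cost]; omega
  · rw [h10]
    refine ⟨h0, by omega, h13, ?_⟩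
    rw [h14]; exact h.mono hE
  · simp only [List.mem_cons, List.not_mem_nil, or_false, not_or] at hb
    funext i
    simp [consAtom, assigned, State.store, hb]

/-- Read an array of the length given in bank `17` from bank `3` into the accumulator. -/
def readArray : Prog :=
  .loop (reg 17) (.seq (.write 17 (.lit 0) (.sub (reg 17) (.lit 1)))
    (assign (consAtom (.read 3 (reg 17)))))

/-- Putting elements in front reverses their order, so the array is read from its last cell
downwards. -/
theorem exec_readArray (q : ℕ) : ∀ (σ : State) (l : List ℕ), σ 17 0 = q → 0 < σ 12 0 →
    Rep σ (σ 10 0) (enc l) → ∃ τ t, Exec readArray σ τ t ∧ t ≤ q * 40 + 3 ∧ 0 < τ 12 0 ∧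
      Rep τ (τ 10 0) (enc ((List.range q).map (σ 3) ++ l)) ∧
      ∀ b, b ∉ [10, 12, 13, 14, 17] → τ b = σ b := by
  induction q with
  | zero =>
    intro σ l h17 h0 hl
    exact ⟨σ, _, .loop_done h17, by simp [Expr.cost], h0, by simpa using hl, fun _ _ => rfl⟩
  | succ q ih =>
    intro σ l h17 h0 hl
    set σ₁ := σ.store 17 0 q with hσ₁
    have hσ : σ.store 17 ((Expr.lit 0).eval σ) ((Expr.sub (reg 17) (.lit 1)).eval σ) = σ₁ := by
      simp [Expr.eval, h17, hσ₁]
    have hf {b i : ℕ} (hb : b ≠ 17) : σ₁ b i = σ b i := by simp [hσ₁, State.store, hb]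
    have hE : Ext σ σ₁ := ⟨by simp [hf], fun w _ => by simp [hf]⟩
    obtain ⟨τ, x1, x2, x3, x4⟩ := exec_consAtom (.read 3 (reg 17)) (σ := σ₁) (d := enc l)
      (by simpa [hf] using h0) (by rw [hf (by omega)]; exact hl.mono hE)
    have hv : (Expr.read 3 (reg 17)).eval σ₁ = σ 3 q := by
      simp [Expr.eval, hσ₁, State.store]
    rw [hv] at x3
    have x17 : τ 17 0 = q := by rw [x4 17 (by simp)]; simp [hσ₁, State.store]
    obtain ⟨υ, t, y1, y2, y3, y4, y5⟩ := ih τ (σ 3 q :: l) x17 x2 x3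
    have h3 : τ 3 = σ 3 := by
      rw [x4 3 (by simp)]; funext i; exact hf (by omega)
    refine ⟨υ, _, .loop_step (by simp [Expr.eval, h17]) (.seq (.write _ _ _ _) (hσ ▸ x1)) y1, ?_, y3,
      ?_, fun b hb => ?_⟩
    · simp only [Expr.cost]; omega
    · rw [h3] at y4
      simpa [List.range_succ] using y4
    · rw [y5 b hb]
      simp only [List.mem_cons, List.not_mem_nil, or_false, not_or] at hb
      rw [x4 b (by simp [hb])]
      funext i; exact hf hb.2.2.2.2

/-- Add the product of the numbers in the banks `0` and `16` to that in bank `17`. -/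
def addMul : Prog :=
  .loop (reg 16) (assign [(17, .lit 0, .add (reg 17) (reg 0)), (16, .lit 0, .sub (reg 16) (.lit 1))])

theorem exec_addMul (q : ℕ) : ∀ σ : State, σ 16 0 = q → ∃ τ t, Exec addMul σ τ t ∧ t ≤ q * 20 + 3 ∧
    τ 17 0 = σ 17 0 + q * σ 0 0 ∧ ∀ b, b ∉ [16, 17] → τ b = σ b := by
  induction q with
  | zero =>
    intro σ h
    exact ⟨σ, _, .loop_done h, by simp [Expr.cost], by simp, fun _ _ => rfl⟩
  | succ q ih =>
    intro σ h
    set l : List (ℕ × Expr × Expr) :=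
      [(17, .lit 0, .add (reg 17) (reg 0)), (16, .lit 0, .sub (reg 16) (.lit 1))] with hl
    have h16 : assigned l σ 16 0 = q := by simp [hl, assigned, State.store, Expr.eval, h]
    have h17 : assigned l σ 17 0 = σ 17 0 + σ 0 0 := by simp [hl, assigned, State.store, Expr.eval]
    have hf (b : ℕ) (hb : b ∉ [16, 17]) : assigned l σ b = σ b := by
      simp only [List.mem_cons, List.not_mem_nil, or_false, not_or] at hb
      funext i
      simp [hl, assigned, State.store, hb]
    obtain ⟨τ, t, x1, x2, x3, x4⟩ := ih _ h16
    refine ⟨τ, _, .loop_step (by simp [Expr.eval, h]) (exec_assign l σ) x1, ?_, ?_,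
      fun b hb => (x4 b hb).trans (hf b hb)⟩
    · simp [hl, assignCost, Expr.cost]; omega
    · rw [x3, h17, hf 0 (by simp)]; ring

/-- Read the input into the accumulator. -/
def readInput : Prog :=
  .seq (assign [(12, .lit 0, .lit 1), (16, .lit 0, reg 0)])
    (.seq addMul (.seq readArray
      (.seq (assign (consAtom (.sub (reg 2) (.sub (reg 2) (reg 0)))))
        (.seq (assign (consAtom (.sub (reg 1) (.sub (reg 1) (reg 0)))))
          (assign (consAtom (reg 0)))))))

/-- The heap top starts at `1`, since address `0` is reserved for the empty list. The number of
matrix cells is found by repeated addition, and `k` and `r` are replaced by their minima with `n`.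
-/
theorem exec_readInput (σ : State) (h : ∀ b, b ∉ [0, 1, 2, 3] → σ b 0 = 0) :
    ∃ τ t, Exec readInput σ τ t ∧ t ≤ 200 * (σ 0 0 + 1) ^ 2 ∧ 0 < τ 12 0 ∧ Rep τ (τ 10 0) (enc
      (σ 0 0, min (σ 1 0) (σ 0 0), min (σ 2 0) (σ 0 0), (List.range (σ 0 0 * σ 0 0)).map (σ 3))) := by
  set n := σ 0 0 with hn
  set l : List (ℕ × Expr × Expr) := [(12, .lit 0, .lit 1), (16, .lit 0, reg 0)] with hl
  have a16 : assigned l σ 16 0 = n := by simp [hl, assigned, State.store, Expr.eval, hn]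
  have a12 : assigned l σ 12 0 = 1 := by simp [hl, assigned, State.store, Expr.eval]
  have af (b : ℕ) (hb : b ∉ [12, 16]) : assigned l σ b = σ b := by
    simp only [List.mem_cons, List.not_mem_nil, or_false, not_or] at hb
    funext i
    simp [hl, assigned, State.store, hb]
  obtain ⟨σ₂, t₂, b1, b2, b3, b4⟩ := exec_addMul n _ a16
  have h17 : σ₂ 17 0 = n * n := by
    rw [b3, af 17 (by simp), af 0 (by simp), h 17 (by simp), zero_add]
  have h10 : σ₂ 10 0 = 0 := by rw [b4 10 (by simp), af 10 (by simp), h 10 (by simp)]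
  have h12 : σ₂ 12 0 = 1 := by rw [b4 12 (by simp), a12]
  obtain ⟨σ₃, t₃, c1, c2, c3, c4, c5⟩ := exec_readArray _ σ₂ [] h17 (by omega) h10
  have f3 (b : ℕ) (hb : b ∈ [0, 1, 2, 3]) : σ₃ b = σ b := by
    simp only [List.mem_cons, List.not_mem_nil, or_false] at hb
    rw [c5, b4, af] <;> simp <;> omega
  rw [List.append_nil, b4 3 (by simp), af 3 (by simp)] at c4
  obtain ⟨σ₄, d1, d2, d3, d4⟩ := exec_consAtom (.sub (reg 2) (.sub (reg 2) (reg 0))) c3 c4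
  obtain ⟨σ₅, e1, e2, e3, e4⟩ := exec_consAtom (.sub (reg 1) (.sub (reg 1) (reg 0))) d2 d3
  obtain ⟨σ₆, f1, f2, f3', -⟩ := exec_consAtom (reg 0) e2 e3
  refine ⟨σ₆, _, (exec_assign l σ).seq (b1.seq (c1.seq (d1.seq (e1.seq f1)))), ?_, f2, ?_⟩
  · have hsq : 200 * (n + 1) ^ 2 = 200 * (n * n) + 400 * n + 200 := by ring
    simp only [hl, assignCost, Expr.cost]
    omega
  · have v0 : (reg 0).eval σ₅ = n := by
      simp [Expr.eval, e4 0, d4 0, f3 0, hn]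
    have v1 : (Expr.sub (reg 1) (.sub (reg 1) (reg 0))).eval σ₄ = min (σ 1 0) n := by
      simp only [Expr.eval, d4 0 (by simp), d4 1 (by simp), f3 0 (by simp), f3 1 (by simp)]
      omega
    have v2 : (Expr.sub (reg 2) (.sub (reg 2) (reg 0))).eval σ₃ = min (σ 2 0) n := by
      simp only [Expr.eval, f3 0 (by simp), f3 2 (by simp)]
      omega
    rw [v0, v1, v2] at f3'
    exact f3'

theorem inputState_three {n : ℕ} (G : SimpleGraph (Fin n)) (k r q : ℕ)
    [Decidable (∃ i j : Fin n, G.Adj i j ∧ q = i * n + j)] :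
    inputState G k r 3 q = if ∃ i j : Fin n, G.Adj i j ∧ q = i * n + j then 1 else 0 := by
  simp [inputState]

theorem isMatrix_inputState {n : ℕ} (G : SimpleGraph (Fin n)) (k r : ℕ) :
    IsMatrix G ((List.range (n * n)).map (inputState G k r 3)) := by
  intro i j
  have hlt : (i : ℕ) * n + j < n * n := by
    have h1 : ((i : ℕ) + 1) * n ≤ n * n := Nat.mul_le_mul_right _ i.2
    have h2 := j.2
    rw [add_mul] at h1; omega
  have hget : ((List.range (n * n)).map (inputState G k r 3)).getD (i * n + j) 0 =
      inputState G k r 3 (i * n + j) := by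
    simp [List.getD_eq_getElem?_getD, hlt]
  classical
  rw [hget, inputState_three, ne_eq, ite_eq_right_iff, Classical.not_imp]
  constructor
  · rintro ⟨⟨i', j', hadj, he⟩, -⟩
    -- The remainder modulo `n` recovers the column, and then the row, from the index.
    have hn : 0 < n := i.pos
    have hj : (j : ℕ) = j' := by
      have := congrArg (· % n) he
      simpa [Nat.mod_eq_of_lt j.2, Nat.mod_eq_of_lt j'.2] using this
    have hi : (i : ℕ) = i' := by
      have : (i : ℕ) * n = i' * n := by omega
      exact Nat.eq_of_mul_eq_mul_right hn this
    rwa [Fin.ext hi, Fin.ext hj]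
  · exact fun h => ⟨⟨i, j, h, rfl⟩, one_ne_zero⟩

theorem sz_input_le {n : ℕ} (G : SimpleGraph (Fin n)) (k r : ℕ) :
    sz ((n, min k n, min r n, (List.range (n * n)).map (inputState G k r 3)) : Input) ≤
      7 * (n + 1) ^ 2 := by
  have h1 : sz ((List.range (n * n)).map (inputState G k r 3)) ≤
      ((List.range (n * n)).map (inputState G k r 3)).length * (2 + 1) + 1 := by
    refine sz_list_le fun a ha => ?_
    obtain ⟨q, -, rfl⟩ := List.mem_map.1 ha
    classical
    rw [sz_nat, inputState_three]
    split_ifs <;> omega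
  rw [List.length_map, List.length_range] at h1
  have h2 : 7 * (n + 1) ^ 2 = 7 * (n * n) + 14 * n + 7 := by ring
  simp only [sz_prod, sz_nat]
  omega

/-- Since `18 * (d + 1) ^ 2 ≤ 36 * d ^ 2 + 36`, the part of the exponent that remains at tree-depth
`0` is a constant and goes into the polynomial factor. -/
theorem time_le (n d c M : ℕ) (hM : M = 18 * (d + 1) ^ 2) :
    200 * (n + 1) ^ 2 + ((7 * (n + 1) ^ 2 + 2 ^ M + 4) ^ c + 10) ≤
      2 ^ ((36 * c) * d ^ 2) * ((210 + 12 ^ c * 2 ^ (36 * c)) * (n + 1) ^ (2 * c + 2)) := by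
  have hA : 1 ≤ (n + 1) ^ 2 := Nat.one_le_pow _ _ (by omega)
  have hB : 1 ≤ 2 ^ M := Nat.one_le_two_pow
  have h1 : 7 * (n + 1) ^ 2 + 2 ^ M + 4 ≤ 12 * ((n + 1) ^ 2 * 2 ^ M) := by
    have := Nat.mul_le_mul_left ((n + 1) ^ 2) hB
    have := Nat.mul_le_mul_right (2 ^ M) hA
    omega
  have h2 : (7 * (n + 1) ^ 2 + 2 ^ M + 4) ^ c ≤
      2 ^ ((36 * c) * d ^ 2) * ((12 ^ c * 2 ^ (36 * c)) * (n + 1) ^ (2 * c + 2)) := by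
    calc _ ≤ (12 * ((n + 1) ^ 2 * 2 ^ M)) ^ c := Nat.pow_le_pow_left h1 c
      _ = 12 ^ c * 2 ^ (M * c) * (n + 1) ^ (2 * c) := by
        rw [mul_pow, mul_pow, ← pow_mul, ← pow_mul]; ring
      _ ≤ 12 ^ c * 2 ^ (36 * c * d ^ 2 + 36 * c) * (n + 1) ^ (2 * c + 2) := by
        refine Nat.mul_le_mul (Nat.mul_le_mul_left _ (Nat.pow_le_pow_right (by omega) ?_))
          (Nat.pow_le_pow_right (by omega) (by omega))
        have h3 : M ≤ 36 * d ^ 2 + 36 := by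
          rw [hM]; zify; nlinarith [sq_nonneg ((d : ℤ) - 1)]
        calc M * c ≤ (36 * d ^ 2 + 36) * c := Nat.mul_le_mul_right _ h3
          _ = _ := by ring
      _ = _ := by rw [pow_add]; ring
  have h3 : 200 * (n + 1) ^ 2 + 10 ≤ 2 ^ ((36 * c) * d ^ 2) * (210 * (n + 1) ^ (2 * c + 2)) := by
    have h4 : (n + 1) ^ 2 ≤ (n + 1) ^ (2 * c + 2) := Nat.pow_le_pow_right (by omega) (by omega)
    have h5 := Nat.mul_le_mul_right (210 * (n + 1) ^ (2 * c + 2))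
      (Nat.one_le_two_pow (n := (36 * c) * d ^ 2))
    omega
  rw [add_mul 210, mul_add]
  omega

end Center

open Classical in
theorem mainTheorem7 :
    ∃ (P : RAM.Prog) (C : ℕ), ∀ (n : ℕ) (G : SimpleGraph (Fin n)) (k r : ℕ),
      ∃ (τ : RAM.State) (t : ℕ),
        RAM.Exec P (inputState G k r) τ t ∧
        τ 0 0 = (if HasCenter G k r then 1 else 0) ∧
        t ≤ 2 ^ (C * treeDepth G ^ 2) * (C * (n + 1) ^ C) := by
  obtain ⟨p, c, hp⟩ := Center.exists_search
  set C := 36 * c + (210 + 12 ^ c * 2 ^ (36 * c)) + (2 * c + 2) with hC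
  refine ⟨.seq Center.readInput (.seq p (.write 0 (.lit 0) (.read 13 (.read 14 (reg 10))))), C,
    fun n G k r => ?_⟩
  have hX := Center.isMatrix_inputState G k r
  obtain ⟨σ, s, x1, x2, x3, x4⟩ := Center.exec_readInput (inputState G k r) fun b hb => by
    simp only [List.mem_cons, List.not_mem_nil, or_false, not_or] at hb
    simp [inputState, hb]
  have hn : inputState G k r 0 0 = n := rfl
  have hk : inputState G k r 1 0 = k := rfl
  have hr : inputState G k r 2 0 = r := rfl
  rw [hn, hk, hr] at x4
  rw [hn] at x2
  have hne := Center.answer_ne_zero hX (k := k) (r := r) (Nat.le_add_left 1 (treeDepth G))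
    (Center.td_treeDepth G)
  obtain ⟨m, d, ha, hrun⟩ := hp _ _ hne
  obtain ⟨τ, t, y1, y2, -, -, y3⟩ := hrun σ x3 x4
  refine ⟨_, _, x1.seq (y1.seq (.write _ _ _ _)), ?_, ?_⟩
  · have hv : (Expr.read 13 (.read 14 (reg 10))).eval τ = _ := y3.2.2.2.2.2.1
    rw [hv]
    simp only [RAM.State.store, Expr.eval, and_self, if_true]
    rcases Center.answer_sound hX ha with ⟨h1, h2⟩ | ⟨h1, h2⟩
    · rw [h1, if_pos h2]
    · rw [h1, if_neg h2]
  · have h1 := y2.trans (Nat.pow_le_pow_left (Nat.add_le_add_right (Nat.add_le_add_right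
      (Center.sz_input_le G k r) _) 4) c)
    have h2 := Center.time_le n (treeDepth G) c _ rfl
    simp only [Expr.cost]
    refine le_trans (by omega) (h2.trans ?_)
    refine Nat.mul_le_mul (Nat.pow_le_pow_right (by omega) (Nat.mul_le_mul_right _ (by omega)))
      (Nat.mul_le_mul (by omega) (Nat.pow_le_pow_right (by omega) (by omega)))
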